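/- Let $M_1,M_2$ be connected, paracompact, Hausdorff smooth manifolds of positive dimension with smooth linear connections $\nabla_1,\nabla_2$. For a manifold $M$ with linear connection $\nabla$, let $T'M$ be the tangent bundle less the zero section, let $PM$ be the quotient of $T'M$ in which proportional vectors at each point are identified, and let the space of geodesics $G(M)$ be the topological quotient of $PM$ in which two tangent lines are identified if they lie on the lift of a common geodesic. Say that $G(M)$ is *locally Euclidean* if, with its quotient topology, it carries the structure of a smooth locally Euclidean space (a smooth atlas of charts onto open subsets of some $\mathbb{R}^k$; neither Hausdorff nor paracompact is required) for which the natural projection $PM\to G(M)$ (equivalently $T'M\to G(M)$) is a smooth submersion. A *closed geodesic* is a nonconstant geodesic $\gamma$ whose image is a closed curve, i.e. for which $\gamma(s)=\gamma(t)$ and $\gamma'(t)=c\,\gamma'(s)$ for some $s\neq t$ and some real $c\neq 0$. Theorem. Suppose that $G(M_1)$ and $G(M_2)$ are locally Euclidean. Then $G(M_1\times M_2)$, formed with the product connection $\nabla_1\times\nabla_2$, is locally Euclidean if and only if neither $(M_1,\nabla_1)$ nor $(M_2,\nabla_2)$ has a closed geodesic. -/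

import Mathlib

open Bundle Set Filter
open scoped Manifold ContDiff Topology

/-! ### The product of two linear connections -/

section ProductConnection

variable {E₁ : Type*} [NormedAddCommGroup E₁] [NormedSpace ℝ E₁]
  {H₁ : Type*} [TopologicalSpace H₁] {I₁ : ModelWithCorners ℝ E₁ H₁}
  {M₁ : Type*} [TopologicalSpace M₁] [ChartedSpace H₁ M₁]
  {E₂ : Type*} [NormedAddCommGroup E₂] [NormedSpace ℝ E₂]
  {H₂ : Type*} [TopologicalSpace H₂] {I₂ : ModelWithCorners ℝ E₂ H₂}
  {M₂ : Type*} [TopologicalSpace M₂] [ChartedSpace H₂ M₂]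

/-- The component tangent to the first factor of a vector field on `M₁ × M₂`. -/
def fstComp (σ : Π p : M₁ × M₂, TangentSpace (I₁.prod I₂) p) (p : M₁ × M₂) :
    TangentSpace I₁ p.1 :=
  (σ p : E₁ × E₂).1

/-- The component tangent to the second factor of a vector field on `M₁ × M₂`. -/
def sndComp (σ : Π p : M₁ × M₂, TangentSpace (I₁.prod I₂) p) (p : M₁ × M₂) :
    TangentSpace I₂ p.2 :=
  (σ p : E₁ × E₂).2

/-- The formula for the product connection `∇₁ × ∇₂`. For a vector field `σ = (σ₁, σ₂)` on
`M₁ × M₂` and `u = (u₁, u₂)` tangent at `p = (p₁, p₂)`, the first component of `∇_u σ` is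
`∇₁_{u₁} (σ₁(·, p₂))` plus the derivative in the direction `u₂` of the map
`y ↦ σ₁(p₁, y)` from `M₂` to the fixed vector space `T_{p₁} M₁`; similarly for the second one. -/
noncomputable def prodCovAux
    (c₁ : (Π x : M₁, TangentSpace I₁ x) → (Π x : M₁, TangentSpace I₁ x →L[ℝ] TangentSpace I₁ x))
    (c₂ : (Π y : M₂, TangentSpace I₂ y) → (Π y : M₂, TangentSpace I₂ y →L[ℝ] TangentSpace I₂ y))
    (σ : Π p : M₁ × M₂, TangentSpace (I₁.prod I₂) p) (p : M₁ × M₂) :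
    TangentSpace (I₁.prod I₂) p →L[ℝ] TangentSpace (I₁.prod I₂) p :=
  (((c₁ (fun x => fstComp σ (x, p.2)) p.1 : E₁ →L[ℝ] E₁).coprod
      (mvfderiv I₂ (fun y : M₂ => (fstComp σ (p.1, y) : E₁)) p.2 : E₂ →L[ℝ] E₁)).prod
    ((mvfderiv I₁ (fun x : M₁ => (sndComp σ (x, p.2) : E₂)) p.1 : E₁ →L[ℝ] E₂).coprod
      (c₂ (fun y => sndComp σ (p.1, y)) p.2 : E₂ →L[ℝ] E₂)) :
    E₁ × E₂ →L[ℝ] E₁ × E₂)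

lemma fstComp_prodCovAux
    (c₁ : (Π x : M₁, TangentSpace I₁ x) → (Π x : M₁, TangentSpace I₁ x →L[ℝ] TangentSpace I₁ x))
    (c₂ : (Π y : M₂, TangentSpace I₂ y) → (Π y : M₂, TangentSpace I₂ y →L[ℝ] TangentSpace I₂ y))
    (σ : Π p : M₁ × M₂, TangentSpace (I₁.prod I₂) p) (p : M₁ × M₂)
    (u₁ : TangentSpace I₁ p.1) (u₂ : TangentSpace I₂ p.2) :
    (prodCovAux c₁ c₂ σ p ((u₁, u₂) : E₁ × E₂) : E₁ × E₂).1 =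
      c₁ (fun x => fstComp σ (x, p.2)) p.1 u₁ +
        (show TangentSpace I₁ p.1 from
          mvfderiv I₂ (fun y : M₂ => (fstComp σ (p.1, y) : E₁)) p.2 u₂) :=
  rfl

lemma sndComp_prodCovAux
    (c₁ : (Π x : M₁, TangentSpace I₁ x) → (Π x : M₁, TangentSpace I₁ x →L[ℝ] TangentSpace I₁ x))
    (c₂ : (Π y : M₂, TangentSpace I₂ y) → (Π y : M₂, TangentSpace I₂ y →L[ℝ] TangentSpace I₂ y))
    (σ : Π p : M₁ × M₂, TangentSpace (I₁.prod I₂) p) (p : M₁ × M₂)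
    (u₁ : TangentSpace I₁ p.1) (u₂ : TangentSpace I₂ p.2) :
    (prodCovAux c₁ c₂ σ p ((u₁, u₂) : E₁ × E₂) : E₁ × E₂).2 =
      (show TangentSpace I₂ p.2 from
          mvfderiv I₁ (fun x : M₁ => (sndComp σ (x, p.2) : E₂)) p.1 u₁) +
        c₂ (fun y => sndComp σ (p.1, y)) p.2 u₂ :=
  rfl

lemma mdifferentiableAt_slice_left (p : M₁ × M₂) :
    MDifferentiableAt I₁ (I₁.prod I₂) (fun x : M₁ => (x, p.2)) p.1 :=
  mdifferentiableAt_id.prodMk mdifferentiableAt_const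

lemma mdifferentiableAt_slice_right (p : M₁ × M₂) :
    MDifferentiableAt I₂ (I₁.prod I₂) (fun y : M₂ => (p.1, y)) p.2 :=
  mdifferentiableAt_const.prodMk mdifferentiableAt_id

variable [IsManifold I₁ ∞ M₁] [IsManifold I₂ ∞ M₂]

lemma mdifferentiableAt_fstComp {σ : Π p : M₁ × M₂, TangentSpace (I₁.prod I₂) p} {p : M₁ × M₂}
    (h : MDiffAt (T% σ) p) :
    MDifferentiableAt (I₁.prod I₂) I₁.tangent
      (fun q => (⟨q.1, fstComp σ q⟩ : TangentBundle I₁ M₁)) p := by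
  have h3 : MDiff (tangentMap (I₁.prod I₂) I₁ (@Prod.fst M₁ M₂)) :=
    ((contMDiff_fst (n := ∞)).contMDiff_tangentMap (m := 1) (by norm_cast)).mdifferentiable
      (by simp)
  have h4 := (h3 _).comp p h
  refine h4.congr_of_eventuallyEq (Eventually.of_forall fun q => ?_)
  rw [Function.comp_apply, tangentMap_prodFst]
  rfl

lemma mdifferentiableAt_sndComp {σ : Π p : M₁ × M₂, TangentSpace (I₁.prod I₂) p} {p : M₁ × M₂}
    (h : MDiffAt (T% σ) p) :
    MDifferentiableAt (I₁.prod I₂) I₂.tangent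
      (fun q => (⟨q.2, sndComp σ q⟩ : TangentBundle I₂ M₂)) p := by
  have h3 : MDiff (tangentMap (I₁.prod I₂) I₂ (@Prod.snd M₁ M₂)) :=
    ((contMDiff_snd (n := ∞)).contMDiff_tangentMap (m := 1) (by norm_cast)).mdifferentiable
      (by simp)
  have h4 := (h3 _).comp p h
  refine h4.congr_of_eventuallyEq (Eventually.of_forall fun q => ?_)
  rw [Function.comp_apply, tangentMap_prodSnd]
  rfl

lemma mdifferentiableAt_fstComp_left {σ : Π p : M₁ × M₂, TangentSpace (I₁.prod I₂) p}
    {p : M₁ × M₂} (h : MDiffAt (T% σ) p) :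
    MDiffAt (T% (fun x => fstComp σ (x, p.2))) p.1 :=
  MDifferentiableAt.comp (I' := I₁.prod I₂) p.1 (f := fun x : M₁ => (x, p.2))
    (mdifferentiableAt_fstComp h) (mdifferentiableAt_slice_left p)

lemma mdifferentiableAt_sndComp_right {σ : Π p : M₁ × M₂, TangentSpace (I₁.prod I₂) p}
    {p : M₁ × M₂} (h : MDiffAt (T% σ) p) :
    MDiffAt (T% (fun y => sndComp σ (p.1, y))) p.2 :=
  MDifferentiableAt.comp (I' := I₁.prod I₂) p.2 (f := fun y : M₂ => (p.1, y))
    (mdifferentiableAt_sndComp h) (mdifferentiableAt_slice_right p)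

lemma mdifferentiableAt_fstComp_right {σ : Π p : M₁ × M₂, TangentSpace (I₁.prod I₂) p}
    {p : M₁ × M₂} (h : MDiffAt (T% σ) p) :
    MDifferentiableAt I₂ 𝓘(ℝ, E₁) (fun y : M₂ => (fstComp σ (p.1, y) : E₁)) p.2 := by
  have h1 : MDifferentiableAt I₂ I₁.tangent
      (fun y : M₂ => (⟨p.1, fstComp σ (p.1, y)⟩ : TangentBundle I₁ M₁)) p.2 :=
    MDifferentiableAt.comp (I' := I₁.prod I₂) p.2 (f := fun y : M₂ => (p.1, y))
      (mdifferentiableAt_fstComp h) (mdifferentiableAt_slice_right p)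
  have h2 := ((mdifferentiableAt_totalSpace _ _).1 h1).2
  refine h2.congr_of_eventuallyEq (Eventually.of_forall fun y => ?_)
  exact ((tangentBundleCore I₁ M₁).coordChange_self (achart _ p.1) p.1
    (mem_chart_source H₁ p.1) (fstComp σ (p.1, y))).symm

lemma mdifferentiableAt_sndComp_left {σ : Π p : M₁ × M₂, TangentSpace (I₁.prod I₂) p}
    {p : M₁ × M₂} (h : MDiffAt (T% σ) p) :
    MDifferentiableAt I₁ 𝓘(ℝ, E₂) (fun x : M₁ => (sndComp σ (x, p.2) : E₂)) p.1 := by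
  have h1 : MDifferentiableAt I₁ I₂.tangent
      (fun x : M₁ => (⟨p.2, sndComp σ (x, p.2)⟩ : TangentBundle I₂ M₂)) p.1 :=
    MDifferentiableAt.comp (I' := I₁.prod I₂) p.1 (f := fun x : M₁ => (x, p.2))
      (mdifferentiableAt_sndComp h) (mdifferentiableAt_slice_left p)
  have h2 := ((mdifferentiableAt_totalSpace _ _).1 h1).2
  refine h2.congr_of_eventuallyEq (Eventually.of_forall fun x => ?_)
  exact ((tangentBundleCore I₂ M₂).coordChange_self (achart _ p.2) p.2
    (mem_chart_source H₂ p.2) (sndComp σ (x, p.2))).symm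

/-- The product connection `∇₁ × ∇₂` on `M₁ × M₂`. -/
noncomputable def prodConnection
    (cov₁ : CovariantDerivative I₁ E₁ (TangentSpace I₁ : M₁ → Type _))
    (cov₂ : CovariantDerivative I₂ E₂ (TangentSpace I₂ : M₂ → Type _)) :
    CovariantDerivative (I₁.prod I₂) (E₁ × E₂)
      (TangentSpace (I₁.prod I₂) : M₁ × M₂ → Type _) where
  toFun := prodCovAux cov₁ cov₂
  isCovariantDerivativeOnUniv :=
    { add := by
        intro σ σ' p hσ hσ' _
        have a := cov₁.isCovariantDerivativeOnUniv.add (mdifferentiableAt_fstComp_left hσ)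
          (mdifferentiableAt_fstComp_left hσ')
        have b := mvfderiv_add (mdifferentiableAt_fstComp_right hσ)
          (mdifferentiableAt_fstComp_right hσ')
        have c := mvfderiv_add (mdifferentiableAt_sndComp_left hσ)
          (mdifferentiableAt_sndComp_left hσ')
        have d := cov₂.isCovariantDerivativeOnUniv.add (mdifferentiableAt_sndComp_right hσ)
          (mdifferentiableAt_sndComp_right hσ')
        refine ContinuousLinearMap.ext fun u => ?_
        refine Prod.ext (?_ : (_ : E₁) = _) (?_ : (_ : E₂) = _)
        · have a' := congrArg (fun L => L u.1) a
          have b' := congrArg (fun L => L u.2) b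
          exact (congrArg₂ (fun x y : E₁ => x + y) a' b').trans (add_add_add_comm _ _ _ _)
        · have c' := congrArg (fun L => L u.1) c
          have d' := congrArg (fun L => L u.2) d
          exact (congrArg₂ (fun x y : E₂ => x + y) c' d').trans (add_add_add_comm _ _ _ _)
      leibniz := by
        intro σ g p hσ hg _
        have gl : MDifferentiableAt I₁ 𝓘(ℝ, ℝ) (fun x : M₁ => g (x, p.2)) p.1 :=
          MDifferentiableAt.comp (I' := I₁.prod I₂) p.1 (f := fun x : M₁ => (x, p.2)) hg
            (mdifferentiableAt_slice_left p)
        have gr : MDifferentiableAt I₂ 𝓘(ℝ, ℝ) (fun y : M₂ => g (p.1, y)) p.2 :=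
          MDifferentiableAt.comp (I' := I₁.prod I₂) p.2 (f := fun y : M₂ => (p.1, y)) hg
            (mdifferentiableAt_slice_right p)
        have a := cov₁.isCovariantDerivativeOnUniv.leibniz (mdifferentiableAt_fstComp_left hσ) gl
        have b := mvfderiv_smul gr (mdifferentiableAt_fstComp_right hσ)
        have c := mvfderiv_smul gl (mdifferentiableAt_sndComp_left hσ)
        have d := cov₂.isCovariantDerivativeOnUniv.leibniz (mdifferentiableAt_sndComp_right hσ) gr
        have key : ∀ u : E₁ × E₂, (mvfderiv (I₁.prod I₂) g p u : ℝ) =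
            mvfderiv I₁ (fun x : M₁ => g (x, p.2)) p.1 u.1 +
              mvfderiv I₂ (fun y : M₂ => g (p.1, y)) p.2 u.2 := by
          intro u
          exact mfderiv_prod_eq_add_apply hg
        refine ContinuousLinearMap.ext fun u => ?_
        refine Prod.ext (?_ : (_ : E₁) = _) (?_ : (_ : E₂) = _)
        · have a' := congrArg (fun L => L u.1) a
          have b' := congrArg (fun L => L u.2) b
          refine (congrArg₂ (fun x y : E₁ => x + y) a' b').trans ?_
          have k : (mvfderiv (I₁.prod I₂) g p u : ℝ) • (fstComp σ p : E₁) =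
              mvfderiv I₁ (fun x : M₁ => g (x, p.2)) p.1 u.1 • (fstComp σ p : E₁) +
              mvfderiv I₂ (fun y : M₂ => g (p.1, y)) p.2 u.2 • (fstComp σ p : E₁) := by
            rw [← add_smul, key u]
          refine Eq.trans ?_ (congrArg₂ (fun x y : E₁ => x + y)
            (smul_add (g p) (_ : E₁) (_ : E₁)).symm k.symm)
          exact add_add_add_comm _ _ _ _
        · have c' := congrArg (fun L => L u.1) c
          have d' := congrArg (fun L => L u.2) d
          refine (congrArg₂ (fun x y : E₂ => x + y) c' d').trans ?_
          have k : (mvfderiv (I₁.prod I₂) g p u : ℝ) • (sndComp σ p : E₂) =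
              mvfderiv I₁ (fun x : M₁ => g (x, p.2)) p.1 u.1 • (sndComp σ p : E₂) +
              mvfderiv I₂ (fun y : M₂ => g (p.1, y)) p.2 u.2 • (sndComp σ p : E₂) := by
            rw [← add_smul, key u]
          refine Eq.trans ?_ (congrArg₂ (fun x y : E₂ => x + y)
            (smul_add (g p) (_ : E₂) (_ : E₂)).symm k.symm)
          exact add_add_add_comm _ _ _ _ }

end ProductConnection

/-! ### Geodesics -/

section Geodesics

variable {E : Type*} [NormedAddCommGroup E] [NormedSpace ℝ E]
  {H : Type*} [TopologicalSpace H] {I : ModelWithCorners ℝ E H}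
  {M : Type*} [TopologicalSpace M] [ChartedSpace H M] [IsManifold I ∞ M]

/-- The velocity vector `γ'(t)` of a curve `γ` in `M`. -/
noncomputable def velocity (I : ModelWithCorners ℝ E H) {M : Type*} [TopologicalSpace M]
    [ChartedSpace H M] (γ : ℝ → M) (t : ℝ) : TangentSpace I (γ t) :=
  mfderiv 𝓘(ℝ, ℝ) I γ t (1 : ℝ)

/-- The vector field near `x` which is constant, equal to `v`, in the preferred chart at `x`. -/
noncomputable def coordField (x : M) (v : TangentSpace I x) (y : M) : TangentSpace I y :=
  (trivializationAt E (TangentSpace I : M → Type _) x).symm y (v : E)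

/-- The second derivative at time `t` of `γ` read in the preferred chart at `γ t`. -/
noncomputable def coordAccel (I : ModelWithCorners ℝ E H) {M : Type*} [TopologicalSpace M]
    [ChartedSpace H M] (γ : ℝ → M) (t : ℝ) : TangentSpace I (γ t) :=
  (iteratedDeriv 2 (fun s => extChartAt I (γ t) (γ s) : ℝ → E) t : E)

/-- The covariant acceleration `∇_{γ'} γ'` at time `t`. In the coordinates given by the preferred
chart at `γ t` it is `(γᵏ)'' + Γᵏᵢⱼ (γⁱ)' (γʲ)'`: the last sum is the covariant derivative in the
direction `γ'(t)` of the vector field whose components in this chart are constant and equal to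
those of `γ'(t)`. -/
noncomputable def covAccel (cov : CovariantDerivative I E (TangentSpace I : M → Type _))
    (γ : ℝ → M) (t : ℝ) : TangentSpace I (γ t) :=
  coordAccel I γ t + cov (coordField (γ t) (velocity I γ t)) (γ t) (velocity I γ t)

/-- `γ`, restricted to the open interval `J`, is an (affinely parametrized, possibly constant)
geodesic of the connection `cov`. -/
structure IsGeodesicOn (cov : CovariantDerivative I E (TangentSpace I : M → Type _))
    (γ : ℝ → M) (J : Set ℝ) : Prop where
  isOpen : IsOpen J
  ordConnected : J.OrdConnected
  contMDiffOn : ContMDiffOn 𝓘(ℝ, ℝ) I 2 γ J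
  covAccel_eq_zero : ∀ t ∈ J, covAccel cov γ t = 0

end Geodesics

/-! ### The projective tangent bundle and the space of geodesics -/

section SpaceOfGeodesics

variable {E : Type*} [NormedAddCommGroup E] [NormedSpace ℝ E]
  {H : Type*} [TopologicalSpace H] (I : ModelWithCorners ℝ E H)
  (M : Type*) [TopologicalSpace M] [ChartedSpace H M] [IsManifold I ∞ M]

lemma isOpen_tangent_ne_zero : IsOpen {v : TangentBundle I M | v.2 ≠ 0} := by
  rw [isOpen_iff_mem_nhds]
  intro v hv
  set e := trivializationAt E (TangentSpace I : M → Type _) v.1 with he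
  have hb : v.1 ∈ e.baseSet := mem_baseSet_trivializationAt E (TangentSpace I : M → Type _) v.1
  have hs : v ∈ e.source := e.mem_source.2 hb
  have hev : (e v).2 = v.2 := (tangentBundleCore I M).coordChange_self (achart _ v.1) v.1
    (mem_chart_source H v.1) v.2
  have hc : ContinuousAt (fun w => (e w).2) v :=
    continuous_snd.continuousAt.comp (e.continuousOn.continuousAt (e.open_source.mem_nhds hs))
  have hne : ∀ᶠ w in 𝓝 v, (e w).2 ≠ 0 :=
    hc.eventually_ne (by rw [hev]; exact hv)
  filter_upwards [hne, e.open_source.mem_nhds hs] with w hw hws h0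
  apply hw
  have hwb : w.1 ∈ e.baseSet := e.mem_source.1 hws
  have hz := congrArg Prod.snd (e.zeroSection ℝ hwb)
  have hw' : w = zeroSection E (TangentSpace I : M → Type _) w.1 := by
    obtain ⟨x, w⟩ := w
    exact congrArg _ h0
  rw [hw']
  exact hz

/-- The reduced tangent bundle `T'M`: the tangent bundle less the zero section, as an open
submanifold of the tangent bundle. -/
def ReducedTangentBundle : TopologicalSpace.Opens (TangentBundle I M) :=
  ⟨{v | v.2 ≠ 0}, isOpen_tangent_ne_zero I M⟩

/-- Two nonzero tangent vectors are identified if they are proportional. -/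
def proportionalSetoid : Setoid (ReducedTangentBundle I M) where
  r v w := ∃ c : ℝ, c ≠ 0 ∧ w.1 = ⟨v.1.1, c • v.1.2⟩
  iseqv :=
    { refl := fun v => ⟨1, one_ne_zero, by simp⟩
      symm := by
        rintro ⟨⟨x, v⟩, hv⟩ ⟨w, hw⟩ ⟨c, hc, h⟩
        simp only at h
        subst h
        exact ⟨c⁻¹, inv_ne_zero hc, by simp [smul_smul, hc]⟩
      trans := by
        rintro ⟨⟨x, v⟩, hv⟩ ⟨w, hw⟩ ⟨z, hz⟩ ⟨c, hc, h⟩ ⟨d, hd, h'⟩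
        simp only at h h'
        subst h
        subst h'
        exact ⟨d * c, mul_ne_zero hd hc, by simp [smul_smul]⟩ }

/-- The projective tangent bundle `PM`, whose points are the tangent lines of `M`, with the
quotient topology. -/
abbrev ProjTangentBundle : Type _ := Quotient (proportionalSetoid I M)

variable {I M}

/-- The tangent line of the curve `γ` at time `t` is defined and equal to `ℓ`. -/
def IsTangentLine (γ : ℝ → M) (t : ℝ) (ℓ : ProjTangentBundle I M) : Prop :=
  ∃ h : velocity I γ t ≠ 0,
    (Quotient.mk _ (⟨⟨γ t, velocity I γ t⟩, h⟩ : ReducedTangentBundle I M)) = ℓ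

/-- Two tangent lines lie on the lift to `PM` of a common geodesic. -/
def OnCommonGeodesic (cov : CovariantDerivative I E (TangentSpace I : M → Type _))
    (ℓ ℓ' : ProjTangentBundle I M) : Prop :=
  ∃ (γ : ℝ → M) (J : Set ℝ), IsGeodesicOn cov γ J ∧
    ∃ s ∈ J, ∃ t ∈ J, IsTangentLine γ s ℓ ∧ IsTangentLine γ t ℓ'

/-- The space `G(M)` of unoriented geodesics: the quotient of `PM` obtained by identifying tangent
lines that lie on the lift of a common geodesic, with the quotient topology. -/
abbrev GeodesicSpace (cov : CovariantDerivative I E (TangentSpace I : M → Type _)) : Type _ :=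
  Quot (OnCommonGeodesic cov)

/-- The natural projection `T'M → PM → G(M)`. -/
def geodesicProj (cov : CovariantDerivative I E (TangentSpace I : M → Type _))
    (v : ReducedTangentBundle I M) : GeodesicSpace cov :=
  Quot.mk _ (Quotient.mk _ v)

/-- `G(M)` is locally Euclidean: its quotient topology admits an atlas of charts in some `ℝᵏ`
which makes it a smooth (not necessarily Hausdorff) manifold, with the quotient differentiable
structure, that is, such that the natural projection onto `G(M)` is a smooth submersion. (The
projection `T'M → PM` being a surjective submersion, it is the same to ask this from `T'M` or from
`PM`.) -/
def GeodesicSpaceLocallyEuclidean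
    (cov : CovariantDerivative I E (TangentSpace I : M → Type _)) : Prop :=
  ∃ (k : ℕ) (_ : ChartedSpace (EuclideanSpace ℝ (Fin k)) (GeodesicSpace cov)),
    IsManifold (𝓡 k) ∞ (GeodesicSpace cov) ∧
    Manifold.IsSubmersion I.tangent (𝓡 k) ∞ (geodesicProj cov)

/-- The connection has a closed geodesic: a nonconstant geodesic whose image is a closed curve,
that is, which returns to the same tangent line at two different times. (The two velocity vectors
need only be proportional.) -/
def HasClosedGeodesic (cov : CovariantDerivative I E (TangentSpace I : M → Type _)) : Prop :=
  ∃ (γ : ℝ → M) (J : Set ℝ), IsGeodesicOn cov γ J ∧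
    ∃ s ∈ J, ∃ t ∈ J, s ≠ t ∧
      ∃ ℓ : ProjTangentBundle I M, IsTangentLine γ s ℓ ∧ IsTangentLine γ t ℓ

end SpaceOfGeodesics

/-! ### The inverse function theorem on an open set -/

/-! Locally, `G(M)` is a manifold with submersive projection exactly when every nonzero tangent
vector lies in a chart of the tangent bundle in which geodesic classes are the fibres of a
surjective linear map onto one fixed `ℝᵏ` (`LinearQuotientChart`). One direction is the normal form
of a submersion. Conversely, the geodesic flow and the dilations carry any vector of a class to any
other by a local smooth map that preserves classes (`HasFlow.exists_transport`). Hence the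
projection is open and the charts induced on the quotient have smooth transitions
(`exists_isManifold_isSubmersion`). Geodesics of the product are pairs of geodesics with a common
parameter, so everything becomes a question about the classes of `PairRel` on the product of the two
tangent bundles.

Necessity (`not_hasClosedGeodesic_of_exists_linearQuotientChart`). Suppose that a geodesic of the
first factor returns after time `T ≠ 0` to `c` times its initial velocity `v₁`. Take `w = (p, u)`
with `u ≠ 0`, and follow the pair `(v₁, r w)` for time `T`. After division by `c`, the first
component is `v₁` again, while the base point of the second one has moved from `p` by about `r T u`.
Both pairs are in one class and tend to `(v₁, 0_p)` as `r → 0`, so in a linearizing chart the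
difference of the two derivatives at `r = 0` lies in the kernel of the linear map. The straight line
in that direction stays in the class of `(v₁, 0_p)`, where the second base point is always `p`,
because a geodesic with zero velocity is constant. Hence `T u = 0`, a contradiction.

Sufficiency. Near a nonzero `v₁`, every vector is obtained from a vector of a slice, parametrized by
`ℝᵏ`, by flowing for a time and dilating by a factor, both smooth functions of the vector
(`HasFlow.exists_geodesicSlice`). This requires `k + 2 = 2 dim M₁`, that is, classes of dimension
exactly two. They have dimension at least two because of flow and dilation. They have no more
because a geodesic crosses a hypersurface transversally at countably many times only, and a
submersion with countable fibre is an immersion. A pair near `(v₁, v₂)` can then be moved by the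
flow and dilation of the product until its first component is in the slice. If the first factor has
no closed geodesic, two related pairs with the same nonzero first component coincide
(`PairRel.snd_eq_of_fst_eq`), so the position in the slice together with the moved second component
is a complete smooth invariant with a local section, and it can be linearized
(`exists_linearQuotientChart_of_section`). A nonzero vector of the product has a nonzero component,
and the two factors play symmetric roles.

Of the connections themselves only `HasFlow` is used: uniqueness of geodesics and a smooth local
flow. It passes to products, and for the factors it comes from smooth dependence of solutions of
differential equations on initial data, which is obtained from the inverse function theorem in a
space of continuous curves. -/

section InverseFunction

variable {E F : Type*} [NormedAddCommGroup E] [NormedSpace ℝ E] [CompleteSpace E]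
  [NormedAddCommGroup F] [NormedSpace ℝ F]

/-- The smooth inverse function theorem, with a local inverse smooth on an open set. -/
lemma exists_openPartialHomeomorph_contDiffOn_symm {f : E → F} {U : Set E} (hU : IsOpen U)
    (hf : ContDiffOn ℝ ∞ f U) {a : E} (ha : a ∈ U) (f' : E ≃L[ℝ] F)
    (hf' : HasFDerivAt f (f' : E →L[ℝ] F) a) :
    ∃ e : OpenPartialHomeomorph E F, a ∈ e.source ∧ e.source ⊆ U ∧ (∀ x, e x = f x) ∧
      ContDiffOn ℝ ∞ e.symm e.target := by
  have hfa : ContDiffAt ℝ ∞ f a := hf.contDiffAt (hU.mem_nhds ha)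
  have hc : ContinuousOn (fderiv ℝ f) U := hf.continuousOn_fderiv_of_isOpen hU (by simp)
  -- Invertibility of the derivative is an open condition. Restricting to `V` makes the inverse
  -- smooth on the whole target instead of at the image of `a` alone.
  set V : Set E := U ∩ fderiv ℝ f ⁻¹' range ((↑) : (E ≃L[ℝ] F) → E →L[ℝ] F)
  have hV : IsOpen V := hc.isOpen_inter_preimage hU ContinuousLinearEquiv.isOpen
  have haV : a ∈ V := ⟨ha, f', hf'.fderiv.symm⟩
  set e₀ := hfa.toOpenPartialHomeomorph f hf' (by simp)
  refine ⟨e₀.restrOpen V hV, ?_, ?_, fun x => rfl, ?_⟩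
  · simpa using ⟨hfa.mem_toOpenPartialHomeomorph_source hf' (by simp), haV⟩
  · intro x hx
    rw [OpenPartialHomeomorph.restrOpen_source] at hx
    exact hx.2.1
  · intro y hy
    have hx := (e₀.restrOpen V hV).map_target hy
    have hx' := hx
    rw [OpenPartialHomeomorph.restrOpen_source] at hx'
    obtain ⟨g, hg⟩ := hx'.2.2
    refine (OpenPartialHomeomorph.contDiffAt_symm _ (f₀' := g) hy ?_ ?_).contDiffWithinAt
    · rw [hg]
      exact ((hf.contDiffAt (hU.mem_nhds hx'.2.1)).differentiableAt (by simp)).hasFDerivAt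
    · exact hf.contDiffAt (hU.mem_nhds hx'.2.1)

end InverseFunction

/-! ### Smoothness of composition operators on spaces of continuous curves -/

section Composition

set_option synthInstance.maxHeartbeats 200000

universe u
variable {K : Type*} [TopologicalSpace K] [CompactSpace K]
  {A F G : Type u} [NormedAddCommGroup A] [NormedSpace ℝ A]
  [NormedAddCommGroup F] [NormedSpace ℝ F]
  [NormedAddCommGroup G] [NormedSpace ℝ G]

/-- The pointwise application of a continuous bilinear map to continuous functions. -/
noncomputable def pointwiseBilinₗ (B : A →L[ℝ] F →L[ℝ] G) : C(K, A) →ₗ[ℝ] C(K, F) →ₗ[ℝ] C(K, G) :=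
  LinearMap.mk₂ ℝ
    (fun (a : C(K, A)) (h : C(K, F)) => (⟨fun t => B (a t) (h t), by fun_prop⟩ : C(K, G)))
    (fun A B h => by ext; simp) (fun c A h => by ext; simp)
    (fun A h k => by ext; simp) (fun c A h => by ext; simp)

lemma norm_pointwiseBilinₗ_le (B : A →L[ℝ] F →L[ℝ] G) (a : C(K, A)) (h : C(K, F)) :
    ‖pointwiseBilinₗ B a h‖ ≤ ‖B‖ * ‖a‖ * ‖h‖ := by
  refine (ContinuousMap.norm_le _ (by positivity)).2 fun t => ?_
  exact (B.le_opNorm₂ _ _).trans (by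
    gcongr
    · exact a.norm_coe_le_norm t
    · exact h.norm_coe_le_norm t)

/-- The pointwise application of a continuous bilinear map to continuous functions, as a continuous
bilinear map. -/
noncomputable def pointwiseBilin (B : A →L[ℝ] F →L[ℝ] G) : C(K, A) →L[ℝ] C(K, F) →L[ℝ] C(K, G) :=
  LinearMap.mkContinuous₂ (pointwiseBilinₗ B) ‖B‖ (norm_pointwiseBilinₗ_le B)

/-- The derivative of `X` is uniformly continuous at the compact range of `γ`, so the mean value
inequality bounds the remainder with one constant for all points of `K`. -/
lemma hasFDerivAt_comp_continuousMap {X : F → G} (hX : ContDiff ℝ 1 X) (γ : C(K, F)) :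
    HasFDerivAt (fun η : C(K, F) => (⟨X, hX.continuous⟩ : C(F, G)).comp η)
      (pointwiseBilin (.id ℝ _) ((⟨fderiv ℝ X, hX.continuous_fderiv (by simp)⟩ : C(F, F →L[ℝ] G)).comp γ))
      γ := by
  rw [hasFDerivAt_iff_isLittleO, Asymptotics.isLittleO_iff]
  intro c hc
  have hK : IsCompact (range γ) := isCompact_range γ.continuous
  have hu := hK.uniformContinuousAt_of_continuousAt (fderiv ℝ X)
    (fun a _ => (hX.continuous_fderiv (by simp)).continuousAt) (Metric.dist_mem_uniformity hc)
  obtain ⟨δ, hδ, H⟩ := Metric.mem_uniformity_dist.1 hu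
  filter_upwards [Metric.ball_mem_nhds γ hδ] with η hη
  refine (ContinuousMap.norm_le _ (by positivity)).2 fun t => ?_
  have h1 : η t ∈ Metric.ball (γ t) δ := (ContinuousMap.dist_apply_le_dist t).trans_lt hη
  have h2 := (convex_ball (γ t) δ).norm_image_sub_le_of_norm_fderiv_le' (𝕜 := ℝ) (f := X)
    (φ := fderiv ℝ X (γ t)) (C := c) (fun x _ => (hX.differentiable (by simp)) x)
    (fun x hx => by
      have := H (a := γ t) (b := x) (by rw [dist_comm]; exact hx) (mem_range_self t)
      have h3 : dist (fderiv ℝ X (γ t)) (fderiv ℝ X x) < c := this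
      rw [dist_comm, dist_eq_norm] at h3
      exact h3.le)
    (Metric.mem_ball_self hδ) h1
  refine h2.trans ?_
  exact mul_le_mul_of_nonneg_left ((η - γ).norm_coe_le_norm t) hc.le

/-- By the formula for the derivative, differentiating the operator of composition with `X` gives
that of composition with `fderiv ℝ X`, followed by a bounded linear map. The induction varies `G`
because the new values lie in `F →L[ℝ] G`, whence the single universe. -/
lemma contDiff_comp_continuousMap_nat (n : ℕ) : ∀ {G : Type u} [NormedAddCommGroup G]
    [NormedSpace ℝ G] {X : F → G} (hX : ContDiff ℝ n X),
    ContDiff ℝ n (fun η : C(K, F) => (⟨X, hX.continuous⟩ : C(F, G)).comp η) := by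
  induction n with
  | zero =>
    intro G _ _ X hX
    exact contDiff_zero.2 (ContinuousMap.continuous_postcomp _)
  | succ n ih =>
    intro G _ _ X hX
    have h1 : ContDiff ℝ 1 X := hX.of_le (by norm_cast; omega)
    have h2 : ContDiff ℝ n (fderiv ℝ X) := hX.fderiv_right (by norm_cast)
    refine contDiff_succ_iff_hasFDerivAt.2 ⟨_, ?_, fun γ => hasFDerivAt_comp_continuousMap h1 γ⟩
    exact (pointwiseBilin (K := K) (.id ℝ (F →L[ℝ] G))).contDiff.comp (ih h2)

lemma contDiff_comp_continuousMap {X : F → G} (hX : ContDiff ℝ ∞ X) :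
    ContDiff ℝ ∞ (fun η : C(K, F) => (⟨X, hX.continuous⟩ : C(F, G)).comp η) :=
  contDiff_infty.2 fun n => contDiff_comp_continuousMap_nat n (contDiff_infty.1 hX n)

end Composition

/-! ### Smooth dependence of the flow of a vector field on the initial condition -/

section Flow

universe u
variable {F : Type u} [NormedAddCommGroup F] [NormedSpace ℝ F]

/-- The primitive vanishing at `0` of a continuous curve. -/
noncomputable def curvePrimitive [CompleteSpace F] : C(unitInterval, F) →L[ℝ] C(unitInterval, F) :=
  LinearMap.mkContinuous
    { toFun := fun γ => ⟨fun t => ∫ s in (0 : ℝ)..t, IccExtend (zero_le_one' ℝ) γ s, by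
        have : Continuous (fun t : ℝ => ∫ s in (0 : ℝ)..t, IccExtend (zero_le_one' ℝ) γ s) :=
          intervalIntegral.continuous_primitive
            (fun a b => (γ.continuous.Icc_extend').intervalIntegrable a b) 0
        fun_prop⟩
      map_add' := fun γ η => by
        ext t
        exact intervalIntegral.integral_add ((γ.continuous.Icc_extend').intervalIntegrable _ _)
          ((η.continuous.Icc_extend').intervalIntegrable _ _)
      map_smul' := fun c γ => by
        ext t
        exact intervalIntegral.integral_smul c _ } 1 (by
    intro γ
    rw [one_mul]
    refine (ContinuousMap.norm_le _ (by positivity)).2 fun t => ?_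
    refine (intervalIntegral.norm_integral_le_of_norm_le_const (C := ‖γ‖) fun s _ =>
      γ.norm_coe_le_norm _).trans ?_
    refine mul_le_of_le_one_right (norm_nonneg _) ?_
    rw [sub_zero, abs_of_nonneg t.2.1]
    exact t.2.2)

lemma curvePrimitive_apply [CompleteSpace F] (γ : C(unitInterval, F)) (t : unitInterval) :
    curvePrimitive γ t = ∫ s in (0 : ℝ)..t, IccExtend (zero_le_one' ℝ) γ s := rfl

/-- The solutions `γ` of `γ = x + ε ∫ X(γ)` near a constant one depend smoothly on `(x, ε)`. -/
lemma exists_contDiffOn_integral_equation [CompleteSpace F] {X : F → F} (hX : ContDiff ℝ ∞ X)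
    (x₀ : F) :
    ∃ (W : Set (F × ℝ)) (Γ : F × ℝ → C(unitInterval, F)), IsOpen W ∧ (x₀, 0) ∈ W ∧
      ContDiffOn ℝ ∞ Γ W ∧ ∀ p ∈ W, Γ p = ContinuousMap.const _ p.1 +
        p.2 • curvePrimitive ((⟨X, hX.continuous⟩ : C(F, F)).comp (Γ p)) := by
  set Ω : C(unitInterval, F) → C(unitInterval, F) := fun η => (⟨X, hX.continuous⟩ : C(F, F)).comp η
  have hΩ : ContDiff ℝ ∞ Ω := contDiff_comp_continuousMap hX
  set k : F →L[ℝ] C(unitInterval, F) := ContinuousLinearMap.const ℝ unitInterval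
  have hk : ∀ x, k x = ContinuousMap.const _ x := fun x => rfl
  -- Solutions are the points where the second component vanishes. Keeping the parameters as first
  -- component turns the implicit problem into the inversion of `f`.
  set f : (F × ℝ) × C(unitInterval, F) → (F × ℝ) × C(unitInterval, F) :=
    fun q => (q.1, q.2 - k q.1.1 - q.1.2 • curvePrimitive (Ω q.2)) with hf
  have hfs : ContDiff ℝ ∞ f := by
    have h1 : ContDiff ℝ ∞ (fun q : (F × ℝ) × C(unitInterval, F) => Ω q.2) := hΩ.comp contDiff_snd
    have h2 : ContDiff ℝ ∞ (fun q : (F × ℝ) × C(unitInterval, F) => curvePrimitive (Ω q.2)) :=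
      (curvePrimitive (F := F)).contDiff.comp h1
    fun_prop
  set γ₀ := k x₀
  set A : F × ℝ →L[ℝ] C(unitInterval, F) := k.comp (ContinuousLinearMap.fst ℝ F ℝ) +
    (ContinuousLinearMap.snd ℝ F ℝ).smulRight (curvePrimitive (Ω γ₀)) with hA
  -- At `ε = 0` the integral term contributes no derivative in the curve, so the derivative is
  -- triangular with identities on the diagonal, and changing the sign of `A` inverts it.
  let f' : ((F × ℝ) × C(unitInterval, F)) ≃L[ℝ] ((F × ℝ) × C(unitInterval, F)) :=
    ContinuousLinearEquiv.equivOfInverse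
      ((ContinuousLinearMap.fst ℝ _ _).prod
        (ContinuousLinearMap.snd ℝ _ _ - A.comp (ContinuousLinearMap.fst ℝ _ _)))
      ((ContinuousLinearMap.fst ℝ _ _).prod
        (ContinuousLinearMap.snd ℝ _ _ + A.comp (ContinuousLinearMap.fst ℝ _ _)))
      (fun q => by simp) (fun q => by simp)
  have hf' : HasFDerivAt f (f' : _ →L[ℝ] _) ((x₀, 0), γ₀) := by
    have h1 : HasFDerivAt (fun q : (F × ℝ) × C(unitInterval, F) => curvePrimitive (Ω q.2))
        ((curvePrimitive.comp (fderiv ℝ Ω γ₀)).comp (ContinuousLinearMap.snd ℝ _ _))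
        ((x₀, 0), γ₀) :=
      HasFDerivAt.comp (f := Prod.snd) ((x₀, (0 : ℝ)), γ₀) ((curvePrimitive (F := F)).hasFDerivAt.comp γ₀
        (hΩ.differentiable (by simp) γ₀).hasFDerivAt) hasFDerivAt_snd
    have h2 : HasFDerivAt (fun q : (F × ℝ) × C(unitInterval, F) => q.1.2)
        ((ContinuousLinearMap.snd ℝ F ℝ).comp (ContinuousLinearMap.fst ℝ _ _)) ((x₀, 0), γ₀) :=
      hasFDerivAt_snd.comp _ hasFDerivAt_fst
    have h3 : HasFDerivAt (fun q : (F × ℝ) × C(unitInterval, F) => k q.1.1)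
        ((k.comp (ContinuousLinearMap.fst ℝ F ℝ)).comp (ContinuousLinearMap.fst ℝ _ _))
        ((x₀, 0), γ₀) := ((k.comp (ContinuousLinearMap.fst ℝ F ℝ)).comp
          (ContinuousLinearMap.fst ℝ (F × ℝ) C(unitInterval, F))).hasFDerivAt
    refine (hasFDerivAt_fst.prodMk ((hasFDerivAt_snd.sub h3).sub (h2.smul h1))).congr_fderiv ?_
    refine ContinuousLinearMap.ext fun q => Prod.ext rfl ?_
    simp [f', hA, sub_sub]
  obtain ⟨e, hae, -, hef, hes⟩ := exists_openPartialHomeomorph_contDiffOn_symm isOpen_univ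
    hfs.contDiffOn (mem_univ ((x₀, (0 : ℝ)), γ₀)) f' hf'
  have hfa : f ((x₀, 0), γ₀) = ((x₀, 0), 0) := by simp [hf, γ₀]
  refine ⟨(fun p => (p, (0 : C(unitInterval, F)))) ⁻¹' e.target,
    fun p => (e.symm (p, 0)).2, e.open_target.preimage (by fun_prop), ?_, ?_, ?_⟩
  · have := e.map_source hae
    rwa [hef, hfa] at this
  · exact contDiff_snd.comp_contDiffOn
      (hes.comp (contDiff_id.prodMk contDiff_const).contDiffOn fun p hp => hp)
  · intro p hp
    have h1 := e.right_inv hp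
    rw [hef, hf] at h1
    have h2 : (e.symm (p, 0)).1 = p := congrArg Prod.fst h1
    have h3 := congrArg Prod.snd h1
    simp only [h2] at h3
    rw [sub_sub, sub_eq_zero] at h3
    exact h3

/-- The flow of a globally Lipschitz smooth vector field is smooth. -/
lemma exists_contDiffOn_flow_of_lipschitz [CompleteSpace F] {X : F → F} (hX : ContDiff ℝ ∞ X)
    {K : NNReal} (hL : LipschitzWith K X) (x₀ : F) :
    ∃ r > 0, ∃ ε > 0, ∃ φ : F → ℝ → F,
      ContDiffOn ℝ ∞ (fun p : F × ℝ => φ p.1 p.2) (Metric.ball x₀ r ×ˢ Ioo (-ε) ε) ∧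
      ∀ x ∈ Metric.ball x₀ r, φ x 0 = x ∧
        ∀ t ∈ Ioo (-ε) ε, HasDerivAt (φ x) (X (φ x t)) t := by
  obtain ⟨W, Γ, hWo, hW0, hΓ, hΓe⟩ := exists_contDiffOn_integral_equation hX x₀
  obtain ⟨r₁, hr₁, ε₁, hε₁, H⟩ :=
    ContDiffAt.exists_forall_mem_closedBall_exists_eq_forall_mem_Ioo_hasDerivAt
      (f := X) (x₀ := x₀) (hX.contDiffAt.of_le (by simp)) 0
  choose! α hα0 hα using H
  obtain ⟨r₂, hr₂, hW⟩ := Metric.isOpen_iff.1 hWo _ hW0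
  refine ⟨min r₁ r₂, by positivity, min ε₁ r₂, by positivity, α, ?_, fun x hx => ⟨?_, ?_⟩⟩
  · have hsub : Metric.ball x₀ (min r₁ r₂) ×ˢ Ioo (-min ε₁ r₂) (min ε₁ r₂) ⊆ W := by
      refine Subset.trans ?_ hW
      rw [← ball_prod_same]
      refine prod_mono (Metric.ball_subset_ball (min_le_right _ _)) ?_
      rw [Real.ball_eq_Ioo]
      refine Ioo_subset_Ioo ?_ ?_ <;> simp
    have hev : ContDiffOn ℝ ∞ (fun p : F × ℝ => Γ p 1)
        (Metric.ball x₀ (min r₁ r₂) ×ˢ Ioo (-min ε₁ r₂) (min ε₁ r₂)) :=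
      (ContinuousMap.evalCLM (M := F) ℝ (1 : unitInterval)).contDiff.comp_contDiffOn (hΓ.mono hsub)
    refine hev.congr ?_
    rintro ⟨x, t⟩ hp
    have hpW := hΓe _ (hsub hp)
    have hx : x ∈ Metric.closedBall x₀ r₁ :=
      Metric.ball_subset_closedBall (Metric.ball_subset_ball (min_le_left _ _) hp.1)
    have ht : |t| < ε₁ := by
      rw [abs_lt]
      exact ⟨by have := hp.2.1; have := min_le_left ε₁ r₂; simp only at *; linarith,
        by have := hp.2.2; have := min_le_left ε₁ r₂; simp only at *; linarith⟩
    set γ := Γ (x, t) with hγ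
    set γe := IccExtend (zero_le_one' ℝ) γ with hγe
    have hγc : Continuous γe := γ.continuous.Icc_extend'
    -- The right side of the integral equation, with the curve extended by constants, is
    -- differentiable at every time, including the ends of `[0, 1]`, and equals the fixed point
    -- there.
    set g : ℝ → F := fun s => x + t • ∫ τ in (0 : ℝ)..s, X (γe τ) with hg
    have hgd : ∀ s, HasDerivAt g (t • X (γe s)) s := fun s =>
      ((intervalIntegral.integral_hasDerivAt_right
        ((hX.continuous.comp hγc).intervalIntegrable _ _)
        ((hX.continuous.comp hγc).stronglyMeasurableAtFilter _ _)
        (hX.continuous.comp hγc).continuousAt).const_smul t).const_add x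
    have hgγ : ∀ s ∈ Icc (0 : ℝ) 1, g s = γe s := by
      intro s hs
      have h1 := congrArg (fun c : C(unitInterval, F) => c ⟨s, hs⟩) hpW
      have h2 : γe s = γ ⟨s, hs⟩ := IccExtend_of_mem _ _ hs
      rw [h2]
      refine Eq.trans ?_ h1.symm
      simp only [ContinuousMap.add_apply, ContinuousMap.const_apply, ContinuousMap.smul_apply,
        curvePrimitive_apply, hg]
      rfl
    have hst : ∀ s ∈ Icc (0 : ℝ) 1, t * s ∈ Ioo (0 - ε₁) (0 + ε₁) := by
      intro s hs
      have h1 : |t * s| < ε₁ := by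
        rw [abs_mul, abs_of_nonneg hs.1]
        exact (mul_le_of_le_one_right (abs_nonneg t) hs.2).trans_lt ht
      rw [abs_lt] at h1
      exact ⟨by linarith [h1.1], by linarith [h1.2]⟩
    have hβ : ∀ s ∈ Icc (0 : ℝ) 1,
        HasDerivAt (fun s => α x (t * s)) (t • X (α x (t * s))) s := by
      intro s hs
      have h1 := (hα x hx _ (hst s hs)).scomp s ((hasDerivAt_id s).const_mul t)
      simpa [Function.comp_def] using h1
    -- The fixed point with parameter `t` and the flow line run at speed `t` both solve `y' = t
    -- X(y)` from `x`. At `s = 1` this identifies `φ x t` with a value of a curve that depends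
    -- smoothly on `(x, t)`.
    have huniq := ODE_solution_unique (v := fun _ y => t • X y) (a := 0) (b := 1)
      (K := ‖t‖₊ * K) (f := g) (g := fun s => α x (t * s))
      (fun _ => (lipschitzWith_smul t).comp hL)
      (fun s _ => (hgd s).continuousAt.continuousWithinAt)
      (fun s hs => by
        have := (hgd s).hasDerivWithinAt (s := Ici s)
        rwa [← hgγ s ⟨hs.1, hs.2.le⟩] at this)
      (fun s hs => (hβ s hs).continuousAt.continuousWithinAt)
      (fun s hs => (hβ s ⟨hs.1, hs.2.le⟩).hasDerivWithinAt)
      (by simp [hg, hα0 x hx])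
    have h1 := huniq (right_mem_Icc.2 zero_le_one)
    have h2 := hgγ 1 (right_mem_Icc.2 zero_le_one)
    have h3 : γe 1 = γ 1 := IccExtend_of_mem _ _ (right_mem_Icc.2 zero_le_one)
    simp only [mul_one] at h1
    exact h1.symm.trans (h2.trans h3)
  · exact hα0 x (Metric.ball_subset_closedBall (Metric.ball_subset_ball (min_le_left _ _) hx))
  · intro t ht
    refine hα x (Metric.ball_subset_closedBall (Metric.ball_subset_ball (min_le_left _ _) hx)) t ?_
    have := min_le_left ε₁ r₂
    exact ⟨by linarith [ht.1], by linarith [ht.2]⟩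

/-- The local flow of a vector field which is smooth on an open set is smooth. -/
lemma exists_contDiffOn_flow [FiniteDimensional ℝ F] {X : F → F} {U : Set F} (hU : IsOpen U)
    (hX : ContDiffOn ℝ ∞ X U) {x₀ : F} (hx₀ : x₀ ∈ U) :
    ∃ r > 0, ∃ ε > 0, ∃ φ : F → ℝ → F,
      ContDiffOn ℝ ∞ (fun p : F × ℝ => φ p.1 p.2) (Metric.ball x₀ r ×ˢ Ioo (-ε) ε) ∧
      ∀ x ∈ Metric.ball x₀ r, φ x 0 = x ∧
        ∀ t ∈ Ioo (-ε) ε, φ x t ∈ U ∧ HasDerivAt (φ x) (X (φ x t)) t := by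
  have : CompleteSpace F := FiniteDimensional.complete ℝ F
  obtain ⟨R, hR, hRU⟩ := Metric.nhds_basis_closedBall.mem_iff.1 (hU.mem_nhds hx₀)
  let χ : ContDiffBump x₀ := ⟨R / 2, R, by positivity, by linarith⟩
  -- The cutoff makes the field compactly supported, hence globally Lipschitz, without changing it
  -- on the ball of radius `R / 2`.
  set Y : F → F := fun x => χ x • X x with hY
  have hYs : ContDiff ℝ ∞ Y := by
    rw [contDiff_iff_contDiffAt]
    intro x
    by_cases hx : x ∈ Metric.closedBall x₀ R
    · exact χ.contDiff.contDiffAt.smul (hX.contDiffAt (hU.mem_nhds (hRU hx)))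
    · have h0 : Y =ᶠ[𝓝 x] fun _ => 0 := by
        filter_upwards [Metric.isClosed_closedBall.isOpen_compl.mem_nhds hx] with y hy
        have : χ y = 0 := χ.zero_of_le_dist (by
          have := Metric.mem_closedBall.not.1 hy
          exact (not_le.1 this).le)
        simp [hY, this]
      exact contDiffAt_const.congr_of_eventuallyEq h0
  have hYc : HasCompactSupport Y := χ.hasCompactSupport.smul_right
  obtain ⟨K, hK⟩ := (hYs.of_le (by simp : (1 : WithTop ℕ∞) ≤ ∞)).lipschitzWith_of_hasCompactSupport
    hYc (by simp)
  obtain ⟨r, hr, ε, hε, φ, hφ, hφ'⟩ := exists_contDiffOn_flow_of_lipschitz hYs hK x₀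
  have hmem : (x₀, (0 : ℝ)) ∈ Metric.ball x₀ r ×ˢ Ioo (-ε) ε :=
    ⟨Metric.mem_ball_self hr, by simpa using hε⟩
  have hopen : IsOpen (Metric.ball x₀ r ×ˢ Ioo (-ε) ε) := Metric.isOpen_ball.prod isOpen_Ioo
  -- For these initial values and times the flow stays where the cutoff equals one, so it is a flow
  -- of `X`.
  have hO := hφ.continuousOn.isOpen_inter_preimage hopen (Metric.isOpen_ball (x := x₀) (ε := R / 2))
  obtain ⟨δ, hδ, hsub⟩ := Metric.isOpen_iff.1 hO (x₀, 0)
    ⟨hmem, by simp [(hφ' x₀ (Metric.mem_ball_self hr)).1, hR]⟩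
  rw [← ball_prod_same, Real.ball_eq_Ioo, zero_sub, zero_add] at hsub
  have hb : ∀ x ∈ Metric.ball x₀ δ, x ∈ Metric.ball x₀ r := fun x hx =>
    (hsub (show (x, (0 : ℝ)) ∈ _ from ⟨hx, by simpa using hδ⟩)).1.1
  refine ⟨δ, hδ, δ, hδ, φ, hφ.mono fun p hp => (hsub hp).1, fun x hx => ⟨(hφ' x (hb x hx)).1, ?_⟩⟩
  intro t ht
  have h1 := hsub (show (x, t) ∈ _ from ⟨hx, ht⟩)
  have h2 : φ x t ∈ Metric.ball x₀ (R / 2) := h1.2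
  refine ⟨hRU (Metric.ball_subset_closedBall (Metric.ball_subset_ball (by linarith) h2)), ?_⟩
  have h3 := (hφ' x (hb x hx)).2 t h1.1.2
  have h4 : χ (φ x t) = 1 := χ.one_of_mem_closedBall (Metric.ball_subset_closedBall h2)
  simpa [hY, h4] using h3

end Flow

/-! ### Quotients of manifolds by equivalence relations which are linear in suitable charts -/

section LinearQuotient

variable {E : Type*} [NormedAddCommGroup E] [NormedSpace ℝ E]
  {H : Type*} [TopologicalSpace H] (I : ModelWithCorners ℝ E H)
  {N : Type*} [TopologicalSpace N] [ChartedSpace H N]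
  {G : Type*}

/-- A smooth chart of `N` in which the fibres of `pr : N → G` are the fibres of a surjective linear
map to `ℝᵏ`. -/
structure LinearQuotientChart (k : ℕ) (pr : N → G) where
  /-- the chart -/
  chart : OpenPartialHomeomorph N E
  /-- the linear map which expresses the projection -/
  proj : E →L[ℝ] EuclideanSpace ℝ (Fin k)
  contMDiffOn : ContMDiffOn I 𝓘(ℝ, E) ∞ chart chart.source
  contMDiffOn_symm : ContMDiffOn 𝓘(ℝ, E) I ∞ chart.symm chart.target
  surjective : Function.Surjective proj
  eq_iff : ∀ y ∈ chart.source, ∀ z ∈ chart.source, pr y = pr z ↔ proj (chart y) = proj (chart z)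

/-- In adapted charts a submersion is the first projection of a product. The chart of the target is
injective on its source, so equality of images is equality of first components. -/
lemma Manifold.IsSubmersion.exists_linearQuotientChart [I.Boundaryless] [TopologicalSpace G] {k : ℕ}
    [ChartedSpace (EuclideanSpace ℝ (Fin k)) G] {pr : N → G}
    (h : Manifold.IsSubmersion I (𝓡 k) ∞ pr) (x : N) :
    ∃ c : LinearQuotientChart I k pr, x ∈ c.chart.source := by
  obtain ⟨F, _, _, hF⟩ := h
  have hx := hF x
  set φ := hx.domChart
  have hφ := hx.domChart_mem_maximalAtlas
  have hse : ∀ u ∈ φ.source, (φ.extend I).symm (φ.extend I u) = u := fun u hu =>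
    φ.extend_left_inv hu
  have key : ∀ u ∈ φ.source, hx.codChart.extend (𝓡 k) (pr u) = (hx.equiv (I (φ u))).1 := by
    intro u hu
    have h1 := hx.writtenInCharts ((φ.extend I).map_source (by simpa using hu))
    simpa [φ, hx.domChart.left_inv hu] using h1
  refine ⟨⟨φ.trans I.toHomeomorph.toOpenPartialHomeomorph,
    (ContinuousLinearMap.fst ℝ _ F).comp (hx.equiv : E →L[ℝ] _), ?_, ?_, ?_, ?_⟩, ?_⟩
  · rw [show (φ.trans I.toHomeomorph.toOpenPartialHomeomorph).source = φ.source by simp]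
    exact φ.contMDiffOn_extend hφ
  · have h1 := contMDiffOn_extend_symm (I := I) (n := ∞) hφ
    have h2 : (φ.trans I.toHomeomorph.toOpenPartialHomeomorph).target = I '' φ.target := by
      rw [I.image_eq]
      simp [I.range_eq_univ]
      rfl
    rw [h2]
    exact h1
  · intro y
    refine ⟨hx.equiv.symm (y, 0), by simp⟩
  · intro y hy z hz
    have hy' : y ∈ φ.source := by simpa using hy
    have hz' : z ∈ φ.source := by simpa using hz
    have hyc := hx.source_subset_preimage_source hy'
    have hzc := hx.source_subset_preimage_source hz'
    change pr y = pr z ↔ (hx.equiv (I (φ y))).1 = (hx.equiv (I (φ z))).1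
    rw [← key y hy', ← key z hz']
    refine ⟨fun h => by rw [h], fun h => ?_⟩
    exact (hx.codChart.extend (𝓡 k)).injOn (by simpa using hyc) (by simpa using hzc) h
  · simpa using hx.mem_domChart_source

/-- A smooth map which has a local section and separates the fibres of `pr` near a point gives a
chart which linearizes `pr`. -/
lemma exists_linearQuotientChart_of_section [I.Boundaryless] [IsManifold I ∞ N]
    [FiniteDimensional ℝ E] {F : Type*} [NormedAddCommGroup F] [NormedSpace ℝ F]
    [FiniteDimensional ℝ F] {k : ℕ} (hk : Module.finrank ℝ F = k) {pr : N → G} {x : N} {f : N → F}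
    {U : Set N} (hU : IsOpen U) (hxU : x ∈ U) (hf : ContMDiffOn I 𝓘(ℝ, F) ∞ f U) {σ : F → N}
    (hσ : ContMDiffAt 𝓘(ℝ, F) I 1 σ (f x)) (hσx : σ (f x) = x)
    (hfσ : ∀ᶠ y in 𝓝 (f x), f (σ y) = y)
    (heq : ∀ y ∈ U, ∀ z ∈ U, pr y = pr z ↔ f y = f z) :
    ∃ c : LinearQuotientChart I k pr, x ∈ c.chart.source := by
  have : CompleteSpace E := FiniteDimensional.complete ℝ E
  set φ : OpenPartialHomeomorph N E := (chartAt H x).trans I.toHomeomorph.toOpenPartialHomeomorph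
    with hφdef
  have hφc : ∀ y, φ y = extChartAt I x y := fun y => rfl
  have hφs : ∀ y, φ.symm y = (extChartAt I x).symm y := fun y => rfl
  have hφsource : φ.source = (chartAt H x).source := by simp [hφdef]
  have hφtarget : φ.target = (extChartAt I x).target := by
    simp [hφdef, I.range_eq_univ]
    rfl
  have hxφ : x ∈ φ.source := by rw [hφsource]; exact mem_chart_source H x
  have hsm : ContMDiffOn I 𝓘(ℝ, E) ∞ φ φ.source := by
    rw [hφsource]; exact contMDiffOn_extChartAt
  have hsm' : ContMDiffOn 𝓘(ℝ, E) I ∞ φ.symm φ.target := by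
    rw [hφtarget]; exact contMDiffOn_extChartAt_symm x
  set V : Set E := φ.target ∩ φ.symm ⁻¹' U
  have hV : IsOpen V := φ.isOpen_inter_preimage_symm hU
  have hxV : φ x ∈ V := ⟨φ.map_source hxφ, by simpa [φ.left_inv hxφ] using hxU⟩
  set g : E → F := f ∘ φ.symm
  have hg : ContDiffOn ℝ ∞ g V := by
    rw [← contMDiffOn_iff_contDiffOn]
    exact hf.comp (hsm'.mono inter_subset_left) fun u hu => hu.2
  have hgd : HasFDerivAt g (fderiv ℝ g (φ x)) (φ x) :=
    ((hg.contDiffAt (hV.mem_nhds hxV)).differentiableAt (by simp)).hasFDerivAt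
  set s : F → E := φ ∘ σ
  have hs : DifferentiableAt ℝ s (f x) := by
    rw [← mdifferentiableAt_iff_differentiableAt]
    have h1 : MDifferentiableAt I 𝓘(ℝ, E) φ (σ (f x)) := by
      rw [hσx]
      exact (hsm.contMDiffAt (φ.open_source.mem_nhds hxφ)).mdifferentiableAt (by simp)
    exact h1.comp _ (hσ.mdifferentiableAt (by simp))
  have hsx : s (f x) = φ x := by simp [s, hσx]
  have hgs : ∀ᶠ y in 𝓝 (f x), g (s y) = y := by
    have h1 : ∀ᶠ y in 𝓝 (f x), σ y ∈ φ.source := by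
      refine hσ.continuousAt.eventually_mem ?_
      rw [hσx]
      exact φ.open_source.mem_nhds hxφ
    filter_upwards [hfσ, h1] with y hy hy'
    simp [g, s, φ.left_inv hy', hy]
  set L := fderiv ℝ g (φ x)
  set R := fderiv ℝ s (f x)
  have hLR : L.comp R = .id ℝ F := by
    have h1 : HasFDerivAt (g ∘ s) (L.comp R) (f x) := by
      refine HasFDerivAt.comp _ ?_ hs.hasFDerivAt
      rw [hsx]; exact hgd
    have h2 : HasFDerivAt (g ∘ s) (.id ℝ F) (f x) := (hasFDerivAt_id (f x)).congr_of_eventuallyEq hgs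
    exact h1.unique h2
  have hLR' : ∀ y, L (R y) = y := fun y => congrArg (fun A => A y) hLR
  -- Since `L` composed with `R` is the identity, `L` composed with `S` is `g`. The derivative of
  -- `S` at `φ x` is the identity, so `S` is a change of coordinates in which `g` becomes the linear
  -- map `L`.
  set S : E → E := fun u => u + R (g u - L u) with hS
  have hSs : ContDiffOn ℝ ∞ S V :=
    contDiffOn_id.add (R.contDiff.comp_contDiffOn (hg.sub L.contDiff.contDiffOn))
  have hSd : HasFDerivAt S ((ContinuousLinearEquiv.refl ℝ E : E ≃L[ℝ] E) : E →L[ℝ] E) (φ x) := by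
    refine ((hasFDerivAt_id (φ x)).add
      (R.hasFDerivAt.comp _ (hgd.sub L.hasFDerivAt))).congr_fderiv ?_
    ext u
    simp
  obtain ⟨e, hxe, heV, heS, hes⟩ := exists_openPartialHomeomorph_contDiffOn_symm hV hSs hxV _ hSd
  have hLe : ∀ u, L (e u) = g u := fun u => by simp [heS, hS, hLR']
  let ι : F ≃L[ℝ] EuclideanSpace ℝ (Fin k) :=
    ContinuousLinearEquiv.ofFinrankEq (by simp [hk])
  have hsrc : ∀ y, y ∈ (φ.trans e).source ↔ y ∈ φ.source ∧ φ y ∈ e.source := fun y => by simp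
  refine ⟨⟨φ.trans e, (ι : F →L[ℝ] _).comp L, ?_, ?_, ?_, ?_⟩, (hsrc x).2 ⟨hxφ, hxe⟩⟩
  · have h1 : ContMDiffOn 𝓘(ℝ, E) 𝓘(ℝ, E) ∞ e e.source :=
      ((hSs.mono heV).congr fun u _ => heS u).contMDiffOn
    exact h1.comp (hsm.mono fun y hy => ((hsrc y).1 hy).1) fun y hy => ((hsrc y).1 hy).2
  · have h1 : ContMDiffOn 𝓘(ℝ, E) 𝓘(ℝ, E) ∞ e.symm e.target := hes.contMDiffOn
    refine hsm'.comp (h1.mono fun u hu => ?_) fun u hu => ?_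
    · rw [OpenPartialHomeomorph.trans_target] at hu; exact hu.1
    · rw [OpenPartialHomeomorph.trans_target] at hu; exact hu.2
  · exact ι.surjective.comp fun y => ⟨R y, hLR' y⟩
  · intro y hy z hz
    obtain ⟨hy1, hy2⟩ := (hsrc y).1 hy
    obtain ⟨hz1, hz2⟩ := (hsrc z).1 hz
    have hyU : y ∈ U := by simpa [φ.left_inv hy1] using (heV hy2).2
    have hzU : z ∈ U := by simpa [φ.left_inv hz1] using (heV hz2).2
    change pr y = pr z ↔ ι (L (e (φ y))) = ι (L (e (φ z)))
    rw [ι.injective.eq_iff, hLe, hLe]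
    simp only [g, Function.comp_apply, φ.left_inv hy1, φ.left_inv hz1]
    exact heq y hyU z hzU

end LinearQuotient

/-! ### The quotient manifold defined by linearizing charts -/

section Charts

variable {E : Type*} [NormedAddCommGroup E] [NormedSpace ℝ E]
  {H : Type*} [TopologicalSpace H] {I : ModelWithCorners ℝ E H}
  {N : Type*} [TopologicalSpace N] [ChartedSpace H N]
  {G : Type*} {k : ℕ} {pr : N → G}

namespace LinearQuotientChart

variable (c : LinearQuotientChart I k pr) (x : N)

/-- A right inverse of the linear map which expresses the projection. -/
noncomputable def rightInverse : EuclideanSpace ℝ (Fin k) →L[ℝ] E :=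
  (c.proj.exists_rightInverse_of_surjective (LinearMap.range_eq_top.2 c.surjective)).choose

@[simp] lemma proj_rightInverse (y : EuclideanSpace ℝ (Fin k)) : c.proj (c.rightInverse y) = y :=
  congrArg (fun A => A y) (c.proj.exists_rightInverse_of_surjective
    (LinearMap.range_eq_top.2 c.surjective)).choose_spec

/-- The affine section of the projection through a point, in the chart. -/
noncomputable def affineSection (y : EuclideanSpace ℝ (Fin k)) : E :=
  c.chart x + c.rightInverse (y - c.proj (c.chart x))

@[simp] lemma proj_affineSection (y : EuclideanSpace ℝ (Fin k)) :
    c.proj (c.affineSection x y) = y := by simp [affineSection]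

lemma contDiff_affineSection : ContDiff ℝ ∞ (c.affineSection x) := by
  unfold affineSection
  fun_prop

@[simp] lemma affineSection_self : c.affineSection x (c.proj (c.chart x)) = c.chart x := by
  simp [affineSection]

/-- The domain of the affine section. -/
def sectionDomain : Set (EuclideanSpace ℝ (Fin k)) := c.affineSection x ⁻¹' c.chart.target

lemma isOpen_sectionDomain : IsOpen (c.sectionDomain x) :=
  c.chart.open_target.preimage (c.contDiff_affineSection x).continuous

lemma mem_sectionDomain (hx : x ∈ c.chart.source) :
    c.proj (c.chart x) ∈ c.sectionDomain x := by
  simpa [sectionDomain] using c.chart.map_source hx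

/-- The section of the projection through a point. -/
noncomputable def localSection (y : EuclideanSpace ℝ (Fin k)) : N :=
  c.chart.symm (c.affineSection x y)

lemma localSection_self (hx : x ∈ c.chart.source) :
    c.localSection x (c.proj (c.chart x)) = x := by
  simp [localSection, c.chart.left_inv hx]

lemma localSection_mem_source {y : EuclideanSpace ℝ (Fin k)} (hy : y ∈ c.sectionDomain x) :
    c.localSection x y ∈ c.chart.source := c.chart.map_target hy

lemma proj_localSection {y : EuclideanSpace ℝ (Fin k)} (hy : y ∈ c.sectionDomain x) :
    c.proj (c.chart (c.localSection x y)) = y := by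
  simp [localSection, c.chart.right_inv hy]

lemma contMDiffOn_localSection :
    ContMDiffOn (𝓡 k) I ∞ (c.localSection x) (c.sectionDomain x) :=
  c.contMDiffOn_symm.comp (c.contDiff_affineSection x).contMDiff.contMDiffOn fun _ hy => hy

lemma injOn_comp_localSection : InjOn (pr ∘ c.localSection x) (c.sectionDomain x) := by
  intro y hy z hz h
  have h1 := (c.eq_iff _ (c.localSection_mem_source x hy) _ (c.localSection_mem_source x hz)).1 h
  rwa [c.proj_localSection x hy, c.proj_localSection x hz] at h1

lemma eq_comp_localSection {z : N} (hz : z ∈ c.chart.source)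
    (hzW : c.proj (c.chart z) ∈ c.sectionDomain x) :
    pr z = (pr ∘ c.localSection x) (c.proj (c.chart z)) :=
  (c.eq_iff _ hz _ (c.localSection_mem_source x hzW)).2 (c.proj_localSection x hzW).symm

lemma image_comp_localSection {O : Set (EuclideanSpace ℝ (Fin k))} (hO : O ⊆ c.sectionDomain x) :
    (pr ∘ c.localSection x) '' O = pr '' (c.chart.source ∩ (c.proj ∘ c.chart) ⁻¹' O) := by
  ext g
  constructor
  · rintro ⟨y, hy, rfl⟩
    exact ⟨_, ⟨c.localSection_mem_source x (hO hy), by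
      simpa [c.proj_localSection x (hO hy)] using hy⟩, rfl⟩
  · rintro ⟨z, ⟨hz, hzO⟩, rfl⟩
    exact ⟨_, hzO, (c.eq_comp_localSection x hz (hO hzO)).symm⟩

variable [TopologicalSpace G]

/-- The chart of the quotient defined by a chart which linearizes the projection. -/
noncomputable def quotientChart (hπ : Continuous pr) (hπo : IsOpenMap pr) :
    OpenPartialHomeomorph G (EuclideanSpace ℝ (Fin k)) :=
  (OpenPartialHomeomorph.ofContinuousOpenRestrict
    ((c.injOn_comp_localSection x).toPartialEquiv _ _)
    (hπ.comp_continuousOn (c.contMDiffOn_localSection x).continuousOn)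
    (by
      intro O hO
      obtain ⟨O', hO', rfl⟩ := isOpen_induced_iff.1 hO
      have h1 : (c.sectionDomain x).domRestrict (pr ∘ c.localSection x) '' (Subtype.val ⁻¹' O') =
          (pr ∘ c.localSection x) '' (c.sectionDomain x ∩ O') := by
        ext g
        constructor
        · rintro ⟨⟨y, hy⟩, hyO, rfl⟩
          exact ⟨y, ⟨hy, hyO⟩, rfl⟩
        · rintro ⟨y, ⟨hy, hyO⟩, rfl⟩
          exact ⟨⟨y, hy⟩, hyO, rfl⟩
      refine (congrArg IsOpen h1).mpr ?_
      -- The image of the section is not open in `N` in general, but the open set of points with the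
      -- same linear coordinate has the same projection.
      rw [c.image_comp_localSection x inter_subset_left]
      refine hπo _ ?_
      have h2 : ContinuousOn (c.proj ∘ c.chart) c.chart.source :=
        c.proj.continuous.comp_continuousOn c.chart.continuousOn
      exact h2.isOpen_inter_preimage c.chart.open_source
        ((c.isOpen_sectionDomain x).inter hO'))
    (c.isOpen_sectionDomain x)).symm

variable (hπ : Continuous pr) (hπo : IsOpenMap pr)

lemma quotientChart_symm (y : EuclideanSpace ℝ (Fin k)) :
    (c.quotientChart x hπ hπo).symm y = pr (c.localSection x y) := rfl

lemma mem_quotientChart_source {z : N} (hz : z ∈ c.chart.source)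
    (hzW : c.proj (c.chart z) ∈ c.sectionDomain x) : pr z ∈ (c.quotientChart x hπ hπo).source := by
  rw [c.eq_comp_localSection x hz hzW]
  exact (c.quotientChart x hπ hπo).map_target hzW

lemma quotientChart_apply {z : N} (hz : z ∈ c.chart.source)
    (hzW : c.proj (c.chart z) ∈ c.sectionDomain x) :
    c.quotientChart x hπ hπo (pr z) = c.proj (c.chart z) := by
  rw [c.eq_comp_localSection x hz hzW]
  exact (c.quotientChart x hπ hπo).right_inv hzW

/-- Two sections may meet one class at points of `N` far apart. The map `Θ` brings a neighbourhood
of the first point to the second without changing classes, so the transition map is locally a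
section, then `Θ`, then the linear coordinate of the other chart. -/
lemma contDiffOn_quotientChart_transition (c' : LinearQuotientChart I k pr) (x' : N)
    (htr : ∀ y z : N, pr y = pr z → ∃ Θ : N → N, ContMDiffAt I I ∞ Θ y ∧ Θ y = z ∧
      ∀ᶠ w in 𝓝 y, pr (Θ w) = pr w) :
    ContDiffOn ℝ ∞ (c'.quotientChart x' hπ hπo ∘ (c.quotientChart x hπ hπo).symm)
      ((c.quotientChart x hπ hπo).symm ≫ₕ c'.quotientChart x' hπ hπo).source := by
  intro y hy
  rw [OpenPartialHomeomorph.trans_source] at hy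
  have hyW : y ∈ c.sectionDomain x := hy.1
  set y' := c'.quotientChart x' hπ hπo ((c.quotientChart x hπ hπo).symm y) with hy'
  have hy'W : y' ∈ c'.sectionDomain x' := (c'.quotientChart x' hπ hπo).map_source hy.2
  have hab : pr (c.localSection x y) = pr (c'.localSection x' y') :=
    ((c'.quotientChart x' hπ hπo).left_inv hy.2).symm
  obtain ⟨Θ, hΘ, hΘy, hΘπ⟩ := htr _ _ hab
  have hσ : ContMDiffAt (𝓡 k) I ∞ (c.localSection x) y :=
    (c.contMDiffOn_localSection x).contMDiffAt ((c.isOpen_sectionDomain x).mem_nhds hyW)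
  have hΘσ : ContMDiffAt (𝓡 k) I ∞ (Θ ∘ c.localSection x) y := hΘ.comp y hσ
  have hmem : (Θ ∘ c.localSection x) y ∈ c'.chart.source := by
    simp only [Function.comp_apply, hΘy]
    exact c'.localSection_mem_source x' hy'W
  have hsm : ContMDiffAt (𝓡 k) 𝓘(ℝ, EuclideanSpace ℝ (Fin k)) ∞
      (c'.proj ∘ c'.chart ∘ Θ ∘ c.localSection x) y := by
    refine c'.proj.contMDiff.contMDiffAt.comp y ?_
    exact ContMDiffAt.comp y
      (c'.contMDiffOn.contMDiffAt (c'.chart.open_source.mem_nhds hmem)) hΘσ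
  refine ContDiffAt.contDiffWithinAt (hsm.contDiffAt.congr_of_eventuallyEq ?_)
  have h1 : ∀ᶠ u in 𝓝 y, (Θ ∘ c.localSection x) u ∈ c'.chart.source :=
    hΘσ.continuousAt.eventually_mem (c'.chart.open_source.mem_nhds hmem)
  have h2 : ∀ᶠ u in 𝓝 y, (c'.proj ∘ c'.chart ∘ Θ ∘ c.localSection x) u ∈ c'.sectionDomain x' := by
    refine hsm.continuousAt.eventually_mem ((c'.isOpen_sectionDomain x').mem_nhds ?_)
    simp only [Function.comp_apply, hΘy, c'.proj_localSection x' hy'W]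
    exact hy'W
  have h3 := hσ.continuousAt.eventually hΘπ
  filter_upwards [h1, h2, h3] with u hu1 hu2 hu3
  simp only [Function.comp_apply, quotientChart_symm]
  rw [← hu3]
  exact c'.quotientChart_apply x' hπ hπo hu1 hu2

end LinearQuotientChart

/-- If the fibres of an open quotient map are linear in suitable charts, and locally transported to
each other by smooth maps over the quotient, then the quotient is a manifold and the projection
a submersion. -/
theorem exists_isManifold_isSubmersion [I.Boundaryless] [IsManifold I ∞ N] [FiniteDimensional ℝ E]
    [TopologicalSpace G] (hπ : Topology.IsQuotientMap pr)
    (hlin : ∀ x, ∃ c : LinearQuotientChart I k pr, x ∈ c.chart.source)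
    (htr : ∀ y z : N, pr y = pr z → ∃ Θ : N → N, ContMDiffAt I I ∞ Θ y ∧ Θ y = z ∧
      ∀ᶠ w in 𝓝 y, pr (Θ w) = pr w) :
    ∃ (_ : ChartedSpace (EuclideanSpace ℝ (Fin k)) G), IsManifold (𝓡 k) ∞ G ∧
      Manifold.IsSubmersion I (𝓡 k) ∞ pr := by
  -- The saturation of an open set is open: if `z` lies in it, `Θ` takes a neighbourhood of any
  -- equivalent `y` into it.
  have hπo : IsOpenMap pr := by
    intro O hO
    rw [← hπ.isOpen_preimage, isOpen_iff_mem_nhds]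
    rintro y ⟨z, hz, hzy⟩
    obtain ⟨Θ, hΘ, hΘy, hΘπ⟩ := htr y z hzy.symm
    have h1 : ∀ᶠ w in 𝓝 y, Θ w ∈ O :=
      hΘ.continuousAt.eventually_mem (hO.mem_nhds (by rwa [hΘy]))
    filter_upwards [h1, hΘπ] with w hw hw'
    exact ⟨_, hw, hw'⟩
  choose c hc using hlin
  choose r hr using hπ.surjective
  have hmem : ∀ x, pr x ∈ ((c x).quotientChart x hπ.continuous hπo).source := fun x =>
    (c x).mem_quotientChart_source x _ _ (hc x) ((c x).mem_sectionDomain x (hc x))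
  let _ : ChartedSpace (EuclideanSpace ℝ (Fin k)) G :=
    { atlas := range fun x => (c x).quotientChart x hπ.continuous hπo
      chartAt := fun g => (c (r g)).quotientChart (r g) hπ.continuous hπo
      mem_chart_source := fun g => by
        have := hmem (r g)
        rwa [hr g] at this
      chart_mem_atlas := fun g => ⟨r g, rfl⟩ }
  have hman : IsManifold (𝓡 k) ∞ G := by
    refine isManifold_of_contDiffOn _ _ _ ?_
    rintro _ _ ⟨x, rfl⟩ ⟨x', rfl⟩
    have h1 := (c x).contDiffOn_quotientChart_transition x hπ.continuous hπo (c x') x' htr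
    simpa using h1
  refine ⟨_, hman, ?_⟩
  -- The complement has to be one space for all points. The kernels of the linear maps vary with the
  -- chart but all have this dimension, by the rank theorem.
  refine Manifold.IsSubmersionOfComplement.isSubmersion
    (F := EuclideanSpace ℝ (Fin (Module.finrank ℝ E - k))) fun x => ?_
  set L := (c x).proj
  set R := (c x).rightInverse
  have hLR : ∀ y, L (R y) = y := (c x).proj_rightInverse
  let ε : E ≃L[ℝ] EuclideanSpace ℝ (Fin k) × L.ker :=
    ContinuousLinearEquiv.equivOfInverse
      (L.prod ((ContinuousLinearMap.id ℝ E - R.comp L).codRestrict L.ker fun u => by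
        simp [hLR]))
      ((R.comp (ContinuousLinearMap.fst ℝ _ _)) +
        L.ker.subtypeL.comp (ContinuousLinearMap.snd ℝ _ _))
      (fun u => by simp)
      (fun p => by
        have h2 : L (p.2 : E) = 0 := p.2.2
        refine Prod.ext ?_ (Subtype.ext ?_)
        · simp [hLR, h2]
        · simp [hLR, h2])
  have hrank : Module.finrank ℝ L.ker = Module.finrank ℝ E - k := by
    have := ε.toLinearEquiv.finrank_eq
    rw [Module.finrank_prod, finrank_euclideanSpace_fin] at this
    omega
  let ι : L.ker ≃L[ℝ] EuclideanSpace ℝ (Fin (Module.finrank ℝ E - k)) :=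
    ContinuousLinearEquiv.ofFinrankEq (by simp [hrank])
  have hεL : ∀ u, (ε u).1 = L u := fun u => rfl
  set φ : OpenPartialHomeomorph N H := (c x).chart.trans I.toHomeomorph.symm.toOpenPartialHomeomorph
    with hφ
  have hφs : φ.source = (c x).chart.source := by simp [hφ]
  have hIs : ∀ u : E, I.toHomeomorph.symm u = I.symm u := fun u => rfl
  set O : Set N := (c x).chart.source ∩ (L ∘ (c x).chart) ⁻¹' (c x).sectionDomain x
  have hO : IsOpen O := by
    have h2 : ContinuousOn (L ∘ (c x).chart) (c x).chart.source :=
      L.continuous.comp_continuousOn (c x).chart.continuousOn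
    exact h2.isOpen_inter_preimage (c x).chart.open_source ((c x).isOpen_sectionDomain x)
  refine Manifold.IsSubmersionAtOfComplement.mk_of_continuousAt hπ.continuous.continuousAt
    (ε.trans ((ContinuousLinearEquiv.refl ℝ _).prodCongr ι)) (φ.restr O)
    ((c x).quotientChart x hπ.continuous hπo) ?_ (hmem x) ?_ ?_ ?_
  · rw [φ.restr_source' O hO, hφs]
    exact ⟨hc x, hc x, (c x).mem_sectionDomain x (hc x)⟩
  · have hφmem : φ ∈ IsManifold.maximalAtlas I ∞ N := by
      refine φ.mem_maximalAtlas_of_contMDiffOn ?_ ?_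
      · rw [hφs]
        have h3 := I.contMDiffOn_symm (n := ∞)
        rw [I.range_eq_univ] at h3
        exact h3.comp (c x).contMDiffOn fun _ _ => mem_univ _
      · refine ContMDiffOn.comp (t := (c x).chart.target) (I' := 𝓘(ℝ, E)) (c x).contMDiffOn_symm
          I.contMDiff.contMDiffOn fun u hu => ?_
        rw [hφ, OpenPartialHomeomorph.trans_target] at hu
        exact hu.2
    exact restr_mem_maximalAtlas (contDiffGroupoid ∞ I) hφmem hO
  · exact IsManifold.subset_maximalAtlas ⟨x, rfl⟩
  · intro u hu
    set z := ((φ.restr O).extend I).symm u with hz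
    have hzs : z ∈ ((φ.restr O).extend I).source := PartialEquiv.map_target _ hu
    have hzu : (φ.restr O).extend I z = u := PartialEquiv.right_inv _ hu
    rw [OpenPartialHomeomorph.extend_source, φ.restr_source' O hO] at hzs
    have hcu : (c x).chart z = u := by
      rw [← hzu]
      exact (I.right_inv (by rw [I.range_eq_univ]; exact mem_univ _)).symm
    have h4 := (c x).quotientChart_apply x hπ.continuous hπo hzs.2.1 hzs.2.2
    rw [hcu] at h4
    exact h4

end Charts

/-! ### The geodesic equation in a chart -/

section GeodesicEquation

variable {E : Type*} [NormedAddCommGroup E] [NormedSpace ℝ E]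
  {H : Type*} [TopologicalSpace H] {I : ModelWithCorners ℝ E H}
  {M : Type*} [TopologicalSpace M] [ChartedSpace H M]

/-- The lift of a curve to the tangent bundle by its velocity. -/
noncomputable def curveLift (I : ModelWithCorners ℝ E H) (γ : ℝ → M) (t : ℝ) : TangentBundle I M :=
  ⟨γ t, velocity I γ t⟩

@[simp] lemma curveLift_fst (γ : ℝ → M) (t : ℝ) : (curveLift I γ t).1 = γ t := rfl

lemma hasDerivAt_of_hasMFDerivAt {f : ℝ → E} {f' : ℝ →L[ℝ] E} {t : ℝ}
    (h : HasMFDerivAt 𝓘(ℝ, ℝ) 𝓘(ℝ, E) f t f') : HasDerivAt f (f' 1) t := by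
  have h1 : HasFDerivAt f f' t := hasMFDerivAt_iff_hasFDerivAt.1 h
  exact h1.hasDerivAt

variable [IsManifold I ∞ M]

variable (I) in
/-- The preferred trivialization of the tangent bundle at a point. -/
noncomputable abbrev tangentTriv (x : M) :
    Trivialization E (TotalSpace.proj : TangentBundle I M → M) :=
  trivializationAt E (TangentSpace I : M → Type _) x

/-- The derivative of a curve read in a chart is its velocity read in the induced trivialization. -/
lemma hasDerivAt_extChartAt_comp_curve {γ : ℝ → M} {t : ℝ} {x : M}
    (hγ : MDifferentiableAt 𝓘(ℝ, ℝ) I γ t) (ht : γ t ∈ (chartAt H x).source) :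
    HasDerivAt (extChartAt I x ∘ γ) (tangentTriv I x (curveLift I γ t)).2 t := by
  have : IsManifold I 1 M := .of_le (n := ∞) (by simp)
  have h0 := HasMFDerivAt.comp t (hasMFDerivAt_extChartAt (I := I) ht) hγ.hasMFDerivAt
  have h2 := hasDerivAt_of_hasMFDerivAt h0
  have h3 : (tangentTriv I x (curveLift I γ t)).2 =
      (mfderiv I I (chartAt H x) (γ t)) (velocity I γ t) := by
    rw [mfderiv_chartAt_eq_tangentCoordChange ht]
    rfl
  rw [h3]
  exact h2

/-- The frame field in the chart at `x`. -/
lemma contMDiffAt_coordField {x z : M} (hz : z ∈ (chartAt H x).source) (a : E) :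
    ContMDiffAt I I.tangent ∞
      (fun w => (⟨w, coordField (I := I) x a w⟩ : TangentBundle I M)) z := by
  have hb : (tangentTriv I x).baseSet ∈ 𝓝 z :=
    (tangentTriv I x).open_baseSet.mem_nhds hz
  refine ((tangentTriv I x).contMDiffAt_section_iff hz).2 ?_
  refine (contMDiffAt_const (c := a)).congr_of_eventuallyEq ?_
  filter_upwards [hb] with w hw
  exact congrArg Prod.snd ((tangentTriv I x).apply_mk_symm hw a)

end GeodesicEquation

/-! ### Christoffel symbols in a fixed chart -/

section Christoffel

set_option linter.unusedSectionVars false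

variable {E : Type*} [NormedAddCommGroup E] [NormedSpace ℝ E] [FiniteDimensional ℝ E]
  {M : Type*} [TopologicalSpace M] [ChartedSpace E M] [IsManifold 𝓘(ℝ, E) ∞ M]
  (cov : CovariantDerivative 𝓘(ℝ, E) E (TangentSpace 𝓘(ℝ, E) : M → Type _))

lemma tangentTriv_coordField {x z : M} (hz : z ∈ (chartAt E x).source) (a : E) :
    (tangentTriv 𝓘(ℝ, E) x ⟨z, coordField (I := 𝓘(ℝ, E)) x a z⟩).2 = a :=
  congrArg Prod.snd ((tangentTriv 𝓘(ℝ, E) x).apply_mk_symm hz a)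

lemma coordField_tangentTriv {x z : M} (hz : z ∈ (chartAt E x).source)
    (v : TangentSpace 𝓘(ℝ, E) z) :
    coordField (I := 𝓘(ℝ, E)) x ((tangentTriv 𝓘(ℝ, E) x ⟨z, v⟩).2 : E) z = v :=
  (tangentTriv 𝓘(ℝ, E) x).symm_apply_apply_mk hz v

lemma tangentTriv_add {x z : M} (hz : z ∈ (chartAt E x).source) (v w : TangentSpace 𝓘(ℝ, E) z) :
    (tangentTriv 𝓘(ℝ, E) x ⟨z, v + w⟩).2 =
      (tangentTriv 𝓘(ℝ, E) x ⟨z, v⟩).2 + (tangentTriv 𝓘(ℝ, E) x ⟨z, w⟩).2 :=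
  ((tangentTriv 𝓘(ℝ, E) x).linear ℝ hz).map_add v w

lemma tangentTriv_smul {x z : M} (hz : z ∈ (chartAt E x).source) (c : ℝ)
    (v : TangentSpace 𝓘(ℝ, E) z) :
    (tangentTriv 𝓘(ℝ, E) x ⟨z, c • v⟩).2 = c • (tangentTriv 𝓘(ℝ, E) x ⟨z, v⟩).2 :=
  ((tangentTriv 𝓘(ℝ, E) x).linear ℝ hz).map_smul c v

lemma tangentTriv_self (x : M) (v : TangentSpace 𝓘(ℝ, E) x) :
    (tangentTriv 𝓘(ℝ, E) x ⟨x, v⟩).2 = (v : E) :=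
  (tangentBundleCore 𝓘(ℝ, E) M).coordChange_self (achart _ x) x (mem_chart_source E x) v

lemma tangentTriv_sum {x z : M} (hz : z ∈ (chartAt E x).source) {ι : Type*} (s : Finset ι)
    (v : ι → TangentSpace 𝓘(ℝ, E) z) :
    (tangentTriv 𝓘(ℝ, E) x ⟨z, ∑ i ∈ s, v i⟩).2 = ∑ i ∈ s, (tangentTriv 𝓘(ℝ, E) x ⟨z, v i⟩).2 :=
  map_sum (((tangentTriv 𝓘(ℝ, E) x).linear ℝ hz).mk' _) v s

lemma tangentTriv_injective {x z : M} (hz : z ∈ (chartAt E x).source)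
    {v w : TangentSpace 𝓘(ℝ, E) z}
    (h : (tangentTriv 𝓘(ℝ, E) x ⟨z, v⟩).2 = (tangentTriv 𝓘(ℝ, E) x ⟨z, w⟩).2) : v = w := by
  rw [← coordField_tangentTriv hz v, h, coordField_tangentTriv hz w]

/-- The Christoffel symbols in the chart at `x`, with values in the model space. -/
noncomputable def christoffelSymbol (x : M)
    (i j : Fin (Module.finrank ℝ E)) (z : M) : E :=
  (tangentTriv 𝓘(ℝ, E) x ⟨z, cov (coordField (I := 𝓘(ℝ, E)) x (Module.finBasis ℝ E i)) z
    (coordField (I := 𝓘(ℝ, E)) x (Module.finBasis ℝ E j) z)⟩).2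

/-- The Christoffel bilinear form in the chart at `x`. -/
noncomputable def christoffelForm (x z : M) (a b : E) : E :=
  ∑ i, ∑ j, ((Module.finBasis ℝ E).coord i a * (Module.finBasis ℝ E).coord j b) •
    christoffelSymbol cov x i j z

/-- Smoothness of the connection is applied to fields smooth on the whole manifold. The frame field
is therefore multiplied by a bump function equal to one near `z`; since `cov` is local, its value
near `z` is unchanged. -/
lemma contMDiffAt_christoffelSymbol [T2Space M]
    [CovariantDerivative.ContMDiffCovariantDerivative cov ∞]
    {x z : M} (hz : z ∈ (chartAt E x).source) (i j : Fin (Module.finrank ℝ E)) :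
    ContMDiffAt 𝓘(ℝ, E) 𝓘(ℝ, E) ∞ (christoffelSymbol cov x i j) z := by
  set b := Module.finBasis ℝ E
  have ho : (chartAt E x).source ∈ 𝓝 z := (chartAt E x).open_source.mem_nhds hz
  obtain ⟨f, -, hf⟩ := (SmoothBumpFunction.nhds_basis_tsupport (I := 𝓘(ℝ, E)) z).mem_iff.1 ho
  set σ : Π w : M, TangentSpace 𝓘(ℝ, E) w :=
    (f : M → ℝ) • coordField (I := 𝓘(ℝ, E)) x (b i) with hσ
  have hσs : ContMDiff 𝓘(ℝ, E) 𝓘(ℝ, E).tangent ∞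
      (fun w => (⟨w, σ w⟩ : TangentBundle 𝓘(ℝ, E) M)) :=
    ContMDiffOn.smul_section_of_tsupport (u := (chartAt E x).source) f.contMDiff.contMDiffOn
      (chartAt E x).open_source hf
      (fun w hw => (contMDiffAt_coordField (I := 𝓘(ℝ, E)) hw (b i)).contMDiffWithinAt)
  have hcov := (CovariantDerivative.ContMDiffCovariantDerivative.contMDiff
    (cov := cov) (k := ∞)).contMDiff (σ := σ) hσs.contMDiffOn
  have hz' := hcov.contMDiffAt (univ_mem (f := 𝓝 z))
  have hj := contMDiffAt_coordField (I := 𝓘(ℝ, E)) hz (b j)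
  have h1 : ContMDiffAt 𝓘(ℝ, E) 𝓘(ℝ, E).tangent ∞
      (fun w => (⟨w, cov σ w (coordField (I := 𝓘(ℝ, E)) x (b j) w)⟩ : TangentBundle 𝓘(ℝ, E) M)) z :=
    ContMDiffAt.clm_bundle_apply (F₁ := E) (F₂ := E) hz' hj
  have h2 := ((tangentTriv 𝓘(ℝ, E) x).contMDiffAt_section_iff hz).1 h1
  refine h2.congr_of_eventuallyEq ?_
  filter_upwards [ho, f.eventuallyEq_one.eventually_nhds] with w hw hfw
  have h3 : cov (coordField (I := 𝓘(ℝ, E)) x (b i)) w = cov σ w := by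
    refine cov.isCovariantDerivativeOnUniv.congr_of_eventuallyEq
      ((contMDiffAt_coordField (I := 𝓘(ℝ, E)) hw (b i)).mdifferentiableAt (by simp))
      (hσs.contMDiffAt.mdifferentiableAt (by simp)) univ_mem ?_
    filter_upwards [hfw] with u hu
    simp [hσ, hu]
  simp only [christoffelSymbol]
  rw [h3]

end Christoffel

/-! ### Covariant acceleration under a change of chart -/

section GeodesicChart

set_option linter.unusedSectionVars false

variable {E : Type*} [NormedAddCommGroup E] [NormedSpace ℝ E] [FiniteDimensional ℝ E]
  {M : Type*} [TopologicalSpace M] [ChartedSpace E M] [IsManifold 𝓘(ℝ, E) ∞ M]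
  (cov : CovariantDerivative 𝓘(ℝ, E) E (TangentSpace 𝓘(ℝ, E) : M → Type _))

lemma CovariantDerivative.apply_sum_smul {ι : Type*} (s : Finset ι) {z : M}
    {c : ι → M → ℝ} {σ : ι → Π w : M, TangentSpace 𝓘(ℝ, E) w}
    (hc : ∀ i, MDifferentiableAt 𝓘(ℝ, E) 𝓘(ℝ, ℝ) (c i) z)
    (hσ : ∀ i, MDifferentiableAt 𝓘(ℝ, E) 𝓘(ℝ, E).tangent
      (fun w => (⟨w, σ i w⟩ : TangentBundle 𝓘(ℝ, E) M)) z) (v : TangentSpace 𝓘(ℝ, E) z) :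
    cov (∑ i ∈ s, c i • σ i) z v =
      ∑ i ∈ s, (c i z • cov (σ i) z v + mvfderiv 𝓘(ℝ, E) (c i) z v • σ i z) := by
  classical
  have hs : ∀ i, MDifferentiableAt 𝓘(ℝ, E) 𝓘(ℝ, E).tangent
      (fun w => (⟨w, (c i • σ i) w⟩ : TangentBundle 𝓘(ℝ, E) M)) z := fun i =>
    (hc i).smul_section (hσ i)
  have hsum : ∀ t : Finset ι, MDifferentiableAt 𝓘(ℝ, E) 𝓘(ℝ, E).tangent
      (fun w => (⟨w, (∑ i ∈ t, c i • σ i) w⟩ : TangentBundle 𝓘(ℝ, E) M)) z := fun t => by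
    have := MDifferentiableAt.sum_section (s := t) (t := fun i => c i • σ i) (fun i _ => hs i)
    simpa only [Finset.sum_apply] using this
  induction s using Finset.induction_on with
  | empty =>
    simp only [Finset.sum_empty]
    exact congrArg (fun τ => τ z v) cov.zero
  | insert i s hi ih =>
    rw [Finset.sum_insert hi, Finset.sum_insert hi, ← ih,
      cov.isCovariantDerivativeOnUniv.add (hs i) (hsum s) trivial,
      cov.isCovariantDerivativeOnUniv.leibniz (hσ i) (hc i) trivial]
    rfl

/-- The derivative along a curve of a vector-valued function. -/
lemma hasDerivAt_comp_curve {F : Type*} [NormedAddCommGroup F] [NormedSpace ℝ F]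
    {γ : ℝ → M} {t : ℝ} {g : M → F}
    (hγ : MDifferentiableAt 𝓘(ℝ, ℝ) 𝓘(ℝ, E) γ t)
    (hg : MDifferentiableAt 𝓘(ℝ, E) 𝓘(ℝ, F) g (γ t)) :
    HasDerivAt (g ∘ γ) (mvfderiv 𝓘(ℝ, E) g (γ t) (velocity 𝓘(ℝ, E) γ t)) t := by
  have h0 := HasMFDerivAt.comp t hg.hasMFDerivAt hγ.hasMFDerivAt
  exact hasDerivAt_of_hasMFDerivAt h0

/-- The covariant acceleration in an arbitrary chart of the atlas. -/
lemma tangentTriv_covAccel {γ : ℝ → M} {t : ℝ} {x : M}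
    (hγ : ContMDiffAt 𝓘(ℝ, ℝ) 𝓘(ℝ, E) 2 γ t) (ht : γ t ∈ (chartAt E x).source) :
    (tangentTriv 𝓘(ℝ, E) x ⟨γ t, covAccel cov γ t⟩).2 =
      deriv (fun s => (tangentTriv 𝓘(ℝ, E) x (curveLift 𝓘(ℝ, E) γ s)).2) t +
        christoffelForm cov x (γ t) (tangentTriv 𝓘(ℝ, E) x (curveLift 𝓘(ℝ, E) γ t)).2
          (tangentTriv 𝓘(ℝ, E) x (curveLift 𝓘(ℝ, E) γ t)).2 := by
  set b := Module.finBasis ℝ E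
  set y := γ t with hy
  set V : E := velocity 𝓘(ℝ, E) γ t with hV
  have hmem : y ∈ (chartAt E y).source := mem_chart_source E y
  have hdiff : ∀ᶠ s in 𝓝 t, MDifferentiableAt 𝓘(ℝ, ℝ) 𝓘(ℝ, E) γ s := by
    have h1 : ∀ᶠ s in 𝓝 t, ContMDiffAt 𝓘(ℝ, ℝ) 𝓘(ℝ, E) 1 γ s :=
      (contMDiffAt_iff_contMDiffAt_nhds (by simp)).1 (hγ.of_le one_le_two)
    filter_upwards [h1] with s hs using hs.mdifferentiableAt (by simp)
  have hsy : ∀ᶠ s in 𝓝 t, γ s ∈ (chartAt E y).source :=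
    hγ.continuousAt.eventually_mem ((chartAt E y).open_source.mem_nhds hmem)
  have hsx : ∀ᶠ s in 𝓝 t, γ s ∈ (chartAt E x).source :=
    hγ.continuousAt.eventually_mem ((chartAt E x).open_source.mem_nhds ht)
  -- the transition between the two trivializations
  set A : M → E →L[ℝ] E := fun z =>
    ((tangentTriv 𝓘(ℝ, E) y).coordChangeL ℝ (tangentTriv 𝓘(ℝ, E) x) z : E →L[ℝ] E) with hA
  have hAs : ContMDiffAt 𝓘(ℝ, E) 𝓘(ℝ, E →L[ℝ] E) ∞ A y := contMDiffAt_coordChangeL hmem ht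
  have hAapp : ∀ z ∈ (chartAt E y).source, z ∈ (chartAt E x).source → ∀ a : E,
      A z a = (tangentTriv 𝓘(ℝ, E) x ⟨z, coordField (I := 𝓘(ℝ, E)) y a z⟩).2 :=
    fun z hzy hzx a => Trivialization.coordChangeL_apply _ _ ⟨hzy, hzx⟩ a
  have hAtriv : ∀ z ∈ (chartAt E y).source, z ∈ (chartAt E x).source →
      ∀ v : TangentSpace 𝓘(ℝ, E) z, (tangentTriv 𝓘(ℝ, E) x ⟨z, v⟩).2 =
        A z (tangentTriv 𝓘(ℝ, E) y ⟨z, v⟩).2 := by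
    intro z hzy hzx v
    rw [hAapp z hzy hzx, coordField_tangentTriv hzy]
  -- derivative of the transition along the curve
  set A' : E →L[ℝ] E := mvfderiv 𝓘(ℝ, E) A y (velocity 𝓘(ℝ, E) γ t) with hA'
  have hAγ : HasDerivAt (A ∘ γ) A' t :=
    hasDerivAt_comp_curve hdiff.self_of_nhds (hAs.mdifferentiableAt (by simp))
  -- the curve in the chart at `y`
  set w : ℝ → E := fun s => extChartAt 𝓘(ℝ, E) y (γ s) with hw
  set w' : ℝ → E := fun s => (tangentTriv 𝓘(ℝ, E) y (curveLift 𝓘(ℝ, E) γ s)).2 with hw'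
  have hww' : ∀ᶠ s in 𝓝 t, HasDerivAt w (w' s) s := by
    filter_upwards [hdiff, hsy] with s h1 h2 using hasDerivAt_extChartAt_comp_curve h1 h2
  have hw2 : ContDiffAt ℝ 2 w t := by
    rw [← contMDiffAt_iff_contDiffAt]
    exact (contMDiffAt_extChartAt' (n := 2) hmem).comp t hγ
  have hdw : deriv w =ᶠ[𝓝 t] w' := hww'.mono fun s hs => hs.deriv
  have hw'd : HasDerivAt w' (coordAccel 𝓘(ℝ, E) γ t : E) t := by
    have h1 : DifferentiableAt ℝ (deriv w) t := by
      have h2 : ContDiffAt ℝ 1 (fderiv ℝ w) t :=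
        hw2.fderiv_right (m := 1) (by rw [one_add_one_eq_two])
      exact (h2.differentiableAt (by simp)).clm_apply (differentiableAt_const (1 : ℝ))
    have h2 := h1.hasDerivAt.congr_of_eventuallyEq hdw.symm
    have h3 : (coordAccel 𝓘(ℝ, E) γ t : E) = deriv (deriv w) t := by
      rw [coordAccel, iteratedDeriv_succ, iteratedDeriv_one]
    rw [h3]
    exact h2
  have hw't : w' t = V := tangentTriv_self y _
  have hu : (fun s => (tangentTriv 𝓘(ℝ, E) x (curveLift 𝓘(ℝ, E) γ s)).2) =ᶠ[𝓝 t]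
      fun s => (A ∘ γ) s (w' s) := by
    filter_upwards [hsy, hsx] with s h1 h2 using hAtriv (γ s) h1 h2 _
  have hu' : deriv (fun s => (tangentTriv 𝓘(ℝ, E) x (curveLift 𝓘(ℝ, E) γ s)).2) t =
      A' V + A y (coordAccel 𝓘(ℝ, E) γ t : E) := by
    rw [hu.deriv_eq, (hAγ.clm_apply hw'd).deriv, hw't]
    rfl
  have hut : (tangentTriv 𝓘(ℝ, E) x (curveLift 𝓘(ℝ, E) γ t)).2 = A y V := by
    rw [← hw't]; exact hAtriv y hmem ht _
  -- the covariant derivative of the frame field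
  set c : Fin (Module.finrank ℝ E) → M → ℝ := fun i z => b.coord i (A z V) with hc
  have hcd : ∀ i, MDifferentiableAt 𝓘(ℝ, E) 𝓘(ℝ, ℝ) (c i) y := fun i => by
    have h1 : MDifferentiableAt 𝓘(ℝ, E) 𝓘(ℝ, E) (fun z => A z V) y :=
      ((hAs.clm_apply contMDiffAt_const).mdifferentiableAt (by simp))
    have h2 : Differentiable ℝ (fun a => (b.coord i).toContinuousLinearMap a) :=
      (b.coord i).toContinuousLinearMap.differentiable
    exact (h2.mdifferentiable (A y V)).comp y h1
  have hcd' : ∀ i, mvfderiv 𝓘(ℝ, E) (c i) y (velocity 𝓘(ℝ, E) γ t) = b.coord i (A' V) := by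
    intro i
    have h1 := hasDerivAt_comp_curve hdiff.self_of_nhds (hcd i)
    have h2 : HasDerivAt (c i ∘ γ) (b.coord i (A' V)) t := by
      have h3 := (b.coord i).toContinuousLinearMap.hasFDerivAt.comp_hasDerivAt t
        (hAγ.clm_apply (hasDerivAt_const t V))
      exact h3.congr_deriv (by simp)
    exact h1.unique h2
  -- The field that is constant in the chart at `y` has the components of `A z V` in the frame of
  -- the chart at `x`. By the Leibniz rule the variation of these components adds `A' V` to the
  -- Christoffel term.
  have hcov : cov (coordField (I := 𝓘(ℝ, E)) y V) y =
      cov (∑ i, c i • coordField (I := 𝓘(ℝ, E)) x (b i)) y := by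
    have hfr : ∀ i, MDifferentiableAt 𝓘(ℝ, E) 𝓘(ℝ, E).tangent (fun w =>
        (⟨w, (c i • coordField (I := 𝓘(ℝ, E)) x (b i)) w⟩ : TangentBundle 𝓘(ℝ, E) M)) y :=
      fun i => (hcd i).smul_section ((contMDiffAt_coordField (I := 𝓘(ℝ, E)) ht (b i)).mdifferentiableAt (by simp))
    refine cov.isCovariantDerivativeOnUniv.congr_of_eventuallyEq
      ((contMDiffAt_coordField (I := 𝓘(ℝ, E)) hmem V).mdifferentiableAt (by simp)) ?_ univ_mem ?_
    · have := MDifferentiableAt.sum_section (s := Finset.univ)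
        (t := fun i => c i • coordField (I := 𝓘(ℝ, E)) x (b i)) (fun i _ => hfr i)
      simpa only [Finset.sum_apply] using this
    · filter_upwards [(chartAt E y).open_source.mem_nhds hmem,
        (chartAt E x).open_source.mem_nhds ht] with z hzy hzx
      refine tangentTriv_injective hzx ?_
      rw [← hAapp z hzy hzx, Finset.sum_apply, tangentTriv_sum hzx]
      conv_lhs => rw [← b.sum_repr (A z V)]
      refine Finset.sum_congr rfl fun i _ => ?_
      rw [Pi.smul_apply', tangentTriv_smul hzx, tangentTriv_coordField hzx]
      rfl
  have hcov' : (tangentTriv 𝓘(ℝ, E) x ⟨y, cov (coordField (I := 𝓘(ℝ, E)) y V) y V⟩).2 =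
      christoffelForm cov x y (A y V) (A y V) + A' V := by
    rw [hcov, CovariantDerivative.apply_sum_smul cov _ hcd
      (fun i => (contMDiffAt_coordField (I := 𝓘(ℝ, E)) ht (b i)).mdifferentiableAt (by simp)),
      tangentTriv_sum ht]
    have h1 : ∀ i, (tangentTriv 𝓘(ℝ, E) x ⟨y, c i y • cov (coordField (I := 𝓘(ℝ, E)) x (b i)) y V +
        mvfderiv 𝓘(ℝ, E) (c i) y V • coordField (I := 𝓘(ℝ, E)) x (b i) y⟩).2 =
        ∑ j, (b.coord i (A y V) * b.coord j (A y V)) • christoffelSymbol cov x i j y +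
          b.coord i (A' V) • b i := by
      intro i
      rw [tangentTriv_add ht, tangentTriv_smul ht, tangentTriv_smul ht, tangentTriv_coordField ht,
        hcd' i]
      congr 1
      have h2 : (V : TangentSpace 𝓘(ℝ, E) y) =
          ∑ j, b.coord j (A y V) • coordField (I := 𝓘(ℝ, E)) x (b j) y := by
        refine tangentTriv_injective ht ?_
        rw [tangentTriv_sum ht]
        rw [show (tangentTriv 𝓘(ℝ, E) x ⟨y, V⟩).2 = A y V from hut]
        conv_lhs => rw [← b.sum_repr (A y V)]
        refine Finset.sum_congr rfl fun i _ => ?_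
        rw [tangentTriv_smul ht, tangentTriv_coordField ht]
        rfl
      conv_lhs => rw [h2, map_sum, tangentTriv_sum ht]
      rw [Finset.smul_sum]
      refine Finset.sum_congr rfl fun j _ => ?_
      rw [map_smul, tangentTriv_smul ht, smul_smul]
      rfl
    rw [Finset.sum_congr rfl fun i _ => h1 i, Finset.sum_add_distrib]
    congr 1
    exact b.sum_repr (A' V)
  -- The term `A' V` occurs on both sides, once through the connection and once through the
  -- derivative of the velocity components. This is the transformation law of the Christoffel
  -- symbols.
  rw [hut, hu', covAccel, tangentTriv_add ht, hAtriv y hmem ht, tangentTriv_self]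
  have h5 : (tangentTriv 𝓘(ℝ, E) x ⟨y, cov (coordField (I := 𝓘(ℝ, E)) y (velocity 𝓘(ℝ, E) γ t)) y
    (velocity 𝓘(ℝ, E) γ t)⟩).2 = _ := hcov'
  rw [h5]
  abel

end GeodesicChart

/-! ### The properties of geodesics on which the rest depends -/

section HasFlowDef

variable {E : Type*} [NormedAddCommGroup E] [NormedSpace ℝ E]
  {H : Type*} [TopologicalSpace H] {I : ModelWithCorners ℝ E H}
  {M : Type*} [TopologicalSpace M] [ChartedSpace H M] [IsManifold I ∞ M]

/-- Geodesics are determined by one of their velocity vectors, and there is a smooth local geodesic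
flow. -/
structure HasFlow (cov : CovariantDerivative I E (TangentSpace I : M → Type _)) : Prop where
  unique : ∀ {γ γ' : ℝ → M} {J : Set ℝ}, IsGeodesicOn cov γ J → IsGeodesicOn cov γ' J →
    ∀ {t₀ : ℝ}, t₀ ∈ J → curveLift I γ t₀ = curveLift I γ' t₀ →
    ∀ t ∈ J, curveLift I γ t = curveLift I γ' t
  flow : ∀ v₀ : TangentBundle I M, ∃ ε > 0, ∃ U : Set (TangentBundle I M), IsOpen U ∧ v₀ ∈ U ∧
    ∃ Ψ : ℝ → TangentBundle I M → TangentBundle I M,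
      ContMDiffOn (𝓘(ℝ, ℝ).prod I.tangent) I.tangent ∞
        (fun p : ℝ × TangentBundle I M => Ψ p.1 p.2) (Ioo (-ε) ε ×ˢ U) ∧
      ∀ v ∈ U, Ψ 0 v = v ∧ IsGeodesicOn cov (fun s => (Ψ s v).1) (Ioo (-ε) ε) ∧
        ∀ s ∈ Ioo (-ε) ε, curveLift I (fun s => (Ψ s v).1) s = Ψ s v

end HasFlowDef

/-! ### The geodesic spray: uniqueness and smooth flow of geodesics -/

section Spray

set_option linter.unusedSectionVars false

variable {E : Type*} [NormedAddCommGroup E] [NormedSpace ℝ E] [FiniteDimensional ℝ E]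
  {M : Type*} [TopologicalSpace M] [ChartedSpace E M] [IsManifold 𝓘(ℝ, E) ∞ M]
  (cov : CovariantDerivative 𝓘(ℝ, E) E (TangentSpace 𝓘(ℝ, E) : M → Type _))

/-- The geodesic spray in the chart at `x`. -/
noncomputable def spray (x : M) (p : E × E) : E × E :=
  (p.2, -christoffelForm cov x ((extChartAt 𝓘(ℝ, E) x).symm p.1) p.2 p.2)

lemma contDiffOn_spray [T2Space M] [CovariantDerivative.ContMDiffCovariantDerivative cov ∞]
    (x : M) : ContDiffOn ℝ ∞ (spray cov x) ((extChartAt 𝓘(ℝ, E) x).target ×ˢ univ) := by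
  have h1 : ∀ i j, ContDiffOn ℝ ∞ (fun p : E × E =>
      christoffelSymbol cov x i j ((extChartAt 𝓘(ℝ, E) x).symm p.1))
      ((extChartAt 𝓘(ℝ, E) x).target ×ˢ univ) := by
    intro i j
    have h2 : ContDiffOn ℝ ∞ (fun y : E =>
        christoffelSymbol cov x i j ((extChartAt 𝓘(ℝ, E) x).symm y))
        (extChartAt 𝓘(ℝ, E) x).target := by
      rw [← contMDiffOn_iff_contDiffOn]
      intro y hy
      have hy' : (extChartAt 𝓘(ℝ, E) x).symm y ∈ (chartAt E x).source := by
        have := (extChartAt 𝓘(ℝ, E) x).map_target hy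
        rwa [extChartAt_source] at this
      exact (contMDiffAt_christoffelSymbol cov hy' i j).comp_contMDiffWithinAt y
        (contMDiffOn_extChartAt_symm x y hy)
    exact h2.comp contDiff_fst.contDiffOn fun p hp => hp.1
  have h3 : ∀ i, ContDiff ℝ ∞ (fun p : E × E => (Module.finBasis ℝ E).coord i p.2) := fun i =>
    ((Module.finBasis ℝ E).coord i).toContinuousLinearMap.contDiff.comp contDiff_snd
  refine contDiff_snd.contDiffOn.prodMk (ContDiffOn.neg ?_)
  exact ContDiffOn.sum fun i _ => ContDiffOn.sum fun j _ =>
    ((h3 i).contDiffOn.mul (h3 j).contDiffOn).smul (h1 i j)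

/-- The coordinates on the tangent bundle induced by the chart at `x`. -/
noncomputable def tangentCoord (x : M) (v : TangentBundle 𝓘(ℝ, E) M) : E × E :=
  (extChartAt 𝓘(ℝ, E) x v.1, (tangentTriv 𝓘(ℝ, E) x v).2)

/-- The coordinates depend on the base point of `v` only and are those of the chart of the tangent
bundle at `v`, so the smoothness of manifold charts applies to them. -/
lemma tangentCoord_eq (v w : TangentBundle 𝓘(ℝ, E) M) :
    tangentCoord v.1 w = extChartAt 𝓘(ℝ, E).tangent v w := by
  rw [FiberBundle.extChartAt]
  rfl

lemma tangentCoord_injOn {x : M} {v w : TangentBundle 𝓘(ℝ, E) M}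
    (hv : v.1 ∈ (chartAt E x).source) (hw : w.1 ∈ (chartAt E x).source)
    (h : tangentCoord x v = tangentCoord x w) : v = w := by
  obtain ⟨y, v⟩ := v
  obtain ⟨z, w⟩ := w
  have h1 : y = z := (extChartAt 𝓘(ℝ, E) x).injOn (by simpa using hv) (by simpa using hw)
    (congrArg Prod.fst h)
  subst h1
  have h2 : (tangentTriv 𝓘(ℝ, E) x ⟨y, v⟩).2 = (tangentTriv 𝓘(ℝ, E) x ⟨y, w⟩).2 := by
    have := congrArg Prod.snd h
    exact this
  exact congrArg _ (tangentTriv_injective hv h2)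

lemma differentiableAt_tangentTriv_curveLift {γ : ℝ → M} {t : ℝ} {x : M}
    (hγ : ContMDiffAt 𝓘(ℝ, ℝ) 𝓘(ℝ, E) 2 γ t) (ht : γ t ∈ (chartAt E x).source) :
    DifferentiableAt ℝ (fun s => (tangentTriv 𝓘(ℝ, E) x (curveLift 𝓘(ℝ, E) γ s)).2) t := by
  have hdiff : ∀ᶠ s in 𝓝 t, MDifferentiableAt 𝓘(ℝ, ℝ) 𝓘(ℝ, E) γ s := by
    have h1 : ∀ᶠ s in 𝓝 t, ContMDiffAt 𝓘(ℝ, ℝ) 𝓘(ℝ, E) 1 γ s :=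
      (contMDiffAt_iff_contMDiffAt_nhds (by simp)).1 (hγ.of_le one_le_two)
    filter_upwards [h1] with s hs using hs.mdifferentiableAt (by simp)
  have hsx : ∀ᶠ s in 𝓝 t, γ s ∈ (chartAt E x).source :=
    hγ.continuousAt.eventually_mem ((chartAt E x).open_source.mem_nhds ht)
  have hw2 : ContDiffAt ℝ 2 (extChartAt 𝓘(ℝ, E) x ∘ γ) t := by
    rw [← contMDiffAt_iff_contDiffAt]
    exact (contMDiffAt_extChartAt' (n := 2) ht).comp t hγ
  have h2 : ContDiffAt ℝ 1 (fderiv ℝ (extChartAt 𝓘(ℝ, E) x ∘ γ)) t :=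
    hw2.fderiv_right (m := 1) (by rw [one_add_one_eq_two])
  have h3 : DifferentiableAt ℝ (deriv (extChartAt 𝓘(ℝ, E) x ∘ γ)) t :=
    (h2.differentiableAt (by simp)).clm_apply (differentiableAt_const (1 : ℝ))
  refine h3.congr_of_eventuallyEq ?_
  filter_upwards [hdiff, hsx] with s h1 h2
  exact (hasDerivAt_extChartAt_comp_curve h1 h2).deriv.symm

/-- The geodesic equation as a first order system. -/
lemma covAccel_eq_zero_iff_hasDerivAt {γ : ℝ → M} {t : ℝ} {x : M}
    (hγ : ContMDiffAt 𝓘(ℝ, ℝ) 𝓘(ℝ, E) 2 γ t) (ht : γ t ∈ (chartAt E x).source) :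
    covAccel cov γ t = 0 ↔ HasDerivAt (fun s => tangentCoord x (curveLift 𝓘(ℝ, E) γ s))
      (spray cov x (tangentCoord x (curveLift 𝓘(ℝ, E) γ t))) t := by
  have h1 := hasDerivAt_extChartAt_comp_curve (hγ.mdifferentiableAt (by simp)) ht
  have h2 := (differentiableAt_tangentTriv_curveLift hγ ht).hasDerivAt
  have h3 := tangentTriv_covAccel cov hγ ht
  have hinv : (extChartAt 𝓘(ℝ, E) x).symm (extChartAt 𝓘(ℝ, E) x (γ t)) = γ t :=
    (extChartAt 𝓘(ℝ, E) x).left_inv (by simpa using ht)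
  have hspray : spray cov x (tangentCoord x (curveLift 𝓘(ℝ, E) γ t)) =
      ((tangentTriv 𝓘(ℝ, E) x (curveLift 𝓘(ℝ, E) γ t)).2,
        -christoffelForm cov x (γ t) (tangentTriv 𝓘(ℝ, E) x (curveLift 𝓘(ℝ, E) γ t)).2
          (tangentTriv 𝓘(ℝ, E) x (curveLift 𝓘(ℝ, E) γ t)).2) := by
    simp only [spray, tangentCoord, curveLift_fst, hinv]
  have h0 : (tangentTriv 𝓘(ℝ, E) x ⟨γ t, (0 : TangentSpace 𝓘(ℝ, E) (γ t))⟩).2 = 0 :=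
    ((tangentTriv 𝓘(ℝ, E) x).linear ℝ ht).map_zero
  rw [hspray]
  constructor
  · intro h
    refine h1.prodMk ?_
    rw [h, h0] at h3
    rwa [eq_neg_of_add_eq_zero_left h3.symm] at h2
  · intro h
    have h4 := (ContinuousLinearMap.snd ℝ E E).hasFDerivAt.comp_hasDerivAt t h
    refine tangentTriv_injective ht ?_
    have h5 : deriv (fun s => (tangentTriv 𝓘(ℝ, E) x (curveLift 𝓘(ℝ, E) γ s)).2) t =
      -christoffelForm cov x (γ t) (tangentTriv 𝓘(ℝ, E) x (curveLift 𝓘(ℝ, E) γ t)).2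
          (tangentTriv 𝓘(ℝ, E) x (curveLift 𝓘(ℝ, E) γ t)).2 := h4.deriv
    rw [h3, h0, h5]
    simp


lemma continuousAt_tangentCoord_curveLift {γ : ℝ → M} {t : ℝ} {x : M}
    (hγ : ContMDiffAt 𝓘(ℝ, ℝ) 𝓘(ℝ, E) 2 γ t) (ht : γ t ∈ (chartAt E x).source) :
    ContinuousAt (fun s => tangentCoord x (curveLift 𝓘(ℝ, E) γ s)) t :=
  ((continuousAt_extChartAt' (by simpa using ht)).comp hγ.continuousAt).prodMk
    (differentiableAt_tangentTriv_curveLift hγ ht).continuousAt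

variable {cov}

lemma IsGeodesicOn.contMDiffAt {γ : ℝ → M} {J : Set ℝ} (h : IsGeodesicOn cov γ J) {t : ℝ}
    (ht : t ∈ J) : ContMDiffAt 𝓘(ℝ, ℝ) 𝓘(ℝ, E) 2 γ t :=
  h.contMDiffOn.contMDiffAt (h.isOpen.mem_nhds ht)

/-- In the chart at `γ t` both lifts solve the first order system of the spray, which is Lipschitz
near their common value. -/
lemma IsGeodesicOn.eventually_curveLift_eq [T2Space M]
    [CovariantDerivative.ContMDiffCovariantDerivative cov ∞] {γ γ' : ℝ → M} {J : Set ℝ}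
    (h : IsGeodesicOn cov γ J) (h' : IsGeodesicOn cov γ' J) {t : ℝ} (ht : t ∈ J)
    (heq : curveLift 𝓘(ℝ, E) γ t = curveLift 𝓘(ℝ, E) γ' t) :
    ∀ᶠ s in 𝓝 t, curveLift 𝓘(ℝ, E) γ s = curveLift 𝓘(ℝ, E) γ' s := by
  set x := γ t with hx
  have hxγ : γ t ∈ (chartAt E x).source := mem_chart_source E x
  have hxγ' : γ' t ∈ (chartAt E x).source := by
    rw [← curveLift_fst (I := 𝓘(ℝ, E)) γ' t, ← heq]
    exact hxγ
  set u₀ := tangentCoord x (curveLift 𝓘(ℝ, E) γ t) with hu₀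
  have hO : IsOpen ((extChartAt 𝓘(ℝ, E) x).target ×ˢ (univ : Set E)) :=
    (isOpen_extChartAt_target x).prod isOpen_univ
  have hu₀O : u₀ ∈ (extChartAt 𝓘(ℝ, E) x).target ×ˢ (univ : Set E) :=
    ⟨(extChartAt 𝓘(ℝ, E) x).map_source (by simp [hx]), mem_univ _⟩
  obtain ⟨K, s, hs, hK⟩ := (((contDiffOn_spray cov x).contDiffAt (hO.mem_nhds hu₀O)).of_le
    (m := 1) (by norm_cast)).exists_lipschitzOnWith
  have key : ∀ {β : ℝ → M}, IsGeodesicOn cov β J → β t ∈ (chartAt E x).source →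
      tangentCoord x (curveLift 𝓘(ℝ, E) β t) = u₀ →
      ∀ᶠ r in 𝓝 t, HasDerivAt (fun s => tangentCoord x (curveLift 𝓘(ℝ, E) β s))
        (spray cov x (tangentCoord x (curveLift 𝓘(ℝ, E) β r))) r ∧
        tangentCoord x (curveLift 𝓘(ℝ, E) β r) ∈ s := by
    intro β hβ hβt hβu
    have h1 : ∀ᶠ r in 𝓝 t, β r ∈ (chartAt E x).source :=
      (hβ.contMDiffAt ht).continuousAt.eventually_mem ((chartAt E x).open_source.mem_nhds hβt)
    have h2 := (continuousAt_tangentCoord_curveLift (hβ.contMDiffAt ht) hβt).eventually_mem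
      (by rw [hβu]; exact hs)
    filter_upwards [h1, h2, hβ.isOpen.mem_nhds ht] with r h1 h2 h3
    exact ⟨(covAccel_eq_zero_iff_hasDerivAt cov (hβ.contMDiffAt h3) h1).1
      (hβ.covAccel_eq_zero r h3), h2⟩
  have h3 := ODE_solution_unique_of_eventually (v := fun _ => spray cov x) (s := fun _ => s)
    (Eventually.of_forall fun _ => hK) (key h hxγ rfl) (key h' hxγ' (by rw [← heq]))
    (congrArg (tangentCoord x) heq)
  filter_upwards [h3,
    (h.contMDiffAt ht).continuousAt.eventually_mem ((chartAt E x).open_source.mem_nhds hxγ),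
    (h'.contMDiffAt ht).continuousAt.eventually_mem ((chartAt E x).open_source.mem_nhds hxγ')]
    with r h1 h2 h3
  exact tangentCoord_injOn h2 h3 h1

/-- The set of times of agreement is open by local uniqueness and closed in `J` because `M` is
Hausdorff and the lifts are continuous; `J` is connected. -/
lemma IsGeodesicOn.curveLift_eq_of_eq [T2Space M]
    [CovariantDerivative.ContMDiffCovariantDerivative cov ∞] {γ γ' : ℝ → M} {J : Set ℝ}
    (h : IsGeodesicOn cov γ J) (h' : IsGeodesicOn cov γ' J) {t₀ : ℝ} (ht₀ : t₀ ∈ J)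
    (heq : curveLift 𝓘(ℝ, E) γ t₀ = curveLift 𝓘(ℝ, E) γ' t₀) :
    ∀ t ∈ J, curveLift 𝓘(ℝ, E) γ t = curveLift 𝓘(ℝ, E) γ' t := by
  set u : Set ℝ := {t | t ∈ J ∧ curveLift 𝓘(ℝ, E) γ t = curveLift 𝓘(ℝ, E) γ' t} with hu
  have hsub : J ⊆ u := by
    refine h.ordConnected.isPreconnected.subset_of_closure_inter_subset ?_ ⟨t₀, ht₀, ht₀, heq⟩ ?_
    · rw [isOpen_iff_mem_nhds]
      rintro t ⟨ht, hteq⟩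
      filter_upwards [h.isOpen.mem_nhds ht, h.eventually_curveLift_eq h' ht hteq] with s h1 h2
      exact ⟨h1, h2⟩
    · rintro t ⟨htu, ht⟩
      refine ⟨ht, ?_⟩
      have : (𝓝[u] t).NeBot := mem_closure_iff_nhdsWithin_neBot.1 htu
      have hev : ∀ᶠ s in 𝓝[u] t, curveLift 𝓘(ℝ, E) γ s = curveLift 𝓘(ℝ, E) γ' s :=
        eventually_mem_nhdsWithin.mono fun s hs => hs.2
      have hc := (h.contMDiffAt ht).continuousAt.tendsto.mono_left
        (nhdsWithin_le_nhds (s := u))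
      have hc' := (h'.contMDiffAt ht).continuousAt.tendsto.mono_left
        (nhdsWithin_le_nhds (s := u))
      have hx : γ t = γ' t := tendsto_nhds_unique_of_eventuallyEq hc hc'
        (hev.mono fun s hs => congrArg TotalSpace.proj hs)
      have hxγ : γ t ∈ (chartAt E (γ t)).source := mem_chart_source E _
      have hxγ' : γ' t ∈ (chartAt E (γ t)).source := hx ▸ hxγ
      have hd := (continuousAt_tangentCoord_curveLift (h.contMDiffAt ht) hxγ).tendsto.mono_left
        (nhdsWithin_le_nhds (s := u))
      have hd' := (continuousAt_tangentCoord_curveLift (h'.contMDiffAt ht) hxγ').tendsto.mono_left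
        (nhdsWithin_le_nhds (s := u))
      exact tangentCoord_injOn hxγ hxγ' (tendsto_nhds_unique_of_eventuallyEq hd hd'
        (hev.mono fun s hs => congrArg (tangentCoord (γ t)) hs))
  exact fun t ht => (hsub ht).2

variable (cov)

/-- A smooth connection has a smooth local geodesic flow. -/
lemma hasFlow_of_contMDiff [T2Space M] [CovariantDerivative.ContMDiffCovariantDerivative cov ∞] :
    HasFlow cov := by
  refine ⟨fun h h' _ ht₀ heq => h.curveLift_eq_of_eq h' ht₀ heq, fun v₀ => ?_⟩
  set x := v₀.1 with hx
  set e := extChartAt 𝓘(ℝ, E).tangent v₀ with he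
  have hev : ∀ w, tangentCoord x w = e w := tangentCoord_eq v₀
  have hesource : ∀ {w}, w ∈ e.source ↔ w.1 ∈ (chartAt E x).source := by
    intro w
    rw [he, extChartAt_source, TangentBundle.mem_chart_source_iff]
  have hO : IsOpen ((extChartAt 𝓘(ℝ, E) x).target ×ˢ (univ : Set E)) :=
    (isOpen_extChartAt_target x).prod isOpen_univ
  have htarget : ∀ p, p ∈ e.target ↔ p ∈ (extChartAt 𝓘(ℝ, E) x).target ×ˢ (univ : Set E) := by
    intro p
    constructor
    · intro hp
      have h1 := e.map_target hp
      rw [← e.right_inv hp, ← hev]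
      exact ⟨(extChartAt 𝓘(ℝ, E) x).map_source (by simpa using hesource.1 h1), mem_univ _⟩
    · intro hp
      rw [he]
      erw [FiberBundle.extChartAt_target]
      refine ⟨⟨hp.1, ?_⟩, mem_univ _⟩
      have := (extChartAt 𝓘(ℝ, E) x).map_target hp.1
      rwa [extChartAt_source] at this
  have hv₀ : e v₀ ∈ (extChartAt 𝓘(ℝ, E) x).target ×ˢ (univ : Set E) :=
    (htarget _).1 (mem_extChartAt_target v₀)
  obtain ⟨r, hr, ε, hε, φ, hφs, hφ⟩ := exists_contDiffOn_flow hO (contDiffOn_spray cov x) hv₀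
  set U : Set (TangentBundle 𝓘(ℝ, E) M) := e.source ∩ e ⁻¹' Metric.ball (e v₀) r with hU
  have hUo : IsOpen U :=
    (continuousOn_extChartAt v₀).isOpen_inter_preimage (isOpen_extChartAt_source v₀)
      Metric.isOpen_ball
  have hes : ContMDiffOn 𝓘(ℝ, E).tangent 𝓘(ℝ, E × E) ∞ e e.source := by
    rw [he, extChartAt_source]; exact contMDiffOn_extChartAt
  have hes' : ContMDiffOn 𝓘(ℝ, E × E) 𝓘(ℝ, E).tangent ∞ e.symm e.target :=
    contMDiffOn_extChartAt_symm v₀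
  refine ⟨ε, hε, U, hUo, ⟨mem_extChartAt_source v₀, Metric.mem_ball_self hr⟩,
    fun s v => e.symm (φ (e v) s), ?_, ?_⟩
  · have h1 : ContMDiffOn (𝓘(ℝ, ℝ).prod 𝓘(ℝ, E).tangent) 𝓘(ℝ, (E × E) × ℝ) ∞
        (fun p : ℝ × TangentBundle 𝓘(ℝ, E) M => (e p.2, p.1)) (Ioo (-ε) ε ×ˢ U) :=
      (hes.comp contMDiffOn_snd fun p hp => hp.2.1).prodMk_space contMDiffOn_fst
    have h2 : ContMDiffOn (𝓘(ℝ, ℝ).prod 𝓘(ℝ, E).tangent) 𝓘(ℝ, E × E) ∞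
        (fun p : ℝ × TangentBundle 𝓘(ℝ, E) M => φ (e p.2) p.1) (Ioo (-ε) ε ×ˢ U) :=
      (contMDiffOn_iff_contDiffOn.2 hφs).comp h1 fun p hp => ⟨hp.2.2, hp.1⟩
    exact hes'.comp h2 fun p hp => (htarget _).2 ((hφ _ hp.2.2).2 p.1 hp.1).1
  · intro v hv
    obtain ⟨h0, hode⟩ := hφ (e v) hv.2
    have hcoord : ∀ s ∈ Ioo (-ε) ε, tangentCoord x (e.symm (φ (e v) s)) = φ (e v) s :=
      fun s hs => (hev _).trans (e.right_inv ((htarget _).2 (hode s hs).1))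
    have hsrc : ∀ s ∈ Ioo (-ε) ε, (e.symm (φ (e v) s)).1 ∈ (chartAt E x).source :=
      fun s hs => hesource.1 (e.map_target ((htarget _).2 (hode s hs).1))
    have hsm : ContMDiffOn 𝓘(ℝ, ℝ) 𝓘(ℝ, E) ∞ (fun s => (e.symm (φ (e v) s)).1) (Ioo (-ε) ε) := by
      have h1 : ContDiffOn ℝ ∞ (fun s => φ (e v) s) (Ioo (-ε) ε) :=
        hφs.comp (contDiffOn_const.prodMk contDiffOn_id) fun s hs => ⟨hv.2, hs⟩
      exact (contMDiff_proj (TangentSpace 𝓘(ℝ, E) : M → Type _)).comp_contMDiffOn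
        (hes'.comp (contMDiffOn_iff_contDiffOn.2 h1) fun s hs => (htarget _).2 (hode s hs).1)
    have hsm2 : ContMDiffOn 𝓘(ℝ, ℝ) 𝓘(ℝ, E) 2 (fun s => (e.symm (φ (e v) s)).1) (Ioo (-ε) ε) :=
      hsm.of_le (by norm_cast)
    have hnhds : ∀ s ∈ Ioo (-ε) ε, Ioo (-ε) ε ∈ 𝓝 s := fun s hs => isOpen_Ioo.mem_nhds hs
    -- The first component of the spray is the velocity, so the second component of a solution is
    -- the derivative of the first: a solution is the lift of its own base curve.
    have hlift : ∀ s ∈ Ioo (-ε) ε, tangentCoord x (curveLift 𝓘(ℝ, E)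
        (fun s => (e.symm (φ (e v) s)).1) s) = φ (e v) s := by
      intro s hs
      have h1 := hasDerivAt_extChartAt_comp_curve
        ((hsm2.contMDiffAt (hnhds s hs)).mdifferentiableAt (by simp)) (hsrc s hs)
      have h2 : HasDerivAt (extChartAt 𝓘(ℝ, E) x ∘ fun s => (e.symm (φ (e v) s)).1)
          (φ (e v) s).2 s := by
        refine ((ContinuousLinearMap.fst ℝ E E).hasFDerivAt.comp_hasDerivAt s
          (hode s hs).2).congr_of_eventuallyEq ?_
        filter_upwards [hnhds s hs] with r hr
        exact congrArg Prod.fst (hcoord r hr)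
      have h3 := congrArg Prod.fst (hcoord s hs)
      exact Prod.ext h3 (h1.unique h2)
    refine ⟨?_, ⟨isOpen_Ioo, ordConnected_Ioo, hsm2, fun s hs => ?_⟩, fun s hs => ?_⟩
    · change e.symm (φ (e v) 0) = v
      rw [h0, e.left_inv hv.1]
    · rw [covAccel_eq_zero_iff_hasDerivAt cov (hsm2.contMDiffAt (hnhds s hs)) (hsrc s hs),
        hlift s hs]
      refine (hode s hs).2.congr_of_eventuallyEq ?_
      filter_upwards [hnhds s hs] with r hr using hlift r hr
    · exact tangentCoord_injOn (hsrc s hs) (hsrc s hs)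
        ((hlift s hs).trans (hcoord s hs).symm)

end Spray

/-! ### Geodesics of the product connection -/

section ProductGeodesics

set_option linter.unusedSectionVars false

variable {E₁ : Type*} [NormedAddCommGroup E₁] [NormedSpace ℝ E₁] [FiniteDimensional ℝ E₁]
  {M₁ : Type*} [TopologicalSpace M₁] [ChartedSpace E₁ M₁] [IsManifold 𝓘(ℝ, E₁) ∞ M₁]
  {E₂ : Type*} [NormedAddCommGroup E₂] [NormedSpace ℝ E₂] [FiniteDimensional ℝ E₂]
  {M₂ : Type*} [TopologicalSpace M₂] [ChartedSpace E₂ M₂] [IsManifold 𝓘(ℝ, E₂) ∞ M₂]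

/-- Both sides are derivatives of the same chart transition, one computed in the product and one
factor by factor, and the derivative is unique. -/
lemma tangentTriv_prod {x q : M₁ × M₂} (hq : q ∈ (chartAt (ModelProd E₁ E₂) x).source)
    (v : TangentSpace (𝓘(ℝ, E₁).prod 𝓘(ℝ, E₂)) q) :
    ((tangentTriv (𝓘(ℝ, E₁).prod 𝓘(ℝ, E₂)) x ⟨q, v⟩).2 : E₁ × E₂) =
      ((tangentTriv 𝓘(ℝ, E₁) x.1 ⟨q.1, (v : E₁ × E₂).1⟩).2, (tangentTriv 𝓘(ℝ, E₂) x.2 ⟨q.2, (v : E₁ × E₂).2⟩).2) := by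
  have : IsManifold 𝓘(ℝ, E₁) 1 M₁ := .of_le (n := ∞) (by simp)
  have : IsManifold 𝓘(ℝ, E₂) 1 M₂ := .of_le (n := ∞) (by simp)
  have hq1 : q.1 ∈ (chartAt E₁ x.1).source := hq.1
  have hq2 : q.2 ∈ (chartAt E₂ x.2).source := hq.2
  have h1 := hasFDerivWithinAt_tangentCoordChange (I := 𝓘(ℝ, E₁)) (x := q.1) (y := x.1) (z := q.1)
    ⟨mem_extChartAt_source _, by simpa using hq1⟩
  have h2 := hasFDerivWithinAt_tangentCoordChange (I := 𝓘(ℝ, E₂)) (x := q.2) (y := x.2) (z := q.2)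
    ⟨mem_extChartAt_source _, by simpa using hq2⟩
  have h := hasFDerivWithinAt_tangentCoordChange (I := (𝓘(ℝ, E₁).prod 𝓘(ℝ, E₂))) (x := q) (y := x) (z := q)
    ⟨mem_extChartAt_source _, by rw [extChartAt_source]; exact hq⟩
  have h3 : HasFDerivWithinAt (extChartAt (𝓘(ℝ, E₁).prod 𝓘(ℝ, E₂)) x ∘ (extChartAt (𝓘(ℝ, E₁).prod 𝓘(ℝ, E₂)) q).symm)
      ((tangentCoordChange 𝓘(ℝ, E₁) q.1 x.1 q.1).prodMap (tangentCoordChange 𝓘(ℝ, E₂) q.2 x.2 q.2))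
      (range (𝓘(ℝ, E₁).prod 𝓘(ℝ, E₂))) (extChartAt (𝓘(ℝ, E₁).prod 𝓘(ℝ, E₂)) q q) := by
    have := HasFDerivWithinAt.prodMap (p := (extChartAt 𝓘(ℝ, E₁) q.1 q.1, extChartAt 𝓘(ℝ, E₂) q.2 q.2))
      (s := range (𝓘(ℝ, E₁).prod 𝓘(ℝ, E₂))) (h1.mono (by simp)) (h2.mono (by simp))
    exact this
  have h4 := ((ModelWithCorners.uniqueDiffOn _) _ (mem_range_self _)).eq h h3
  exact congrArg (fun L => L v) h4

lemma velocity_prod {γ : ℝ → M₁ × M₂} {t : ℝ} (hγ : MDifferentiableAt 𝓘(ℝ, ℝ) (𝓘(ℝ, E₁).prod 𝓘(ℝ, E₂)) γ t) :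
    (velocity (𝓘(ℝ, E₁).prod 𝓘(ℝ, E₂)) γ t : E₁ × E₂) =
      (velocity 𝓘(ℝ, E₁) (fun s => (γ s).1) t, velocity 𝓘(ℝ, E₂) (fun s => (γ s).2) t) := by
  have h := mfderiv_prodMk hγ.fst hγ.snd
  exact congrArg (fun L : ℝ →L[ℝ] E₁ × E₂ => L 1) h

lemma coordAccel_prod {γ : ℝ → M₁ × M₂} {t : ℝ} (hγ : ContMDiffAt 𝓘(ℝ, ℝ) (𝓘(ℝ, E₁).prod 𝓘(ℝ, E₂)) 2 γ t) :
    (coordAccel (𝓘(ℝ, E₁).prod 𝓘(ℝ, E₂)) γ t : E₁ × E₂) =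
      (coordAccel 𝓘(ℝ, E₁) (fun s => (γ s).1) t, coordAccel 𝓘(ℝ, E₂) (fun s => (γ s).2) t) := by
  have hw2 : ContDiffAt ℝ 2 (fun s => extChartAt (𝓘(ℝ, E₁).prod 𝓘(ℝ, E₂)) (γ t) (γ s)) t := by
    rw [← contMDiffAt_iff_contDiffAt]
    exact (contMDiffAt_extChartAt (n := 2)).comp t hγ
  have h1 := (ContinuousLinearMap.fst ℝ E₁ E₂).iteratedFDeriv_comp_left hw2 (i := 2) (by norm_cast)
  have h2 := (ContinuousLinearMap.snd ℝ E₁ E₂).iteratedFDeriv_comp_left hw2 (i := 2) (by norm_cast)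
  refine Prod.ext ?_ ?_
  · exact (congrArg (fun L => L fun _ => 1) h1).symm
  · exact (congrArg (fun L => L fun _ => 1) h2).symm


lemma coordField_prod {x q : M₁ × M₂} (hq : q ∈ (chartAt (ModelProd E₁ E₂) x).source)
    (V : E₁ × E₂) :
    (coordField (I := (𝓘(ℝ, E₁).prod 𝓘(ℝ, E₂))) x V q : E₁ × E₂) =
      (coordField (I := 𝓘(ℝ, E₁)) x.1 V.1 q.1, coordField (I := 𝓘(ℝ, E₂)) x.2 V.2 q.2) := by
  have hq1 : q.1 ∈ (chartAt E₁ x.1).source := hq.1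
  have hq2 : q.2 ∈ (chartAt E₂ x.2).source := hq.2
  have h0 : (tangentTriv (𝓘(ℝ, E₁).prod 𝓘(ℝ, E₂)) x ⟨q, coordField (I := (𝓘(ℝ, E₁).prod 𝓘(ℝ, E₂))) x V q⟩).2 = V :=
    congrArg Prod.snd ((tangentTriv (𝓘(ℝ, E₁).prod 𝓘(ℝ, E₂)) x).apply_mk_symm hq V)
  have h1 := (tangentTriv_prod hq (coordField (I := (𝓘(ℝ, E₁).prod 𝓘(ℝ, E₂))) x V q)).symm.trans h0
  refine Prod.ext ?_ ?_
  · refine tangentTriv_injective hq1 ?_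
    rw [tangentTriv_coordField hq1]
    exact congrArg Prod.fst h1
  · refine tangentTriv_injective hq2 ?_
    rw [tangentTriv_coordField hq2]
    exact congrArg Prod.snd h1

variable (cov₁ : CovariantDerivative 𝓘(ℝ, E₁) E₁ (TangentSpace 𝓘(ℝ, E₁) : M₁ → Type _))
  (cov₂ : CovariantDerivative 𝓘(ℝ, E₂) E₂ (TangentSpace 𝓘(ℝ, E₂) : M₂ → Type _))

/-- Each component of a field constant in a product chart depends on its own factor only, so the
mixed derivatives in `prodCovAux` are derivatives of constants and vanish. -/
lemma prodConnection_coordField (x : M₁ × M₂) (V W : E₁ × E₂) :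
    (prodConnection cov₁ cov₂ (coordField (I := (𝓘(ℝ, E₁).prod 𝓘(ℝ, E₂))) x V) x W : E₁ × E₂) =
      (cov₁ (coordField (I := 𝓘(ℝ, E₁)) x.1 V.1) x.1 W.1,
        cov₂ (coordField (I := 𝓘(ℝ, E₂)) x.2 V.2) x.2 W.2) := by
  have hs : (chartAt (ModelProd E₁ E₂) x).source =
    (chartAt E₁ x.1).source ×ˢ (chartAt E₂ x.2).source := rfl
  have hx1 : (chartAt E₁ x.1).source ∈ 𝓝 x.1 := chart_source_mem_nhds _ _
  have hx2 : (chartAt E₂ x.2).source ∈ 𝓝 x.2 := chart_source_mem_nhds _ _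
  have hm1 := mem_chart_source E₁ x.1
  have hm2 := mem_chart_source E₂ x.2
  have hsmooth1 := (contMDiffAt_coordField (I := 𝓘(ℝ, E₁)) hm1 V.1).mdifferentiableAt (by simp)
  have hsmooth2 := (contMDiffAt_coordField (I := 𝓘(ℝ, E₂)) hm2 V.2).mdifferentiableAt (by simp)
  have a1 : (fun y => fstComp (coordField (I := (𝓘(ℝ, E₁).prod 𝓘(ℝ, E₂))) x V) (y, x.2)) =ᶠ[𝓝 x.1]
      coordField (I := 𝓘(ℝ, E₁)) x.1 V.1 := by
    filter_upwards [hx1] with y hy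
    exact congrArg Prod.fst (coordField_prod (x := x) (q := (y, x.2)) ⟨hy, hm2⟩ V)
  have a2 : (fun y => sndComp (coordField (I := (𝓘(ℝ, E₁).prod 𝓘(ℝ, E₂))) x V) (x.1, y)) =ᶠ[𝓝 x.2]
      coordField (I := 𝓘(ℝ, E₂)) x.2 V.2 := by
    filter_upwards [hx2] with y hy
    exact congrArg Prod.snd (coordField_prod (x := x) (q := (x.1, y)) ⟨hm1, hy⟩ V)
  have b1 : cov₁ (fun y => fstComp (coordField (I := (𝓘(ℝ, E₁).prod 𝓘(ℝ, E₂))) x V) (y, x.2)) x.1 =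
      cov₁ (coordField (I := 𝓘(ℝ, E₁)) x.1 V.1) x.1 :=
    (cov₁.isCovariantDerivativeOnUniv.congr_of_eventuallyEq hsmooth1
      (hsmooth1.congr_of_eventuallyEq (a1.mono fun y hy => by
        exact congrArg (TotalSpace.mk' E₁ y) hy)) univ_mem a1.symm).symm
  have b2 : cov₂ (fun y => sndComp (coordField (I := (𝓘(ℝ, E₁).prod 𝓘(ℝ, E₂))) x V) (x.1, y)) x.2 =
      cov₂ (coordField (I := 𝓘(ℝ, E₂)) x.2 V.2) x.2 :=
    (cov₂.isCovariantDerivativeOnUniv.congr_of_eventuallyEq hsmooth2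
      (hsmooth2.congr_of_eventuallyEq (a2.mono fun y hy => by
        exact congrArg (TotalSpace.mk' E₂ y) hy)) univ_mem a2.symm).symm
  have c1 : mvfderiv 𝓘(ℝ, E₂) (fun y : M₂ => (fstComp (coordField (I := (𝓘(ℝ, E₁).prod 𝓘(ℝ, E₂))) x V) (x.1, y) : E₁)) x.2 = 0 := by
    let cst : E₁ := coordField (I := 𝓘(ℝ, E₁)) x.1 V.1 x.1
    have : (fun y : M₂ => (fstComp (coordField (I := (𝓘(ℝ, E₁).prod 𝓘(ℝ, E₂))) x V) (x.1, y) : E₁)) =ᶠ[𝓝 x.2]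
        fun _ => cst := by
      filter_upwards [hx2] with y hy
      exact congrArg Prod.fst (coordField_prod (x := x) (q := (x.1, y)) ⟨hm1, hy⟩ V)
    refine Eq.trans ?_ (mvfderiv_const (I := 𝓘(ℝ, E₂)) (F := E₁) cst (x := x.2))
    have h1 := this.mfderiv_eq (I := 𝓘(ℝ, E₂)) (I' := 𝓘(ℝ, E₁))
    ext u
    exact congrArg (fun L : E₂ →L[ℝ] E₁ => L u) h1
  have c2 : mvfderiv 𝓘(ℝ, E₁) (fun y : M₁ => (sndComp (coordField (I := (𝓘(ℝ, E₁).prod 𝓘(ℝ, E₂))) x V) (y, x.2) : E₂)) x.1 = 0 := by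
    let cst : E₂ := coordField (I := 𝓘(ℝ, E₂)) x.2 V.2 x.2
    have : (fun y : M₁ => (sndComp (coordField (I := (𝓘(ℝ, E₁).prod 𝓘(ℝ, E₂))) x V) (y, x.2) : E₂)) =ᶠ[𝓝 x.1]
        fun _ => cst := by
      filter_upwards [hx1] with y hy
      exact congrArg Prod.snd (coordField_prod (x := x) (q := (y, x.2)) ⟨hy, hm2⟩ V)
    refine Eq.trans ?_ (mvfderiv_const (I := 𝓘(ℝ, E₁)) (F := E₂) cst (x := x.1))
    have h1 := this.mfderiv_eq (I := 𝓘(ℝ, E₁)) (I' := 𝓘(ℝ, E₂))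
    ext u
    exact congrArg (fun L : E₁ →L[ℝ] E₂ => L u) h1
  refine Prod.ext ?_ ?_
  · refine (fstComp_prodCovAux cov₁ cov₂ (coordField (I := (𝓘(ℝ, E₁).prod 𝓘(ℝ, E₂))) x V) x W.1 W.2).trans ?_
    rw [b1]
    let cst : E₁ := cov₁ (coordField (I := 𝓘(ℝ, E₁)) x.1 V.1) x.1 W.1
    refine (congrArg (fun z : E₁ => cst + z)
      (congrArg (fun L : E₂ →L[ℝ] E₁ => L W.2) c1)).trans ?_
    exact add_zero (_ : E₁)
  · refine (sndComp_prodCovAux cov₁ cov₂ (coordField (I := (𝓘(ℝ, E₁).prod 𝓘(ℝ, E₂))) x V) x W.1 W.2).trans ?_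
    rw [b2]
    let cst : E₂ := cov₂ (coordField (I := 𝓘(ℝ, E₂)) x.2 V.2) x.2 W.2
    refine (congrArg (fun z : E₂ => z + cst)
      (congrArg (fun L : E₁ →L[ℝ] E₂ => L W.1) c2)).trans ?_
    exact zero_add (_ : E₂)

lemma covAccel_prod {γ : ℝ → M₁ × M₂} {t : ℝ} (hγ : ContMDiffAt 𝓘(ℝ, ℝ) (𝓘(ℝ, E₁).prod 𝓘(ℝ, E₂)) 2 γ t) :
    (covAccel (prodConnection cov₁ cov₂) γ t : E₁ × E₂) =
      (covAccel cov₁ (fun s => (γ s).1) t, covAccel cov₂ (fun s => (γ s).2) t) := by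
  have h1 := coordAccel_prod hγ
  have h2 := velocity_prod (hγ.mdifferentiableAt (by simp))
  have h3 := prodConnection_coordField cov₁ cov₂ (γ t) (velocity (𝓘(ℝ, E₁).prod 𝓘(ℝ, E₂)) γ t) (velocity (𝓘(ℝ, E₁).prod 𝓘(ℝ, E₂)) γ t)
  refine (congrArg₂ (fun a b : E₁ × E₂ => a + b) h1 h3).trans ?_
  rw [h2]
  rfl

lemma isGeodesicOn_prodConnection_iff {γ : ℝ → M₁ × M₂} {J : Set ℝ} :
    IsGeodesicOn (prodConnection cov₁ cov₂) γ J ↔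
      IsGeodesicOn cov₁ (fun s => (γ s).1) J ∧ IsGeodesicOn cov₂ (fun s => (γ s).2) J := by
  constructor
  · intro h
    have hc : ∀ t ∈ J, ContMDiffAt 𝓘(ℝ, ℝ) (𝓘(ℝ, E₁).prod 𝓘(ℝ, E₂)) 2 γ t := fun t ht =>
      h.contMDiffOn.contMDiffAt (h.isOpen.mem_nhds ht)
    have h0 : ∀ t ∈ J, ((0 : E₁), (0 : E₂)) =
        (covAccel cov₁ (fun s => (γ s).1) t, covAccel cov₂ (fun s => (γ s).2) t) := fun t ht =>
      (h.covAccel_eq_zero t ht).symm.trans (covAccel_prod cov₁ cov₂ (hc t ht))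
    exact ⟨⟨h.isOpen, h.ordConnected, contMDiff_fst.comp_contMDiffOn h.contMDiffOn,
        fun t ht => (congrArg Prod.fst (h0 t ht)).symm⟩,
      ⟨h.isOpen, h.ordConnected, contMDiff_snd.comp_contMDiffOn h.contMDiffOn,
        fun t ht => (congrArg Prod.snd (h0 t ht)).symm⟩⟩
  · rintro ⟨h1, h2⟩
    have hc : ContMDiffOn 𝓘(ℝ, ℝ) (𝓘(ℝ, E₁).prod 𝓘(ℝ, E₂)) 2 γ J := h1.contMDiffOn.prodMk h2.contMDiffOn
    refine ⟨h1.isOpen, h1.ordConnected, hc, fun t ht => ?_⟩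
    have h3 := covAccel_prod cov₁ cov₂ (hc.contMDiffAt (h1.isOpen.mem_nhds ht))
    rw [h1.covAccel_eq_zero t ht, h2.covAccel_eq_zero t ht] at h3
    exact h3

lemma equivTangentBundleProd_curveLift {γ : ℝ → M₁ × M₂} {t : ℝ}
    (hγ : MDifferentiableAt 𝓘(ℝ, ℝ) (𝓘(ℝ, E₁).prod 𝓘(ℝ, E₂)) γ t) :
    equivTangentBundleProd 𝓘(ℝ, E₁) M₁ 𝓘(ℝ, E₂) M₂ (curveLift (𝓘(ℝ, E₁).prod 𝓘(ℝ, E₂)) γ t) =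
      (curveLift 𝓘(ℝ, E₁) (fun s => (γ s).1) t, curveLift 𝓘(ℝ, E₂) (fun s => (γ s).2) t) := by
  have h := velocity_prod hγ
  refine Prod.ext ?_ ?_
  · exact congrArg (fun v : E₁ × E₂ => (⟨(γ t).1, v.1⟩ : TangentBundle 𝓘(ℝ, E₁) M₁)) h
  · exact congrArg (fun v : E₁ × E₂ => (⟨(γ t).2, v.2⟩ : TangentBundle 𝓘(ℝ, E₂) M₂)) h


variable {cov₁ cov₂}

lemma IsGeodesicOn.mdifferentiableAt {E : Type*} [NormedAddCommGroup E] [NormedSpace ℝ E]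
    {H : Type*} [TopologicalSpace H] {I : ModelWithCorners ℝ E H}
    {M : Type*} [TopologicalSpace M] [ChartedSpace H M] [IsManifold I ∞ M]
    {cov : CovariantDerivative I E (TangentSpace I : M → Type _)} {γ : ℝ → M} {J : Set ℝ}
    (h : IsGeodesicOn cov γ J) {t : ℝ} (ht : t ∈ J) : MDifferentiableAt 𝓘(ℝ, ℝ) I γ t :=
  (h.contMDiffOn.contMDiffAt (h.isOpen.mem_nhds ht)).mdifferentiableAt (by simp)

/-- The product of two connections with a smooth local geodesic flow has one. -/
lemma HasFlow.prodConnection (h₁ : HasFlow cov₁) (h₂ : HasFlow cov₂) :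
    HasFlow (prodConnection cov₁ cov₂) := by
  set e := equivTangentBundleProd 𝓘(ℝ, E₁) M₁ 𝓘(ℝ, E₂) M₂ with he
  have hes : ContMDiff (𝓘(ℝ, E₁).prod 𝓘(ℝ, E₂)).tangent (𝓘(ℝ, E₁).tangent.prod 𝓘(ℝ, E₂).tangent) ∞ e :=
    contMDiff_equivTangentBundleProd
  have hes' : ContMDiff (𝓘(ℝ, E₁).tangent.prod 𝓘(ℝ, E₂).tangent) (𝓘(ℝ, E₁).prod 𝓘(ℝ, E₂)).tangent ∞ e.symm :=
    contMDiff_equivTangentBundleProd_symm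
  refine ⟨fun {γ γ' J} h h' t₀ ht₀ heq t ht => ?_, fun v₀ => ?_⟩
  · rw [isGeodesicOn_prodConnection_iff] at h h'
    have hd := fun s (hs : s ∈ J) => (h.1.mdifferentiableAt hs).prodMk (h.2.mdifferentiableAt hs)
    have hd' := fun s (hs : s ∈ J) =>
      (h'.1.mdifferentiableAt hs).prodMk (h'.2.mdifferentiableAt hs)
    have h0 := congrArg e heq
    rw [equivTangentBundleProd_curveLift (hd t₀ ht₀),
      equivTangentBundleProd_curveLift (hd' t₀ ht₀)] at h0
    apply e.injective
    rw [equivTangentBundleProd_curveLift (hd t ht), equivTangentBundleProd_curveLift (hd' t ht)]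
    exact Prod.ext (h₁.unique h.1 h'.1 ht₀ (congrArg Prod.fst h0) t ht)
      (h₂.unique h.2 h'.2 ht₀ (congrArg Prod.snd h0) t ht)
  · obtain ⟨ε₁, hε₁, U₁, hU₁, hv₁, Ψ₁, hΨ₁, hf₁⟩ := h₁.flow (e v₀).1
    obtain ⟨ε₂, hε₂, U₂, hU₂, hv₂, Ψ₂, hΨ₂, hf₂⟩ := h₂.flow (e v₀).2
    set ε := min ε₁ ε₂
    have hs1 : Ioo (-ε) ε ⊆ Ioo (-ε₁) ε₁ :=
      Ioo_subset_Ioo (neg_le_neg (min_le_left _ _)) (min_le_left _ _)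
    have hs2 : Ioo (-ε) ε ⊆ Ioo (-ε₂) ε₂ :=
      Ioo_subset_Ioo (neg_le_neg (min_le_right _ _)) (min_le_right _ _)
    refine ⟨ε, lt_min hε₁ hε₂, e ⁻¹' (U₁ ×ˢ U₂), (hU₁.prod hU₂).preimage hes.continuous,
      ⟨hv₁, hv₂⟩, fun s v => e.symm (Ψ₁ s (e v).1, Ψ₂ s (e v).2), ?_, ?_⟩
    · refine hes'.comp_contMDiffOn (ContMDiffOn.prodMk ?_ ?_)
      · exact hΨ₁.comp (f := fun p : ℝ × TangentBundle (𝓘(ℝ, E₁).prod 𝓘(ℝ, E₂)) (M₁ × M₂) => (p.1, (e p.2).1))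
          (contMDiffOn_fst.prodMk ((contMDiff_fst.comp hes).comp_contMDiffOn contMDiffOn_snd))
          fun p hp => ⟨hs1 hp.1, hp.2.1⟩
      · exact hΨ₂.comp (f := fun p : ℝ × TangentBundle (𝓘(ℝ, E₁).prod 𝓘(ℝ, E₂)) (M₁ × M₂) => (p.1, (e p.2).2))
          (contMDiffOn_fst.prodMk ((contMDiff_snd.comp hes).comp_contMDiffOn contMDiffOn_snd))
          fun p hp => ⟨hs2 hp.1, hp.2.2⟩
    · intro v hv
      obtain ⟨a1, b1, c1⟩ := hf₁ _ hv.1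
      obtain ⟨a2, b2, c2⟩ := hf₂ _ hv.2
      have hg : IsGeodesicOn (_root_.prodConnection cov₁ cov₂)
          (fun s => (e.symm (Ψ₁ s (e v).1, Ψ₂ s (e v).2)).1) (Ioo (-ε) ε) := by
        rw [isGeodesicOn_prodConnection_iff]
        exact ⟨⟨isOpen_Ioo, ordConnected_Ioo, b1.contMDiffOn.mono hs1,
            fun t ht => b1.covAccel_eq_zero t (hs1 ht)⟩,
          ⟨isOpen_Ioo, ordConnected_Ioo, b2.contMDiffOn.mono hs2,
            fun t ht => b2.covAccel_eq_zero t (hs2 ht)⟩⟩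
      refine ⟨?_, hg, fun s hs => ?_⟩
      · have h5 := congrArg₂ (fun a b => e.symm (a, b)) a1 a2
        exact h5.trans (e.symm_apply_apply v)
      · apply e.injective
        rw [e.apply_symm_apply, equivTangentBundleProd_curveLift (hg.mdifferentiableAt hs)]
        exact Prod.ext (c1 s (hs1 hs)) (c2 s (hs2 hs))

end ProductGeodesics

/-! ### Affine reparametrization and gluing of geodesics -/

section Reparametrization

variable {E : Type*} [NormedAddCommGroup E] [NormedSpace ℝ E]
  {H : Type*} [TopologicalSpace H] {I : ModelWithCorners ℝ E H}
  {M : Type*} [TopologicalSpace M] [ChartedSpace H M]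

set_option linter.unusedSectionVars false

/-- Scalar multiplication of tangent vectors. -/
noncomputable def fiberSMul (c : ℝ) (v : TangentBundle I M) : TangentBundle I M := ⟨v.1, c • v.2⟩

@[simp] lemma fiberSMul_fst (c : ℝ) (v : TangentBundle I M) : (fiberSMul c v).1 = v.1 := rfl

@[simp] lemma fiberSMul_snd (c : ℝ) (v : TangentBundle I M) : (fiberSMul c v).2 = c • v.2 := rfl

@[simp] lemma one_fiberSMul (v : TangentBundle I M) : fiberSMul 1 v = v :=
  congrArg (TotalSpace.mk' E v.1) (one_smul ℝ v.2)

lemma fiberSMul_fiberSMul (c d : ℝ) (v : TangentBundle I M) :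
    fiberSMul c (fiberSMul d v) = fiberSMul (c * d) v :=
  congrArg (TotalSpace.mk' E v.1) (smul_smul c d v.2)

lemma velocity_comp_affine {γ : ℝ → M} {a b t : ℝ}
    (hγ : MDifferentiableAt 𝓘(ℝ, ℝ) I γ (a * t + b)) :
    velocity I (fun s => γ (a * s + b)) t = a • velocity I γ (a * t + b) := by
  have h1 : HasDerivAt (fun s : ℝ => a * s + b) a t := by
    simpa using ((hasDerivAt_id t).const_mul a).add_const b
  have h2 : HasMFDerivAt 𝓘(ℝ, ℝ) 𝓘(ℝ, ℝ) (fun s : ℝ => a * s + b) t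
      (ContinuousLinearMap.toSpanSingleton ℝ a) := h1.hasFDerivAt.hasMFDerivAt
  have h3 := (HasMFDerivAt.comp t hγ.hasMFDerivAt h2).mfderiv
  have h4 : velocity I (fun s => γ (a * s + b)) t =
      mfderiv 𝓘(ℝ, ℝ) I γ (a * t + b) ((1 : ℝ) • a : ℝ) := congrArg (fun L => L (1 : ℝ)) h3
  have h5 : (mfderiv 𝓘(ℝ, ℝ) I γ (a * t + b) : ℝ →L[ℝ] E) (a • (1 : ℝ)) =
      a • (mfderiv 𝓘(ℝ, ℝ) I γ (a * t + b) : ℝ →L[ℝ] E) 1 := map_smul _ a (1 : ℝ)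
  have h6 : (1 : ℝ) • a = a • (1 : ℝ) := by simp
  rw [h4]
  exact (congrArg (fun r : ℝ => (mfderiv 𝓘(ℝ, ℝ) I γ (a * t + b) : ℝ →L[ℝ] E) r) h6).trans h5

lemma curveLift_comp_affine {γ : ℝ → M} {a b t : ℝ}
    (hγ : MDifferentiableAt 𝓘(ℝ, ℝ) I γ (a * t + b)) :
    curveLift I (fun s => γ (a * s + b)) t = fiberSMul a (curveLift I γ (a * t + b)) :=
  congrArg (TotalSpace.mk' E (γ (a * t + b))) (velocity_comp_affine hγ)

lemma coordAccel_comp_affine (γ : ℝ → M) (a b t : ℝ) :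
    coordAccel I (fun s => γ (a * s + b)) t = (a * a) • coordAccel I γ (a * t + b) := by
  set f : ℝ → E := fun s => extChartAt I (γ (a * t + b)) (γ s) with hf
  have h : ∀ g : ℝ → E, deriv (fun s => g (a * s + b)) = fun s => a • deriv g (a * s + b) := by
    intro g
    funext s
    have h1 := deriv_comp_mul_left a (fun s => g (s + b)) s
    rw [h1, deriv_comp_add_const]
  have h2 : iteratedDeriv 2 (fun s => f (a * s + b)) t = (a * a) • iteratedDeriv 2 f (a * t + b) := by
    simp only [iteratedDeriv_succ, iteratedDeriv_zero]
    rw [h f, deriv_fun_const_smul_field, h (deriv f), smul_smul]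
  exact h2

variable [IsManifold I ∞ M] (cov : CovariantDerivative I E (TangentSpace I : M → Type _))

lemma coordField_smul {x y : M} (hy : y ∈ (chartAt H x).source) (a : ℝ) (v : TangentSpace I x) :
    coordField x (a • v) y = a • coordField x v y := by
  have h1 : (tangentTriv I x).symmₗ ℝ y (a • (v : E)) =
    a • (tangentTriv I x).symmₗ ℝ y (v : E) := map_smul _ a (v : E)
  rw [Trivialization.coe_symmₗ (R := ℝ) (tangentTriv I x) hy] at h1
  exact h1

/-- One factor `a` comes from the field, which near `x` is `a` times the other one, and one from the
direction. -/
lemma cov_coordField_smul (x : M) (a : ℝ) (v : TangentSpace I x) :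
    cov (coordField x (a • v)) x (a • v) = (a * a) • cov (coordField x v) x v := by
  have hd : ∀ w : TangentSpace I x, MDifferentiableAt I I.tangent
      (fun z => (⟨z, coordField x w z⟩ : TangentBundle I M)) x := fun w =>
    (contMDiffAt_coordField (I := I) (mem_chart_source H x) w).mdifferentiableAt (by simp)
  have h1 : coordField x (a • v) =ᶠ[𝓝 x] a • coordField x v :=
    eventually_of_mem (chart_source_mem_nhds H x) fun y hy => coordField_smul hy a v
  have h2 := cov.isCovariantDerivativeOnUniv.congr_of_eventuallyEq (hd (a • v))
    ((hd (a • v)).congr_of_eventuallyEq (h1.symm.mono fun y hy =>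
      congrArg (TotalSpace.mk' E y) hy)) univ_mem h1
  rw [h2, cov.isCovariantDerivativeOnUniv.smul_const a (hd v) trivial,
    map_smul, smul_apply, smul_smul]

variable {cov}

/-- Both terms of the covariant acceleration are multiplied by `a²`. The value `a = 0` is included:
it gives the constant geodesics needed at zero vectors. -/
lemma IsGeodesicOn.comp_affine {γ : ℝ → M} {J : Set ℝ} (h : IsGeodesicOn cov γ J) (a b : ℝ) :
    IsGeodesicOn cov (fun s => γ (a * s + b)) ((fun s => a * s + b) ⁻¹' J) := by
  have hc : Continuous fun s : ℝ => a * s + b := by fun_prop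
  have hoc : ((fun s => a * s + b) ⁻¹' J).OrdConnected := by
    rcases le_total 0 a with ha | ha
    · exact h.ordConnected.preimage_mono fun s t hst => by
        have := mul_le_mul_of_nonneg_left hst ha
        simpa using this
    · exact h.ordConnected.preimage_anti fun s t hst => by
        have := mul_le_mul_of_nonpos_left hst ha
        simpa using this
  refine ⟨h.isOpen.preimage hc, hoc, ?_, fun t ht => ?_⟩
  · refine h.contMDiffOn.comp (ContDiff.contMDiff ?_).contMDiffOn fun s hs => hs
    fun_prop
  · have ht' : a * t + b ∈ J := ht
    have h1 := velocity_comp_affine (h.mdifferentiableAt ht')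
    have h2 := h.covAccel_eq_zero _ ht'
    have h3 : covAccel cov (fun s => γ (a * s + b)) t = (a * a) • covAccel cov γ (a * t + b) := by
      rw [covAccel, covAccel, coordAccel_comp_affine, h1, smul_add]
      congr 1
      exact cov_coordField_smul cov _ a _
    rw [h3, h2]
    exact smul_zero (a * a)

/-- The base points `γ t` and `γ' t` are equal only through a proof. The auxiliary `acc` takes its
values in the fixed space `E`, where base point and velocity can be replaced by equal ones. -/
lemma covAccel_congr {γ γ' : ℝ → M} {t : ℝ} (h : γ =ᶠ[𝓝 t] γ') (h0 : covAccel cov γ t = 0) :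
    covAccel cov γ' t = 0 := by
  have hx := h.self_of_nhds
  have h1 : (mfderiv 𝓘(ℝ, ℝ) I γ t : ℝ →L[ℝ] E) = mfderiv 𝓘(ℝ, ℝ) I γ' t := h.mfderiv_eq
  let acc : M → E → (ℝ → M) → E := fun x V f =>
    let c : E := cov (coordField x V) x V
    iteratedDeriv 2 (fun s => extChartAt I x (f s)) t + c
  have key : ∀ (x x' : M) (_ : x = x') (V V' : E) (_ : V = V') (f f' : ℝ → M), f =ᶠ[𝓝 t] f' →
      acc x V f = acc x' V' f' := by
    rintro x x' rfl V V' rfl f f' hf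
    have h2 : (fun s => extChartAt I x (f s)) =ᶠ[𝓝 t] fun s => extChartAt I x (f' s) :=
      hf.mono fun s hs => congrArg (extChartAt I x) hs
    simp only [acc]
    rw [(h2.iteratedDeriv 2).self_of_nhds]
  exact (key _ _ hx _ _ (congrArg (fun L : ℝ →L[ℝ] E => L 1) h1) γ γ' h).symm.trans h0

lemma curveLift_congr {γ γ' : ℝ → M} {t : ℝ} (h : γ =ᶠ[𝓝 t] γ') :
    curveLift I γ t = curveLift I γ' t := by
  have hx := h.self_of_nhds
  have h1 : (mfderiv 𝓘(ℝ, ℝ) I γ t : ℝ →L[ℝ] E) = mfderiv 𝓘(ℝ, ℝ) I γ' t := h.mfderiv_eq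
  have key : ∀ (x x' : M) (_ : x = x') (V V' : E) (_ : V = V'),
      TotalSpace.mk' E (E := (TangentSpace I : M → Type _)) x V = TotalSpace.mk' E x' V' := by
    rintro x x' rfl V V' rfl; rfl
  exact key _ _ hx _ _ (congrArg (fun L : ℝ →L[ℝ] E => L 1) h1)

lemma IsGeodesicOn.mono {γ : ℝ → M} {J K : Set ℝ} (h : IsGeodesicOn cov γ J) (hK : IsOpen K)
    (hK' : K.OrdConnected) (hKJ : K ⊆ J) : IsGeodesicOn cov γ K :=
  ⟨hK, hK', h.contMDiffOn.mono hKJ, fun t ht => h.covAccel_eq_zero t (hKJ ht)⟩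

lemma IsGeodesicOn.congr {γ γ' : ℝ → M} {J : Set ℝ} (h : IsGeodesicOn cov γ J)
    (hγ : EqOn γ γ' J) : IsGeodesicOn cov γ' J :=
  ⟨h.isOpen, h.ordConnected, h.contMDiffOn.congr fun _ ht => (hγ ht).symm, fun t ht =>
    covAccel_congr (hγ.eventuallyEq_of_mem (h.isOpen.mem_nhds ht)) (h.covAccel_eq_zero t ht)⟩

/-- Geodesics which share a velocity vector can be glued. -/
lemma HasFlow.exists_glue (hF : HasFlow cov) {γ β : ℝ → M} {J K : Set ℝ}
    (h : IsGeodesicOn cov γ J) (h' : IsGeodesicOn cov β K) {s : ℝ} (hsJ : s ∈ J) (hsK : s ∈ K)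
    (heq : curveLift I γ s = curveLift I β s) :
    ∃ δ : ℝ → M, IsGeodesicOn cov δ (J ∪ K) ∧ (∀ t ∈ J, curveLift I δ t = curveLift I γ t) ∧
      ∀ t ∈ K, curveLift I δ t = curveLift I β t := by
  classical
  have hJK : (J ∩ K).OrdConnected := h.ordConnected.inter h'.ordConnected
  have hu := hF.unique (h.mono (h.isOpen.inter h'.isOpen) hJK inter_subset_left)
    (h'.mono (h.isOpen.inter h'.isOpen) hJK inter_subset_right) ⟨hsJ, hsK⟩ heq
  set δ : ℝ → M := fun t => if t ∈ J then γ t else β t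
  have hδJ : EqOn γ δ J := fun t ht => by simp [δ, ht]
  have hδK : EqOn β δ K := fun t ht => by
    by_cases htJ : t ∈ J
    · simp only [δ, htJ, if_true]
      exact (congrArg TotalSpace.proj (hu t ⟨htJ, ht⟩)).symm
    · simp [δ, htJ]
  have h1 := h.congr hδJ
  have h2 := h'.congr hδK
  refine ⟨δ, ⟨h.isOpen.union h'.isOpen, ?_, ?_, ?_⟩, fun t ht => ?_, fun t ht => ?_⟩
  · exact (h.ordConnected.isPreconnected.union s hsJ hsK
      h'.ordConnected.isPreconnected).ordConnected
  · rintro t (ht | ht)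
    · exact (h1.contMDiffOn.contMDiffAt (h.isOpen.mem_nhds ht)).contMDiffWithinAt
    · exact (h2.contMDiffOn.contMDiffAt (h'.isOpen.mem_nhds ht)).contMDiffWithinAt
  · rintro t (ht | ht)
    · exact h1.covAccel_eq_zero t ht
    · exact h2.covAccel_eq_zero t ht
  · exact (curveLift_congr (hδJ.eventuallyEq_of_mem (h.isOpen.mem_nhds ht))).symm
  · exact (curveLift_congr (hδK.eventuallyEq_of_mem (h'.isOpen.mem_nhds ht))).symm

end Reparametrization

/-! ### The equivalence relation of lying on a common geodesic -/

section GeodesicRelation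

set_option linter.unusedSectionVars false

variable {E : Type*} [NormedAddCommGroup E] [NormedSpace ℝ E]
  {H : Type*} [TopologicalSpace H] {I : ModelWithCorners ℝ E H}
  {M : Type*} [TopologicalSpace M] [ChartedSpace H M] [IsManifold I ∞ M]
  {cov : CovariantDerivative I E (TangentSpace I : M → Type _)}

lemma contMDiff_fiberSMul : ContMDiff (𝓘(ℝ, ℝ).prod I.tangent) I.tangent ∞
    (fun p : ℝ × TangentBundle I M => fiberSMul p.1 p.2) := by
  rintro ⟨c, v⟩
  have h2 : ContMDiffAt (𝓘(ℝ, ℝ).prod I.tangent) I.tangent ∞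
    (fun p : ℝ × TangentBundle I M => p.2) (c, v) := contMDiffAt_snd
  have h1 : ContMDiffAt (𝓘(ℝ, ℝ).prod I.tangent) 𝓘(ℝ, ℝ) ∞
    (fun p : ℝ × TangentBundle I M => p.1) (c, v) := contMDiffAt_fst
  obtain ⟨h3, h4⟩ := contMDiffAt_totalSpace.1 h2
  refine contMDiffAt_totalSpace.2 ⟨h3, ?_⟩
  refine (h1.smul h4).congr_of_eventuallyEq ?_
  have hb : ∀ᶠ p : ℝ × TangentBundle I M in 𝓝 (c, v), p.2.1 ∈ (tangentTriv I v.1).baseSet :=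
    h3.continuousAt.eventually_mem ((tangentTriv I v.1).open_baseSet.mem_nhds
      (mem_chart_source H v.1))
  filter_upwards [hb] with p hp
  exact ((tangentTriv I v.1).linear ℝ hp).map_smul p.1 p.2.2

lemma contMDiff_fiberSMul_const (c : ℝ) :
    ContMDiff I.tangent I.tangent ∞ (fun v : TangentBundle I M => fiberSMul c v) :=
  contMDiff_fiberSMul.comp (contMDiff_const.prodMk contMDiff_id)

variable (cov) in
/-- Two tangent vectors are proportional to velocity vectors of a common geodesic. -/
def GeodRel (v w : TangentBundle I M) : Prop :=
  ∃ (γ : ℝ → M) (J : Set ℝ), IsGeodesicOn cov γ J ∧ ∃ s ∈ J, ∃ t ∈ J, curveLift I γ s = v ∧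
    ∃ c : ℝ, c ≠ 0 ∧ w = fiberSMul c (curveLift I γ t)

lemma IsGeodesicOn.curveLift_comp_affine {γ : ℝ → M} {J : Set ℝ} (h : IsGeodesicOn cov γ J)
    {a b t : ℝ} (ht : a * t + b ∈ J) :
    curveLift I (fun s => γ (a * s + b)) t = fiberSMul a (curveLift I γ (a * t + b)) :=
  _root_.curveLift_comp_affine (h.mdifferentiableAt ht)

/-- Geodesically related vectors, in a normalized form. -/
lemma GeodRel.exists_zero_mem {v w : TangentBundle I M} (h : GeodRel cov v w) :
    ∃ (γ : ℝ → M) (J : Set ℝ), IsGeodesicOn cov γ J ∧ 0 ∈ J ∧ curveLift I γ 0 = v ∧ ∃ t ∈ J,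
      ∃ c : ℝ, c ≠ 0 ∧ w = fiberSMul c (curveLift I γ t) := by
  obtain ⟨γ, J, hγ, s, hs, t, ht, rfl, c, hc, rfl⟩ := h
  refine ⟨fun r => γ (1 * r + s), _, hγ.comp_affine 1 s, by simpa using hs, ?_, t - s,
    by simpa using ht, c, hc, ?_⟩
  · rw [hγ.curveLift_comp_affine (by simpa using hs)]
    simp
  · rw [hγ.curveLift_comp_affine (by simpa using ht)]
    simp

/-- The curve `r ↦ γ (c r)` has velocity `c γ'(s)` at `r = s / c`, which absorbs the first factor.
The factor left for the second vector is `d / c`. -/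
lemma GeodRel.of_curveLift_smul {γ : ℝ → M} {J : Set ℝ} (hγ : IsGeodesicOn cov γ J) {s t : ℝ}
    (hs : s ∈ J) (ht : t ∈ J) {c d : ℝ} (hc : c ≠ 0) (hd : d ≠ 0) :
    GeodRel cov (fiberSMul c (curveLift I γ s)) (fiberSMul d (curveLift I γ t)) := by
  refine ⟨fun r => γ (c * r + 0), _, hγ.comp_affine c 0, s / c, ?_, t / c, ?_, ?_, d / c,
    div_ne_zero hd hc, ?_⟩
  · simpa [mul_div_cancel₀ _ hc] using hs
  · simpa [mul_div_cancel₀ _ hc] using ht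
  · have h1 : c * (s / c) + 0 = s := by field_simp; ring
    rw [hγ.curveLift_comp_affine (by rwa [h1]), h1]
  · have h1 : c * (t / c) + 0 = t := by field_simp; ring
    rw [hγ.curveLift_comp_affine (by rwa [h1]), h1, fiberSMul_fiberSMul, div_mul_cancel₀ _ hc]

lemma GeodRel.symm {v w : TangentBundle I M} (h : GeodRel cov v w) : GeodRel cov w v := by
  obtain ⟨γ, J, hγ, s, hs, t, ht, rfl, c, hc, rfl⟩ := h
  simpa using GeodRel.of_curveLift_smul hγ ht hs hc one_ne_zero

lemma HasFlow.exists_geodesic (hF : HasFlow cov) (v : TangentBundle I M) :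
    ∃ (γ : ℝ → M) (J : Set ℝ), IsGeodesicOn cov γ J ∧ 0 ∈ J ∧ curveLift I γ 0 = v := by
  obtain ⟨ε, hε, U, -, hv, Ψ, -, h⟩ := hF.flow v
  obtain ⟨h0, h1, h2⟩ := h v hv
  have h3 : (0 : ℝ) ∈ Ioo (-ε) ε := ⟨by linarith, hε⟩
  exact ⟨_, _, h1, h3, (h2 0 h3).trans h0⟩

lemma HasFlow.geodRel_fiberSMul (hF : HasFlow cov) (v : TangentBundle I M) {c : ℝ} (hc : c ≠ 0) :
    GeodRel cov v (fiberSMul c v) := by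
  obtain ⟨γ, J, h1, h2, rfl⟩ := hF.exists_geodesic v
  exact ⟨γ, J, h1, 0, h2, 0, h2, rfl, c, hc, rfl⟩

lemma HasFlow.geodRel_refl (hF : HasFlow cov) (v : TangentBundle I M) : GeodRel cov v v := by
  simpa using hF.geodRel_fiberSMul v one_ne_zero

/-- The first geodesic is run at speed `c` with its origin moved to `t`, so that its velocity at
time zero is `v`. It can then be glued to the second one. -/
lemma HasFlow.geodRel_trans (hF : HasFlow cov) {u v w : TangentBundle I M}
    (h : GeodRel cov u v) (h' : GeodRel cov v w) : GeodRel cov u w := by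
  obtain ⟨γ, J, hγ, s, hs, t, ht, rfl, c, hc, rfl⟩ := h
  obtain ⟨β, K, hβ, hK, h0, t', ht', d, hd, rfl⟩ := h'.exists_zero_mem
  have hm : ∀ r, r ∈ J → c * ((r - t) / c) + t ∈ J := fun r hr => by
    have : c * ((r - t) / c) + t = r := by field_simp; ring
    rwa [this]
  have hγ' := hγ.comp_affine c t
  obtain ⟨δ, hδ, h1, h2⟩ := hF.exists_glue hγ' hβ (s := 0) (by simpa using ht) hK (by
    rw [hγ.curveLift_comp_affine (by simpa using ht), h0]; simp)
  have h3 := h1 ((s - t) / c) (hm s hs)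
  have h4 := h2 t' ht'
  have h5 : c * ((s - t) / c) + t = s := by field_simp; ring
  rw [hγ.curveLift_comp_affine (hm s hs), h5] at h3
  have h6 := GeodRel.of_curveLift_smul hδ (s := (s - t) / c) (t := t') (Or.inl (hm s hs))
    (Or.inr ht') (inv_ne_zero hc) hd
  rwa [h3, h4, fiberSMul_fiberSMul, inv_mul_cancel₀ hc, one_fiberSMul] at h6

/-- Passing to the generated equivalence relation adds nothing: by gluing of geodesics, being on a
common geodesic up to dilation is already transitive. -/
lemma HasFlow.geodesicProj_eq_iff (hF : HasFlow cov) (v w : ReducedTangentBundle I M) :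
    geodesicProj cov v = geodesicProj cov w ↔ GeodRel cov v.1 w.1 := by
  have hline : ∀ (γ : ℝ → M) (t : ℝ) (u : ReducedTangentBundle I M),
      IsTangentLine γ t (Quotient.mk (proportionalSetoid I M) u) →
      ∃ c : ℝ, c ≠ 0 ∧ u.1 = fiberSMul c (curveLift I γ t) := by
    rintro γ t u ⟨hne, hq⟩
    obtain ⟨c, hc, h⟩ := Quotient.exact hq
    exact ⟨c, hc, h⟩
  constructor
  · intro h
    have h1 := Quot.eqvGen_exact h
    have key : ∀ ℓ ℓ' : ProjTangentBundle I M, Relation.EqvGen (OnCommonGeodesic cov) ℓ ℓ' →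
        ∀ v w : ReducedTangentBundle I M, Quotient.mk _ v = ℓ → Quotient.mk _ w = ℓ' →
        GeodRel cov v.1 w.1 := by
      intro ℓ ℓ' hℓ
      induction hℓ with
      | rel ℓ ℓ' h =>
        rintro v w rfl rfl
        obtain ⟨γ, J, hγ, s, hs, t, ht, h1, h2⟩ := h
        obtain ⟨c, hc, h1⟩ := hline γ s v h1
        obtain ⟨d, hd, h2⟩ := hline γ t w h2
        rw [h1, h2]
        exact GeodRel.of_curveLift_smul hγ hs ht hc hd
      | refl ℓ =>
        rintro v w rfl hw
        obtain ⟨c, hc, h⟩ := Quotient.exact hw.symm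
        rw [h]
        exact hF.geodRel_fiberSMul v.1 hc
      | symm ℓ ℓ' _ ih =>
        intro v w hv hw
        exact (ih w v hw hv).symm
      | trans ℓ ℓ' ℓ'' _ _ ih1 ih2 =>
        intro v w hv hw
        obtain ⟨u, hu⟩ := Quotient.exists_rep ℓ'
        exact hF.geodRel_trans (ih1 v u hv hu) (ih2 u w hu hw)
    exact key _ _ h1 v w rfl rfl
  · rintro ⟨γ, J, hγ, s, hs, t, ht, hv, c, hc, hw⟩
    have hs0 : velocity I γ s ≠ 0 := by
      have h1 := v.2
      intro h0
      exact h1 (hv ▸ h0 : v.1.2 = 0)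
    have ht0 : velocity I γ t ≠ 0 := by
      have h1 := w.2
      intro h0
      refine h1 ?_
      rw [hw]
      change c • velocity I γ t = 0
      rw [h0, smul_zero]
    refine Quot.sound ⟨γ, J, hγ, s, hs, t, ht, ⟨hs0, ?_⟩, ⟨ht0, ?_⟩⟩
    · exact congrArg _ (Subtype.ext hv)
    · exact Quotient.sound ⟨c, hc, hw⟩

lemma isQuotientMap_geodesicProj :
    Topology.IsQuotientMap (geodesicProj cov) :=
  (isQuotientMap_quot_mk).comp isQuotientMap_quotient_mk'

/-- The flow follows geodesics. -/
lemma HasFlow.curveLift_eq_flow (hF : HasFlow cov) {ε : ℝ} {v : TangentBundle I M}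
    {Ψ : ℝ → TangentBundle I M → TangentBundle I M}
    (h0 : Ψ 0 v = v) (hg : IsGeodesicOn cov (fun s => (Ψ s v).1) (Ioo (-ε) ε))
    (hl : ∀ s ∈ Ioo (-ε) ε, curveLift I (fun s => (Ψ s v).1) s = Ψ s v)
    {γ : ℝ → M} {J : Set ℝ} (hγ : IsGeodesicOn cov γ J) {s t : ℝ} (hs : s ∈ J) (ht : t ∈ J)
    (hv : curveLift I γ s = v) (hst : t - s ∈ Ioo (-ε) ε) : curveLift I γ t = Ψ (t - s) v := by
  have hε : 0 < ε := by linarith [hst.1, hst.2]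
  have h1 := hg.comp_affine 1 (-s)
  have h3 : ∀ r, r ∈ (fun r => 1 * r + -s) ⁻¹' Ioo (-ε) ε ↔ r - s ∈ Ioo (-ε) ε := fun r => by
    simp [sub_eq_add_neg]
  have ho := hγ.isOpen.inter h1.isOpen
  have hoc := hγ.ordConnected.inter h1.ordConnected
  have hmem : ∀ r, r - s ∈ Ioo (-ε) ε → 1 * r + -s ∈ Ioo (-ε) ε := fun r hr => by
    simpa [sub_eq_add_neg] using hr
  have hs0 : s - s ∈ Ioo (-ε) ε := by simp [hε]
  have hL : ∀ r, r - s ∈ Ioo (-ε) ε →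
      curveLift I (fun r => (fun s => (Ψ s v).1) (1 * r + -s)) r = Ψ (r - s) v := by
    intro r hr
    rw [hg.curveLift_comp_affine (hmem r hr), hl _ (hmem r hr), one_fiberSMul, one_mul,
      sub_eq_add_neg]
  have h4 := hF.unique (hγ.mono ho hoc inter_subset_left) (h1.mono ho hoc inter_subset_right)
    (t₀ := s) ⟨hs, (h3 s).2 hs0⟩ (by rw [hL s hs0, sub_self, h0, hv]) t ⟨ht, (h3 t).2 hst⟩
  rw [h4, hL t hst]


/-- There is a smooth local map taking the first of two geodesically related vectors to the second
one and every vector to a geodesically related one. -/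
lemma HasFlow.exists_transport (hF : HasFlow cov) {v w : TangentBundle I M}
    (h : GeodRel cov v w) : ∃ Θ : TangentBundle I M → TangentBundle I M,
      ContMDiffAt I.tangent I.tangent ∞ Θ v ∧ Θ v = w ∧ ∀ᶠ u in 𝓝 v, GeodRel cov u (Θ u) := by
  set P : TangentBundle I M → TangentBundle I M → Prop := fun v w =>
    ∃ Θ : TangentBundle I M → TangentBundle I M,
      ContMDiffAt I.tangent I.tangent ∞ Θ v ∧ Θ v = w ∧ ∀ᶠ u in 𝓝 v, GeodRel cov u (Θ u) with hP
  have htrans : ∀ u v w, P u v → P v w → P u w := by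
    rintro u v w ⟨Θ, hΘ, rfl, hΘ'⟩ ⟨Ξ, hΞ, rfl, hΞ'⟩
    refine ⟨Ξ ∘ Θ, hΞ.comp u hΘ, rfl, ?_⟩
    filter_upwards [hΘ', hΘ.continuousAt.eventually hΞ'] with z h1 h2
    exact hF.geodRel_trans h1 h2
  obtain ⟨γ, J, hγ, s, hs, t, ht, rfl, c, hc, rfl⟩ := h
  refine htrans _ (curveLift I γ t) _ ?_ ⟨fiberSMul c, (contMDiff_fiberSMul_const c).contMDiffAt,
    rfl, Eventually.of_forall fun u => hF.geodRel_fiberSMul u hc⟩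
  -- Since `P` is transitive, it is enough to connect each time `r` with the times near it. Both
  -- directions are required, because `P` is not symmetric by its form.
  refine hγ.ordConnected.isPreconnected.induction₂' (fun a b => P (curveLift I γ a)
    (curveLift I γ b)) ?_ (fun a b c _ _ _ h1 h2 => htrans _ _ _ h1 h2) hs ht
  intro r hr
  obtain ⟨ε, hε, U, hU, hv, Ψ, hΨ, hfl⟩ := hF.flow (curveLift I γ r)
  have hsub : Tendsto (fun a : ℝ => a - r) (𝓝 r) (𝓝 0) := by
    have : Continuous fun a : ℝ => a - r := by fun_prop
    simpa using this.tendsto r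
  have hnear : ∀ᶠ a in 𝓝 r, a ∈ J ∧ a - r ∈ Ioo (-ε) ε :=
    Filter.Eventually.and (hγ.isOpen.mem_nhds hr) (hsub.eventually (isOpen_Ioo.mem_nhds ⟨by linarith, hε⟩))
  obtain ⟨f0, f1, f2⟩ := hfl _ hv
  have hlift : ∀ᶠ a in 𝓝 r, curveLift I γ a = Ψ (a - r) (curveLift I γ r) := by
    filter_upwards [hnear] with a ha
    exact hF.curveLift_eq_flow f0 f1 f2 hγ hr ha.1 rfl ha.2
  have hmemU : ∀ᶠ a in 𝓝 r, curveLift I γ a ∈ U := by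
    have hc1 : ContinuousAt (fun a : ℝ => Ψ (a - r) (curveLift I γ r)) r := by
      have h1 := hΨ.continuousOn.continuousAt (x := (0, curveLift I γ r))
        ((isOpen_Ioo.prod hU).mem_nhds ⟨⟨by linarith, hε⟩, hv⟩)
      have h2 : ContinuousAt (fun a : ℝ => (a - r, curveLift I γ r)) r := by fun_prop
      have h3 : (fun p : ℝ × TangentBundle I M => Ψ p.1 p.2) ∘
          (fun a : ℝ => (a - r, curveLift I γ r)) =
        fun a : ℝ => Ψ (a - r) (curveLift I γ r) := rfl
      rw [← h3]
      refine ContinuousAt.comp ?_ h2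
      simpa using h1
    have h4 := hc1.eventually_mem (s := U) (by simpa [f0] using hU.mem_nhds hv)
    filter_upwards [hlift, h4] with a h5 h6
    rwa [h5]
  -- The map `Θ` is the flow for the fixed time `b - a`, defined on one neighbourhood `U` that
  -- contains all the vectors concerned.
  have key : ∀ a b, a ∈ J → b ∈ J → curveLift I γ a ∈ U → b - a ∈ Ioo (-ε) ε →
      P (curveLift I γ a) (curveLift I γ b) := by
    intro a b ha hb haU hab
    have hε0 : (0 : ℝ) ∈ Ioo (-ε) ε := ⟨by linarith, hε⟩
    obtain ⟨g0, g1, g2⟩ := hfl _ haU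
    refine ⟨Ψ (b - a), ?_, (hF.curveLift_eq_flow g0 g1 g2 hγ ha hb rfl hab).symm, ?_⟩
    · have h1 := hΨ.contMDiffAt (x := (b - a, curveLift I γ a))
        ((isOpen_Ioo.prod hU).mem_nhds ⟨hab, haU⟩)
      exact h1.comp (f := fun u => ((b - a, u) : ℝ × TangentBundle I M)) (curveLift I γ a)
        (contMDiffAt_const.prodMk contMDiffAt_id)
    · filter_upwards [hU.mem_nhds haU] with u hu
      obtain ⟨k0, k1, k2⟩ := hfl u hu
      refine ⟨_, _, k1, 0, hε0, b - a, hab, (k2 0 hε0).trans k0, 1, one_ne_zero, ?_⟩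
      rw [one_fiberSMul, k2 _ hab]
  refine nhdsWithin_le_nhds ?_
  filter_upwards [hnear, hmemU] with a h1 h2
  refine ⟨key r a hr h1.1 hv h1.2, key a r h1.1 hr h2 ?_⟩
  exact ⟨by linarith [h1.2.2], by linarith [h1.2.1]⟩

/-- The same on the reduced tangent bundle. -/
lemma HasFlow.exists_transport_reduced (hF : HasFlow cov) (y z : ReducedTangentBundle I M)
    (h : geodesicProj cov y = geodesicProj cov z) :
    ∃ Θ : ReducedTangentBundle I M → ReducedTangentBundle I M,
      ContMDiffAt I.tangent I.tangent ∞ Θ y ∧ Θ y = z ∧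
      ∀ᶠ w in 𝓝 y, geodesicProj cov (Θ w) = geodesicProj cov w := by
  classical
  obtain ⟨Θ, hΘ, hyz, hrel⟩ := hF.exists_transport ((hF.geodesicProj_eq_iff y z).1 h)
  have hne : ∀ᶠ u in 𝓝 (y : TangentBundle I M), Θ u ∈ ReducedTangentBundle I M :=
    hΘ.continuousAt.eventually_mem ((ReducedTangentBundle I M).isOpen.mem_nhds
      (by rw [hyz]; exact z.2))
  have hval : Tendsto (Subtype.val : ReducedTangentBundle I M → TangentBundle I M) (𝓝 y) (𝓝 y.1) :=
    continuous_subtype_val.continuousAt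
  -- The default `z` is never taken near `y`, where `Θ` has nonzero values.
  set Ξ : ReducedTangentBundle I M → ReducedTangentBundle I M := fun w =>
    if hw : Θ w.1 ∈ ReducedTangentBundle I M then ⟨Θ w.1, hw⟩ else z with hΞ
  have hΞe : ∀ w : ReducedTangentBundle I M, Θ w.1 ∈ ReducedTangentBundle I M →
      (Ξ w).1 = Θ w.1 := fun w hw => by simp [hΞ, hw]
  refine ⟨Ξ, ?_, ?_, ?_⟩
  · rw [← ContMDiffAt.subtypeVal_comp_iff]
    have h1 : ContMDiffAt I.tangent I.tangent ∞ (fun w : ReducedTangentBundle I M => Θ w.1) y :=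
      contMDiffAt_subtype_iff.2 hΘ
    refine h1.congr_of_eventuallyEq ?_
    filter_upwards [hval.eventually hne] with w hw using hΞe w hw
  · refine Subtype.ext ?_
    rw [hΞe y (by rw [hyz]; exact z.2), hyz]
  · filter_upwards [hval.eventually hne, hval.eventually hrel] with w hw hw'
    rw [hF.geodesicProj_eq_iff, hΞe w hw]
    exact hw'.symm

end GeodesicRelation

/-! ### Linearizing charts for geodesic classes on the full tangent bundle -/

section LinearChartsOfGeodesics

set_option linter.unusedSectionVars false

variable {E : Type*} [NormedAddCommGroup E] [NormedSpace ℝ E]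
  {H : Type*} [TopologicalSpace H] {I : ModelWithCorners ℝ E H}
  {M : Type*} [TopologicalSpace M] [ChartedSpace H M] [IsManifold I ∞ M]
  {cov : CovariantDerivative I E (TangentSpace I : M → Type _)}

variable (cov) in
/-- The set of all tangent vectors geodesically related to a given one. -/
def geodClass (v : TangentBundle I M) : Set (TangentBundle I M) := {w | GeodRel cov v w}

lemma HasFlow.geodClass_eq_iff (hF : HasFlow cov) (v w : TangentBundle I M) :
    geodClass cov v = geodClass cov w ↔ GeodRel cov v w := by
  constructor
  · intro h
    have h1 : w ∈ geodClass cov v := by rw [h]; exact hF.geodRel_refl w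
    exact h1
  · intro h
    ext u
    exact ⟨fun hu => hF.geodRel_trans h.symm hu, fun hu => hF.geodRel_trans h hu⟩

/-- A chart of the reduced tangent bundle which linearizes the projection onto the space of
geodesics gives such a chart of the tangent bundle. -/
lemma HasFlow.exists_linearQuotientChart_geodClass (hF : HasFlow cov) {k : ℕ}
    {x : ReducedTangentBundle I M} (h : ∃ c : LinearQuotientChart I.tangent k (geodesicProj cov),
      x ∈ c.chart.source) :
    ∃ c : LinearQuotientChart I.tangent k (geodClass cov), x.1 ∈ c.chart.source ∧
      ∀ v ∈ c.chart.source, v.2 ≠ 0 := by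
  obtain ⟨c, hx⟩ := h
  set ι := (ReducedTangentBundle I M).openPartialHomeomorphSubtypeCoe ⟨x⟩ with hι
  have hιs : ∀ u : ReducedTangentBundle I M, ι.symm u.1 = u := fun u =>
    ι.left_inv (by simp [hι])
  set φ := ι.symm.trans c.chart with hφ
  have hsrc : ∀ v, v ∈ φ.source ↔ ∃ u : ReducedTangentBundle I M, u.1 = v ∧ u ∈ c.chart.source := by
    intro v
    rw [hφ, OpenPartialHomeomorph.trans_source]
    constructor
    · rintro ⟨h1, h2⟩
      have h3 : v ∈ ReducedTangentBundle I M := by simpa [hι] using h1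
      refine ⟨⟨v, h3⟩, rfl, ?_⟩
      have := hιs ⟨v, h3⟩
      simp only at this
      rw [← this]
      exact h2
    · rintro ⟨u, rfl, hu⟩
      refine ⟨by simp [hι], ?_⟩
      rw [mem_preimage, hιs]
      exact hu
  have hφu : ∀ u : ReducedTangentBundle I M, φ u.1 = c.chart u := fun u => by
    rw [hφ, OpenPartialHomeomorph.trans_apply, hιs]
  have htarget : φ.target = c.chart.target := by simp [hφ, hι]
  refine ⟨⟨φ, c.proj, ?_, ?_, c.surjective, ?_⟩, (hsrc _).2 ⟨x, rfl, hx⟩, ?_⟩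
  · intro v hv
    obtain ⟨u, rfl, hu⟩ := (hsrc v).1 hv
    refine ContMDiffAt.contMDiffWithinAt (contMDiffAt_subtype_iff.1 ?_)
    refine (c.contMDiffOn.contMDiffAt (c.chart.open_source.mem_nhds hu)).congr_of_eventuallyEq ?_
    exact Eventually.of_forall hφu
  · rw [htarget]
    exact contMDiff_subtype_val.comp_contMDiffOn c.contMDiffOn_symm
  · intro v hv w hw
    obtain ⟨v', rfl, hv'⟩ := (hsrc v).1 hv
    obtain ⟨w', rfl, hw'⟩ := (hsrc w).1 hw
    rw [hF.geodClass_eq_iff, ← hF.geodesicProj_eq_iff, hφu, hφu]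
    exact c.eq_iff v' hv' w' hw'
  · intro v hv
    obtain ⟨v, rfl, hv⟩ := (hsrc v).1 hv
    exact v.2

lemma HasFlow.exists_linearQuotientChart_geodesicProj (hF : HasFlow cov) {k : ℕ}
    {x : ReducedTangentBundle I M} (h : ∃ c : LinearQuotientChart I.tangent k (geodClass cov),
      x.1 ∈ c.chart.source) :
    ∃ c : LinearQuotientChart I.tangent k (geodesicProj cov), x ∈ c.chart.source := by
  obtain ⟨c, hx⟩ := h
  set ι := (ReducedTangentBundle I M).openPartialHomeomorphSubtypeCoe ⟨x⟩ with hι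
  have hιv : ∀ u, ι u = u.1 := fun u => rfl
  set φ := ι.trans c.chart with hφ
  have hsrc : ∀ u, u ∈ φ.source ↔ u.1 ∈ c.chart.source := by
    intro u
    rw [hφ, OpenPartialHomeomorph.trans_source]
    simp [hι]
  have hφu : ∀ u, φ u = c.chart u.1 := fun u => rfl
  refine ⟨⟨φ, c.proj, ?_, ?_, c.surjective, ?_⟩, (hsrc _).2 hx⟩
  · exact c.contMDiffOn.comp contMDiff_subtype_val.contMDiffOn fun u hu => (hsrc u).1 hu
  · intro p hp
    have h1 : p ∈ c.chart.target := by
      rw [hφ, OpenPartialHomeomorph.trans_target] at hp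
      exact hp.1
    refine ContMDiffAt.contMDiffWithinAt ((ContMDiffAt.subtypeVal_comp_iff _ _ _).1 ?_)
    refine (c.contMDiffOn_symm.contMDiffAt (c.chart.open_target.mem_nhds h1)).congr_of_eventuallyEq ?_
    filter_upwards [φ.open_target.mem_nhds hp] with q hq
    rw [hφ, OpenPartialHomeomorph.trans_target] at hq
    exact ι.right_inv hq.2
  · intro v hv w hw
    rw [hF.geodesicProj_eq_iff, ← hF.geodClass_eq_iff, hφu, hφu]
    exact c.eq_iff _ ((hsrc v).1 hv) _ ((hsrc w).1 hw)

lemma HasFlow.exists_linearQuotientChart_of_locallyEuclidean [I.Boundaryless] (hF : HasFlow cov)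
    (h : GeodesicSpaceLocallyEuclidean cov) :
    ∃ k : ℕ, ∀ v : TangentBundle I M, v.2 ≠ 0 →
      ∃ c : LinearQuotientChart I.tangent k (geodClass cov), v ∈ c.chart.source ∧
        ∀ w ∈ c.chart.source, w.2 ≠ 0 := by
  obtain ⟨k, hk, -, hs⟩ := h
  exact ⟨k, fun v hv => hF.exists_linearQuotientChart_geodClass (x := ⟨v, hv⟩)
    (Manifold.IsSubmersion.exists_linearQuotientChart I.tangent hs _)⟩

lemma HasFlow.geodesicSpaceLocallyEuclidean [I.Boundaryless] [FiniteDimensional ℝ E]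
    (hF : HasFlow cov) {k : ℕ} (h : ∀ v : TangentBundle I M, v.2 ≠ 0 →
      ∃ c : LinearQuotientChart I.tangent k (geodClass cov), v ∈ c.chart.source) :
    GeodesicSpaceLocallyEuclidean cov := by
  obtain ⟨hc, h1, h2⟩ := exists_isManifold_isSubmersion (I := I.tangent)
    (isQuotientMap_geodesicProj (cov := cov)) (k := k)
    (fun x => hF.exists_linearQuotientChart_geodesicProj (h x.1 x.2))
    (fun y z hyz => hF.exists_transport_reduced y z hyz)
  exact ⟨k, hc, h1, h2⟩

end LinearChartsOfGeodesics

/-! ### Transport of linearizing charts by diffeomorphisms -/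

section Transfer

variable {E : Type*} [NormedAddCommGroup E] [NormedSpace ℝ E]
  {H : Type*} [TopologicalSpace H] {I : ModelWithCorners ℝ E H}
  {N : Type*} [TopologicalSpace N] [ChartedSpace H N] {G : Type*}
  {E' : Type*} [NormedAddCommGroup E'] [NormedSpace ℝ E']
  {H' : Type*} [TopologicalSpace H'] {I' : ModelWithCorners ℝ E' H'}
  {N' : Type*} [TopologicalSpace N'] [ChartedSpace H' N'] {G' : Type*}

/-- Charts which linearize a projection can be transported by a diffeomorphism. -/
lemma exists_linearQuotientChart_of_diffeomorph {k : ℕ} {pr : N → G} {pr' : N' → G'}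
    (Φ : N' ≃ₘ^∞⟮I', I⟯ N) (A : E ≃L[ℝ] E')
    (hpr : ∀ x y, pr' x = pr' y ↔ pr (Φ x) = pr (Φ y)) {x : N'}
    (h : ∃ c : LinearQuotientChart I k pr, Φ x ∈ c.chart.source) :
    ∃ c : LinearQuotientChart I' k pr', x ∈ c.chart.source := by
  obtain ⟨c, hx⟩ := h
  set φ : OpenPartialHomeomorph N' E' :=
    (Φ.toHomeomorph.toOpenPartialHomeomorph.trans c.chart).trans
      A.toHomeomorph.toOpenPartialHomeomorph with hφ
  have hsrc : ∀ y, y ∈ φ.source ↔ Φ y ∈ c.chart.source := fun y => by simp [hφ]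
  have htgt : ∀ p, p ∈ φ.target ↔ A.symm p ∈ c.chart.target := fun p => by simp [hφ]
  have happ : ∀ y, φ y = A (c.chart (Φ y)) := fun y => rfl
  have hsymm : ∀ p, φ.symm p = Φ.symm (c.chart.symm (A.symm p)) := fun p => rfl
  refine ⟨⟨φ, c.proj.comp (A.symm : E' →L[ℝ] E), ?_, ?_, ?_, ?_⟩, (hsrc x).2 hx⟩
  · exact A.contDiff.contMDiff.comp_contMDiffOn
      (c.contMDiffOn.comp Φ.contMDiff.contMDiffOn fun y hy => (hsrc y).1 hy)
  · exact Φ.symm.contMDiff.comp_contMDiffOn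
      (c.contMDiffOn_symm.comp A.symm.contDiff.contMDiff.contMDiffOn fun p hp => (htgt p).1 hp)
  · exact c.surjective.comp A.symm.surjective
  · intro y hy z hz
    rw [hpr, c.eq_iff _ ((hsrc y).1 hy) _ ((hsrc z).1 hz), happ, happ]
    simp

end Transfer

/-! ### The relation between pairs of vectors induced by product geodesics -/

section PairRel

set_option linter.unusedSectionVars false

variable {E₁ : Type*} [NormedAddCommGroup E₁] [NormedSpace ℝ E₁] [FiniteDimensional ℝ E₁]
  {M₁ : Type*} [TopologicalSpace M₁] [ChartedSpace E₁ M₁] [IsManifold 𝓘(ℝ, E₁) ∞ M₁]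
  {E₂ : Type*} [NormedAddCommGroup E₂] [NormedSpace ℝ E₂] [FiniteDimensional ℝ E₂]
  {M₂ : Type*} [TopologicalSpace M₂] [ChartedSpace E₂ M₂] [IsManifold 𝓘(ℝ, E₂) ∞ M₂]
  (cov₁ : CovariantDerivative 𝓘(ℝ, E₁) E₁ (TangentSpace 𝓘(ℝ, E₁) : M₁ → Type _))
  (cov₂ : CovariantDerivative 𝓘(ℝ, E₂) E₂ (TangentSpace 𝓘(ℝ, E₂) : M₂ → Type _))

/-- Two pairs of tangent vectors are proportional to velocity vectors of a common pair of
geodesics. -/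
def PairRel (v w : TangentBundle 𝓘(ℝ, E₁) M₁ × TangentBundle 𝓘(ℝ, E₂) M₂) : Prop :=
  ∃ (γ₁ : ℝ → M₁) (γ₂ : ℝ → M₂) (J : Set ℝ), IsGeodesicOn cov₁ γ₁ J ∧ IsGeodesicOn cov₂ γ₂ J ∧
    ∃ s ∈ J, ∃ t ∈ J, curveLift 𝓘(ℝ, E₁) γ₁ s = v.1 ∧ curveLift 𝓘(ℝ, E₂) γ₂ s = v.2 ∧
      ∃ c : ℝ, c ≠ 0 ∧ w.1 = fiberSMul c (curveLift 𝓘(ℝ, E₁) γ₁ t) ∧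
        w.2 = fiberSMul c (curveLift 𝓘(ℝ, E₂) γ₂ t)

/-- The set of pairs of tangent vectors related to a given one. -/
def pairClass (v : TangentBundle 𝓘(ℝ, E₁) M₁ × TangentBundle 𝓘(ℝ, E₂) M₂) :
    Set (TangentBundle 𝓘(ℝ, E₁) M₁ × TangentBundle 𝓘(ℝ, E₂) M₂) := {w | PairRel cov₁ cov₂ v w}

variable {cov₁ cov₂}

lemma PairRel.swap {v w : TangentBundle 𝓘(ℝ, E₁) M₁ × TangentBundle 𝓘(ℝ, E₂) M₂}
    (h : PairRel cov₁ cov₂ v w) : PairRel cov₂ cov₁ v.swap w.swap := by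
  obtain ⟨γ₁, γ₂, J, h1, h2, s, hs, t, ht, h3, h4, c, hc, h5, h6⟩ := h
  exact ⟨γ₂, γ₁, J, h2, h1, s, hs, t, ht, h4, h3, c, hc, h6, h5⟩

lemma pairRel_swap_iff {v w : TangentBundle 𝓘(ℝ, E₁) M₁ × TangentBundle 𝓘(ℝ, E₂) M₂} :
    PairRel cov₂ cov₁ v.swap w.swap ↔ PairRel cov₁ cov₂ v w :=
  ⟨fun h => by simpa using h.swap, PairRel.swap⟩

/-- A product geodesic is a pair of geodesics on the same interval. Both components therefore move
for the same time and receive the same dilation factor; this coupling is what makes closed geodesics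
matter. -/
lemma geodRel_prodConnection_iff
    {V W : TangentBundle (𝓘(ℝ, E₁).prod 𝓘(ℝ, E₂)) (M₁ × M₂)} :
    GeodRel (prodConnection cov₁ cov₂) V W ↔
      PairRel cov₁ cov₂ (equivTangentBundleProd 𝓘(ℝ, E₁) M₁ 𝓘(ℝ, E₂) M₂ V)
        (equivTangentBundleProd 𝓘(ℝ, E₁) M₁ 𝓘(ℝ, E₂) M₂ W) := by
  constructor
  · rintro ⟨γ, J, hγ, s, hs, t, ht, rfl, c, hc, rfl⟩
    have h1 := (isGeodesicOn_prodConnection_iff cov₁ cov₂).1 hγ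
    have h2 := equivTangentBundleProd_curveLift (hγ.mdifferentiableAt hs)
    have h3 := equivTangentBundleProd_curveLift (hγ.mdifferentiableAt ht)
    refine ⟨_, _, J, h1.1, h1.2, s, hs, t, ht, (congrArg Prod.fst h2).symm,
      (congrArg Prod.snd h2).symm, c, hc, ?_, ?_⟩
    · exact congrArg (fun p => fiberSMul c p.1) h3
    · exact congrArg (fun p => fiberSMul c p.2) h3
  · rintro ⟨γ₁, γ₂, J, h1, h2, s, hs, t, ht, h3, h4, c, hc, h5, h6⟩
    have hγ : IsGeodesicOn (prodConnection cov₁ cov₂) (fun r => (γ₁ r, γ₂ r)) J :=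
      (isGeodesicOn_prodConnection_iff cov₁ cov₂).2 ⟨h1, h2⟩
    have h7 := equivTangentBundleProd_curveLift (hγ.mdifferentiableAt hs)
    have h8 := equivTangentBundleProd_curveLift (hγ.mdifferentiableAt ht)
    refine ⟨_, J, hγ, s, hs, t, ht, ?_, c, hc, ?_⟩
    · exact (equivTangentBundleProd 𝓘(ℝ, E₁) M₁ 𝓘(ℝ, E₂) M₂).injective
        (h7.trans (Prod.ext h3 h4))
    · refine (equivTangentBundleProd 𝓘(ℝ, E₁) M₁ 𝓘(ℝ, E₂) M₂).injective ?_
      have h9 := congrArg (fun p => (fiberSMul c p.1, fiberSMul c p.2)) h8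
      exact (Prod.ext h5 h6).trans h9.symm

lemma pairClass_eq_iff (h₁ : HasFlow cov₁) (h₂ : HasFlow cov₂)
    (v w : TangentBundle 𝓘(ℝ, E₁) M₁ × TangentBundle 𝓘(ℝ, E₂) M₂) :
    pairClass cov₁ cov₂ v = pairClass cov₁ cov₂ w ↔ PairRel cov₁ cov₂ v w := by
  set e := equivTangentBundleProd 𝓘(ℝ, E₁) M₁ 𝓘(ℝ, E₂) M₂ with he
  have hF := h₁.prodConnection h₂
  have key : ∀ a b, PairRel cov₁ cov₂ a b ↔
      GeodRel (prodConnection cov₁ cov₂) (e.symm a) (e.symm b) := fun a b => by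
    rw [geodRel_prodConnection_iff, ← he, e.apply_symm_apply, e.apply_symm_apply]
  constructor
  · intro h
    have h1 : w ∈ pairClass cov₁ cov₂ v := by
      rw [h]; exact (key _ _).2 (hF.geodRel_refl _)
    exact h1
  · intro h
    ext u
    exact ⟨fun hu => (key _ _).2 (hF.geodRel_trans ((key _ _).1 h).symm ((key _ _).1 hu)),
      fun hu => (key _ _).2 (hF.geodRel_trans ((key _ _).1 h) ((key _ _).1 hu))⟩

/-- The tangent bundle of a product is diffeomorphic to the product of the tangent bundles. -/
noncomputable def tangentBundleProdDiffeomorph (E₁ E₂ : Type*)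
    [NormedAddCommGroup E₁] [NormedSpace ℝ E₁] (M₁ M₂ : Type*) [TopologicalSpace M₁] [ChartedSpace E₁ M₁] [IsManifold 𝓘(ℝ, E₁) ∞ M₁]
    [NormedAddCommGroup E₂] [NormedSpace ℝ E₂]
    [TopologicalSpace M₂] [ChartedSpace E₂ M₂] [IsManifold 𝓘(ℝ, E₂) ∞ M₂] :
    TangentBundle (𝓘(ℝ, E₁).prod 𝓘(ℝ, E₂)) (M₁ × M₂)
      ≃ₘ^∞⟮(𝓘(ℝ, E₁).prod 𝓘(ℝ, E₂)).tangent, 𝓘(ℝ, E₁).tangent.prod 𝓘(ℝ, E₂).tangent⟯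
      (TangentBundle 𝓘(ℝ, E₁) M₁ × TangentBundle 𝓘(ℝ, E₂) M₂) where
  toEquiv := equivTangentBundleProd 𝓘(ℝ, E₁) M₁ 𝓘(ℝ, E₂) M₂
  contMDiff_toFun := contMDiff_equivTangentBundleProd
  contMDiff_invFun := contMDiff_equivTangentBundleProd_symm

lemma exists_linearQuotientChart_pairClass_iff (h₁ : HasFlow cov₁) (h₂ : HasFlow cov₂) {k : ℕ}
    (V : TangentBundle (𝓘(ℝ, E₁).prod 𝓘(ℝ, E₂)) (M₁ × M₂)) :
    (∃ c : LinearQuotientChart (𝓘(ℝ, E₁).tangent.prod 𝓘(ℝ, E₂).tangent) k (pairClass cov₁ cov₂),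
      equivTangentBundleProd 𝓘(ℝ, E₁) M₁ 𝓘(ℝ, E₂) M₂ V ∈ c.chart.source) ↔
    ∃ c : LinearQuotientChart (𝓘(ℝ, E₁).prod 𝓘(ℝ, E₂)).tangent k
      (geodClass (prodConnection cov₁ cov₂)), V ∈ c.chart.source := by
  set Φ := tangentBundleProdDiffeomorph E₁ E₂ M₁ M₂
  have hΦ : ∀ V, Φ V = equivTangentBundleProd 𝓘(ℝ, E₁) M₁ 𝓘(ℝ, E₂) M₂ V := fun V => rfl
  have hpr : ∀ V W, geodClass (prodConnection cov₁ cov₂) V = geodClass (prodConnection cov₁ cov₂) W ↔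
      pairClass cov₁ cov₂ (Φ V) = pairClass cov₁ cov₂ (Φ W) := fun V W => by
    rw [(h₁.prodConnection h₂).geodClass_eq_iff, pairClass_eq_iff h₁ h₂,
      geodRel_prodConnection_iff, hΦ, hΦ]
  constructor
  · exact exists_linearQuotientChart_of_diffeomorph Φ
      (ContinuousLinearEquiv.prodProdProdComm ℝ E₁ E₁ E₂ E₂) hpr
  · intro h
    refine exists_linearQuotientChart_of_diffeomorph (pr := geodClass (prodConnection cov₁ cov₂))
      Φ.symm
      (ContinuousLinearEquiv.prodProdProdComm ℝ E₁ E₂ E₁ E₂) (fun V W => ?_) ?_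
    · rw [hpr, Φ.apply_symm_apply, Φ.apply_symm_apply]
    · rw [← hΦ, Φ.symm_apply_apply]
      exact h

lemma exists_linearQuotientChart_pairClass_swap (h₁ : HasFlow cov₁) (h₂ : HasFlow cov₂) {k : ℕ}
    {v : TangentBundle 𝓘(ℝ, E₁) M₁ × TangentBundle 𝓘(ℝ, E₂) M₂}
    (h : ∃ c : LinearQuotientChart (𝓘(ℝ, E₁).tangent.prod 𝓘(ℝ, E₂).tangent) k
      (pairClass cov₁ cov₂), v ∈ c.chart.source) :
    ∃ c : LinearQuotientChart (𝓘(ℝ, E₂).tangent.prod 𝓘(ℝ, E₁).tangent) k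
      (pairClass cov₂ cov₁), v.swap ∈ c.chart.source := by
  refine exists_linearQuotientChart_of_diffeomorph
    (Diffeomorph.prodComm 𝓘(ℝ, E₂).tangent 𝓘(ℝ, E₁).tangent (TangentBundle 𝓘(ℝ, E₂) M₂)
      (TangentBundle 𝓘(ℝ, E₁) M₁) ∞)
    (ContinuousLinearEquiv.prodComm ℝ (E₁ × E₁) (E₂ × E₂)) (fun V W => ?_) (by simpa using h)
  rw [pairClass_eq_iff h₁ h₂, pairClass_eq_iff h₂ h₁]
  exact pairRel_swap_iff.symm

end PairRel

/-! ### Closed geodesics and constant geodesics -/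

section ClosedGeodesics

set_option linter.unusedSectionVars false

variable {E : Type*} [NormedAddCommGroup E] [NormedSpace ℝ E]
  {H : Type*} [TopologicalSpace H] {I : ModelWithCorners ℝ E H}
  {M : Type*} [TopologicalSpace M] [ChartedSpace H M] [IsManifold I ∞ M]
  {cov : CovariantDerivative I E (TangentSpace I : M → Type _)}

lemma HasClosedGeodesic.exists_curveLift_eq (h : HasClosedGeodesic cov) :
    ∃ (γ : ℝ → M) (J : Set ℝ), IsGeodesicOn cov γ J ∧ 0 ∈ J ∧ velocity I γ 0 ≠ 0 ∧
      ∃ T ∈ J, T ≠ 0 ∧ ∃ c : ℝ, c ≠ 0 ∧ curveLift I γ T = fiberSMul c (curveLift I γ 0) := by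
  obtain ⟨γ, J, hγ, s, hs, t, ht, hst, ℓ, ⟨hvs, h1⟩, hvt, h2⟩ := h
  obtain ⟨c, hc, h3⟩ := Quotient.exact (h1.trans h2.symm)
  have hl : ∀ r, r ∈ J → curveLift I (fun r => γ (1 * r + s)) (r - s) = curveLift I γ r := by
    intro r hr
    rw [hγ.curveLift_comp_affine (by simpa using hr)]
    simp
  have hl0 := hl s hs
  rw [sub_self] at hl0
  refine ⟨fun r => γ (1 * r + s), _, hγ.comp_affine 1 s, by simpa using hs, fun h0 => hvs ?_, t - s,
    by simpa using ht, sub_ne_zero.2 hst.symm, c, hc, ?_⟩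
  · have h4 : (curveLift I (fun r => γ (1 * r + s)) 0).2 = 0 := h0
    rw [hl0] at h4
    exact h4
  · rw [hl t ht, hl0]
    exact h3

lemma eq_of_not_hasClosedGeodesic (h : ¬ HasClosedGeodesic cov) {γ : ℝ → M} {J : Set ℝ}
    (hγ : IsGeodesicOn cov γ J) {s t : ℝ} (hs : s ∈ J) (ht : t ∈ J) (hv : velocity I γ s ≠ 0)
    {c : ℝ} (hc : c ≠ 0) (hst : curveLift I γ t = fiberSMul c (curveLift I γ s)) : s = t := by
  by_contra hne
  have hv' : velocity I γ t ≠ 0 := by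
    intro h0
    have h1 : (curveLift I γ t).2 = 0 := h0
    rw [hst] at h1
    exact (smul_ne_zero hc hv) h1
  refine h ⟨γ, J, hγ, s, hs, t, ht, hne, Quotient.mk _ ⟨curveLift I γ s, hv⟩, ⟨hv, rfl⟩, hv', ?_⟩
  exact (Quotient.sound ⟨c, hc, hst⟩ : Quotient.mk (proportionalSetoid I M)
    ⟨curveLift I γ s, hv⟩ = Quotient.mk _ ⟨curveLift I γ t, hv'⟩).symm

/-- By uniqueness, a geodesic with zero velocity at time zero coincides with its reparametrization
at speed zero, which is constant. -/
lemma HasFlow.fst_eq_of_geodRel_zero (hF : HasFlow cov) {x : M} {w : TangentBundle I M}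
    (h : GeodRel cov ⟨x, 0⟩ w) : w.1 = x := by
  obtain ⟨γ, J, hγ, h0, h1, t, ht, c, hc, rfl⟩ := h.exists_zero_mem
  have hx : γ 0 = x := congrArg TotalSpace.proj h1
  have hγ' := hγ.comp_affine 0 0
  have hmem : ∀ r : ℝ, 0 * r + 0 ∈ J := fun r => by simpa using h0
  have hu := hF.unique hγ ((hγ'.mono hγ.isOpen hγ.ordConnected fun r _ => hmem r)) h0 (by
    rw [hγ.curveLift_comp_affine (hmem 0), zero_mul, add_zero, h1]
    exact congrArg (TotalSpace.mk' E x) (smul_zero (0 : ℝ)).symm) t ht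
  have h2 := congrArg TotalSpace.proj hu
  simpa [hx] using h2

end ClosedGeodesics

/-! ### A closed geodesic in one factor prevents linearizing charts -/

section Necessity

set_option linter.unusedSectionVars false

variable {E₁ : Type*} [NormedAddCommGroup E₁] [NormedSpace ℝ E₁] [FiniteDimensional ℝ E₁]
  {M₁ : Type*} [TopologicalSpace M₁] [ChartedSpace E₁ M₁] [IsManifold 𝓘(ℝ, E₁) ∞ M₁]
  {E₂ : Type*} [NormedAddCommGroup E₂] [NormedSpace ℝ E₂] [FiniteDimensional ℝ E₂]
  {M₂ : Type*} [TopologicalSpace M₂] [ChartedSpace E₂ M₂] [IsManifold 𝓘(ℝ, E₂) ∞ M₂]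
  {cov₁ : CovariantDerivative 𝓘(ℝ, E₁) E₁ (TangentSpace 𝓘(ℝ, E₁) : M₁ → Type _)}
  {cov₂ : CovariantDerivative 𝓘(ℝ, E₂) E₂ (TangentSpace 𝓘(ℝ, E₂) : M₂ → Type _)}

lemma PairRel.geodRel_snd {v w : TangentBundle 𝓘(ℝ, E₁) M₁ × TangentBundle 𝓘(ℝ, E₂) M₂}
    (h : PairRel cov₁ cov₂ v w) : GeodRel cov₂ v.2 w.2 := by
  obtain ⟨γ₁, γ₂, J, -, h2, s, hs, t, ht, -, h4, c, hc, -, h6⟩ := h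
  exact ⟨γ₂, J, h2, s, hs, t, ht, h4, c, hc, h6⟩

lemma PairRel.geodRel_fst {v w : TangentBundle 𝓘(ℝ, E₁) M₁ × TangentBundle 𝓘(ℝ, E₂) M₂}
    (h : PairRel cov₁ cov₂ v w) : GeodRel cov₁ v.1 w.1 := by
  obtain ⟨γ₁, γ₂, J, h1, -, s, hs, t, ht, h3, -, c, hc, h5, -⟩ := h
  exact ⟨γ₁, J, h1, s, hs, t, ht, h3, c, hc, h5⟩

lemma isGeodesicOn_inter {E : Type*} [NormedAddCommGroup E] [NormedSpace ℝ E]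
    {H : Type*} [TopologicalSpace H] {I : ModelWithCorners ℝ E H}
    {M : Type*} [TopologicalSpace M] [ChartedSpace H M] [IsManifold I ∞ M]
    {cov : CovariantDerivative I E (TangentSpace I : M → Type _)} {γ : ℝ → M} {J K : Set ℝ}
    (h : IsGeodesicOn cov γ J) (hK : IsOpen K) (hK' : K.OrdConnected) :
    IsGeodesicOn cov γ (J ∩ K) ∧ IsGeodesicOn cov γ (K ∩ J) :=
  ⟨h.mono (h.isOpen.inter hK) (h.ordConnected.inter hK') inter_subset_left,
    h.mono (hK.inter h.isOpen) (hK'.inter h.ordConnected) inter_subset_right⟩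

/-- If pairs of geodesics form a manifold near the pairs with constant second component, then the
first factor has no closed geodesic. -/
lemma not_hasClosedGeodesic_of_exists_linearQuotientChart [Nontrivial E₂] [Nonempty M₂]
    (h₁ : HasFlow cov₁) (h₂ : HasFlow cov₂) {k : ℕ}
    (hch : ∀ v : TangentBundle 𝓘(ℝ, E₁) M₁ × TangentBundle 𝓘(ℝ, E₂) M₂, v.1.2 ≠ 0 →
      ∃ c : LinearQuotientChart (𝓘(ℝ, E₁).tangent.prod 𝓘(ℝ, E₂).tangent) k
        (pairClass cov₁ cov₂), v ∈ c.chart.source) :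
    ¬ HasClosedGeodesic cov₁ := by
  intro hcl
  obtain ⟨γ₁, J, hγ₁, h0J, hv0, T, hTJ, hT, c, hc, hcT⟩ := hcl.exists_curveLift_eq
  obtain ⟨p⟩ := ‹Nonempty M₂›
  obtain ⟨u, hu⟩ := exists_ne (0 : E₂)
  set w : TangentBundle 𝓘(ℝ, E₂) M₂ := ⟨p, u⟩ with hw
  obtain ⟨δ, hδ, U, hU, hwU, Ψ, hΨ, hfl⟩ := h₂.flow w
  obtain ⟨f0, f1, f2⟩ := hfl w hwU
  set v₁ := curveLift 𝓘(ℝ, E₁) γ₁ 0 with hv₁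
  set V : TangentBundle 𝓘(ℝ, E₁) M₁ × TangentBundle 𝓘(ℝ, E₂) M₂ := (v₁, ⟨p, 0⟩) with hV
  obtain ⟨q, hq⟩ := hch V hv0
  -- Along `a` the closed direction is fixed and the second component is a small multiple of `w`.
  set a : ℝ → TangentBundle 𝓘(ℝ, E₁) M₁ × TangentBundle 𝓘(ℝ, E₂) M₂ := fun r =>
    (v₁, fiberSMul r w) with ha
  -- This is `a r` moved for time `T` along the product geodesic and divided by `c`. The first
  -- component is `v₁` again; the geodesic issued from `r w` has velocity `r Ψ (r T) w` at time `T`.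
  set b : ℝ → TangentBundle 𝓘(ℝ, E₁) M₁ × TangentBundle 𝓘(ℝ, E₂) M₂ := fun r =>
    (v₁, fiberSMul (r / c) (Ψ (r * T) w)) with hb
  have h0δ : (0 : ℝ) ∈ Ioo (-δ) δ := ⟨by linarith, hδ⟩
  have hzero : ∀ z : TangentBundle 𝓘(ℝ, E₂) M₂, fiberSMul 0 z = ⟨z.1, 0⟩ := fun z =>
    congrArg (TotalSpace.mk' E₂ z.1) (zero_smul ℝ z.2)
  have ha0 : a 0 = V := by simp only [ha, hV, hzero, hw]
  have hb0 : b 0 = V := by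
    change (v₁, fiberSMul (0 / c) (Ψ (0 * T) w)) = V
    rw [zero_div, zero_mul, f0, hzero]
  have had : MDifferentiableAt 𝓘(ℝ, ℝ) (𝓘(ℝ, E₁).tangent.prod 𝓘(ℝ, E₂).tangent) a 0 := by
    refine mdifferentiableAt_const.prodMk ?_
    exact ((contMDiff_fiberSMul (I := 𝓘(ℝ, E₂)) (M := M₂)).comp
      (contMDiff_id.prodMk contMDiff_const)).mdifferentiable (by simp) 0
  have hbd : MDifferentiableAt 𝓘(ℝ, ℝ) (𝓘(ℝ, E₁).tangent.prod 𝓘(ℝ, E₂).tangent) b 0 := by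
    refine mdifferentiableAt_const.prodMk ?_
    have e1 : ContMDiffAt 𝓘(ℝ, ℝ) 𝓘(ℝ, ℝ) ∞ (fun r : ℝ => r / c) 0 :=
      (contDiff_id.div_const c).contMDiff.contMDiffAt
    have e2 : ContMDiffAt 𝓘(ℝ, ℝ) 𝓘(ℝ, ℝ) ∞ (fun r : ℝ => r * T) 0 :=
      (contDiff_id.mul contDiff_const).contMDiff.contMDiffAt
    have e3 : ContMDiffAt 𝓘(ℝ, ℝ) 𝓘(ℝ, E₂).tangent ∞ (fun r : ℝ => Ψ (r * T) w) 0 := by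
      have e4 := hΨ.contMDiffAt (x := ((0 : ℝ) * T, w)) ((isOpen_Ioo.prod hU).mem_nhds
        ⟨by simpa using h0δ, hwU⟩)
      exact e4.comp (f := fun r : ℝ => ((r * T, w) : ℝ × TangentBundle 𝓘(ℝ, E₂) M₂)) 0
        (e2.prodMk contMDiffAt_const)
    exact ((contMDiff_fiberSMul (I := 𝓘(ℝ, E₂)) (M := M₂)).contMDiffAt.comp 0
      (e1.prodMk e3)).mdifferentiableAt (by simp)
  have hTδ : ∀ᶠ r : ℝ in 𝓝 0, r * T ∈ Ioo (-δ) δ := by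
    have : Continuous fun r : ℝ => r * T := by fun_prop
    exact this.continuousAt.eventually_mem (by simpa using isOpen_Ioo.mem_nhds h0δ)
  have hab : ∀ᶠ r : ℝ in 𝓝 0, PairRel cov₁ cov₂ (a r) (b r) := by
    filter_upwards [hTδ] with r hr
    have g := f1.comp_affine r 0
    refine ⟨γ₁, _, _, (isGeodesicOn_inter hγ₁ g.isOpen g.ordConnected).1,
      (isGeodesicOn_inter g hγ₁.isOpen hγ₁.ordConnected).2, 0, ⟨h0J, by simpa using h0δ⟩, T,
      ⟨hTJ, by simpa using hr⟩, rfl, ?_, c⁻¹, inv_ne_zero hc, ?_, ?_⟩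
    · have e1 : r * 0 + 0 ∈ Ioo (-δ) δ := by simpa using h0δ
      rw [f1.curveLift_comp_affine e1, f2 _ e1]
      simp [f0, ha]
    · rw [hcT, fiberSMul_fiberSMul, inv_mul_cancel₀ hc, one_fiberSMul]
    · have e1 : r * T + 0 ∈ Ioo (-δ) δ := by simpa using hr
      rw [f1.curveLift_comp_affine e1, f2 _ e1, fiberSMul_fiberSMul, add_zero]
      simp only [hb, div_eq_inv_mul]
  -- read everything in the chart
  have hqV := q.chart.open_source.mem_nhds hq
  have haq : ∀ᶠ r in 𝓝 0, a r ∈ q.chart.source :=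
    had.continuousAt.eventually_mem (by rw [ha0]; exact hqV)
  have hbq : ∀ᶠ r in 𝓝 0, b r ∈ q.chart.source :=
    hbd.continuousAt.eventually_mem (by rw [hb0]; exact hqV)
  have hqd : MDifferentiableAt (𝓘(ℝ, E₁).tangent.prod 𝓘(ℝ, E₂).tangent)
      𝓘(ℝ, (E₁ × E₁) × (E₂ × E₂)) q.chart V :=
    (q.contMDiffOn.contMDiffAt hqV).mdifferentiableAt (by simp)
  have had' : DifferentiableAt ℝ (q.chart ∘ a) 0 := by
    rw [← mdifferentiableAt_iff_differentiableAt]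
    exact MDifferentiableAt.comp 0 (by rw [ha0]; exact hqd) had
  have hbd' : DifferentiableAt ℝ (q.chart ∘ b) 0 := by
    rw [← mdifferentiableAt_iff_differentiableAt]
    exact MDifferentiableAt.comp 0 (by rw [hb0]; exact hqd) hbd
  -- The base point of the second component, as a function on the linearizing chart.
  set P : (E₁ × E₁) × (E₂ × E₂) → E₂ := fun z => extChartAt 𝓘(ℝ, E₂) p (q.chart.symm z).2.1 with hP
  have hPd : DifferentiableAt ℝ P (q.chart V) := by
    rw [← mdifferentiableAt_iff_differentiableAt]
    have e1 : MDifferentiableAt 𝓘(ℝ, (E₁ × E₁) × (E₂ × E₂))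
        (𝓘(ℝ, E₁).tangent.prod 𝓘(ℝ, E₂).tangent) q.chart.symm (q.chart V) :=
      (q.contMDiffOn_symm.contMDiffAt (q.chart.open_target.mem_nhds
        (q.chart.map_source hq))).mdifferentiableAt (by simp)
    have e2 : MDifferentiableAt 𝓘(ℝ, (E₁ × E₁) × (E₂ × E₂)) 𝓘(ℝ, E₂)
        (fun z => (q.chart.symm z).2.1) (q.chart V) :=
      (((contMDiff_proj (n := ∞) (TangentSpace 𝓘(ℝ, E₂) : M₂ → Type _)).mdifferentiable
        (by simp)).comp (mdifferentiable_snd (I := 𝓘(ℝ, E₁).tangent)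
          (M := TangentBundle 𝓘(ℝ, E₁) M₁))).mdifferentiableAt.comp _ e1
    have e3 : (q.chart.symm (q.chart V)).2.1 = p := by rw [q.chart.left_inv hq]
    refine MDifferentiableAt.comp (I' := 𝓘(ℝ, E₂)) (q.chart V) (g := extChartAt 𝓘(ℝ, E₂) p) ?_ e2
    rw [e3]
    exact (contMDiffAt_extChartAt (n := 1)).mdifferentiableAt (by simp)
  set P' := fderiv ℝ P (q.chart V)
  have hP' : HasFDerivAt P P' (q.chart V) := hPd.hasFDerivAt
  set a' := deriv (q.chart ∘ a) 0
  set b' := deriv (q.chart ∘ b) 0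
  -- For small `r` the pairs `a r` and `b r` are in one class, so the linear map has the same value
  -- along both curves.
  have hproj : q.proj a' = q.proj b' := by
    have e1 := q.proj.hasFDerivAt.comp_hasDerivAt 0 had'.hasDerivAt
    have e2 := q.proj.hasFDerivAt.comp_hasDerivAt 0 hbd'.hasDerivAt
    refine e1.unique (e2.congr_of_eventuallyEq ?_)
    filter_upwards [haq, hbq, hab] with r h3 h4 h5
    exact (q.eq_iff _ h3 _ h4).1 ((pairClass_eq_iff h₁ h₂ _ _).2 h5)
  have hPa : P' a' = 0 := by
    have e1 : HasDerivAt (P ∘ (q.chart ∘ a)) (P' a') 0 := by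
      refine HasFDerivAt.comp_hasDerivAt 0 ?_ had'.hasDerivAt
      rw [Function.comp_apply, ha0]
      exact hP'
    refine e1.unique ((hasDerivAt_const (0 : ℝ) (extChartAt 𝓘(ℝ, E₂) p p)).congr_of_eventuallyEq ?_)
    filter_upwards [haq] with r hr
    simp only [hP, Function.comp_apply, q.chart.left_inv hr]
    rfl
  -- The second base point of `b r` is that of the geodesic of `w` at time `r T`, hence it moves
  -- with velocity `T u`, whereas that of `a r` stays at `p`.
  have hPb : P' b' = T • u := by
    have e1 : HasDerivAt (P ∘ (q.chart ∘ b)) (P' b') 0 := by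
      refine HasFDerivAt.comp_hasDerivAt 0 ?_ hbd'.hasDerivAt
      rw [Function.comp_apply, hb0]
      exact hP'
    have e0 : T * 0 + 0 ∈ Ioo (-δ) δ := by simpa using h0δ
    have e2 := (f1.comp_affine T 0).mdifferentiableAt (t := 0) e0
    have e4 : curveLift 𝓘(ℝ, E₂) (fun r => (fun s => (Ψ s w).1) (T * r + 0)) 0 = fiberSMul T w := by
      rw [f1.curveLift_comp_affine e0, f2 _ e0]
      simp [f0]
    have e5 : (Ψ (T * 0 + 0) w).1 = p := by rw [mul_zero, add_zero, f0]
    have e3 := hasDerivAt_extChartAt_comp_curve (x := p) e2 (by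
      rw [e5]; exact mem_chart_source E₂ p)
    rw [e4] at e3
    have e6 : (tangentTriv 𝓘(ℝ, E₂) p (fiberSMul T w)).2 = T • u :=
      tangentTriv_self p (T • u : E₂)
    rw [e6] at e3
    refine e1.unique (e3.congr_of_eventuallyEq ?_)
    filter_upwards [hbq] with r hr
    simp only [hP, Function.comp_apply, q.chart.left_inv hr]
    simp [hb, mul_comm]
  -- The straight line in the kernel direction stays in the class of `(v₁, 0_p)`. There the second
  -- component lies on a constant geodesic, so `P` is constant along the line.
  have hline : P' (b' - a') = 0 := by
    have hc0 : HasDerivAt (fun r : ℝ => q.chart V + r • (b' - a')) (b' - a') 0 := by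
      simpa using ((hasDerivAt_id (0 : ℝ)).smul_const (b' - a')).const_add (q.chart V)
    have e1 : HasDerivAt (P ∘ fun r : ℝ => q.chart V + r • (b' - a')) (P' (b' - a')) 0 := by
      refine HasFDerivAt.comp_hasDerivAt 0 ?_ hc0
      simpa using hP'
    refine e1.unique ((hasDerivAt_const (0 : ℝ) (extChartAt 𝓘(ℝ, E₂) p p)).congr_of_eventuallyEq ?_)
    have e2 : ∀ᶠ r : ℝ in 𝓝 0, q.chart V + r • (b' - a') ∈ q.chart.target :=
      hc0.continuousAt.eventually_mem (by
        simpa using q.chart.open_target.mem_nhds (q.chart.map_source hq))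
    filter_upwards [e2] with r hr
    have e3 : PairRel cov₁ cov₂ V (q.chart.symm (q.chart V + r • (b' - a'))) := by
      rw [← pairClass_eq_iff h₁ h₂, q.eq_iff _ hq _ (q.chart.map_target hr), q.chart.right_inv hr]
      simp [hproj]
    have e4 := h₂.fst_eq_of_geodRel_zero e3.geodRel_snd
    simp only [hP, Function.comp_apply, e4]
  rw [map_sub, hPa, hPb, sub_zero] at hline
  exact smul_ne_zero hT hu hline

end Necessity

/-! ### Submersions with countable fibres -/

section CountableFibre

variable {E F : Type*} [NormedAddCommGroup E] [NormedSpace ℝ E] [CompleteSpace E]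
  [NormedAddCommGroup F] [NormedSpace ℝ F] [FiniteDimensional ℝ F]

/-- A submersion with a locally countable fibre through `a` is an immersion at `a`. -/
theorem HasStrictFDerivAt.injective_of_countable_fibre {f : E → F} {A : E →L[ℝ] F} {a : E}
    (hf : HasStrictFDerivAt f A a) (hA : A.range = ⊤) {N : Set E} (hN : N ∈ 𝓝 a)
    (hc : (N ∩ f ⁻¹' {f a}).Countable) : Function.Injective A := by
  have : CompleteSpace F := FiniteDimensional.complete ℝ F
  refine LinearMap.ker_eq_bot (f := (A : E →ₗ[ℝ] F)).1 ((Submodule.eq_bot_iff _).2 ?_)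
  by_contra! hne
  obtain ⟨ξ, hξ, hξ0⟩ := hne
  -- These coordinates straighten the fibres of `f`. A nonzero vector of the kernel would give an
  -- injective image of an interval inside the fibre, which would be uncountable.
  set e := hf.implicitToOpenPartialHomeomorph f A hA with he
  let ξ' : A.ker := ⟨ξ, hξ⟩
  have hξ' : ξ' ≠ 0 := fun h => hξ0 (congrArg Subtype.val h)
  have hea : e a = (f a, 0) := by
    simp [he]
  have hsrc : a ∈ e.source := hf.mem_implicitToOpenPartialHomeomorph_source hA
  have htgt : (f a, (0 : A.ker)) ∈ e.target := hea ▸ e.map_source hsrc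
  have hsymm : e.symm (f a, 0) = a := by rw [← hea, e.left_inv hsrc]
  have hcont : ContinuousAt (fun r : ℝ => (f a, r • ξ')) 0 := by fun_prop
  have h1 : ∀ᶠ r : ℝ in 𝓝 0, (f a, r • ξ') ∈ e.target :=
    hcont.eventually_mem (by simpa using e.open_target.mem_nhds htgt)
  have h2 : ∀ᶠ r : ℝ in 𝓝 0, e.symm (f a, r • ξ') ∈ N := by
    have hs : ContinuousAt e.symm (f a, 0) := e.continuousAt_symm htgt
    have : ContinuousAt (fun r : ℝ => e.symm (f a, r • ξ')) 0 :=
      ContinuousAt.comp (f := fun r : ℝ => (f a, r • ξ')) (by simpa using hs) hcont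
    exact this.eventually_mem (by simpa [hsymm] using hN)
  obtain ⟨ε, hε, hball⟩ := Metric.eventually_nhds_iff_ball.1 (h1.and h2)
  have hinj : InjOn (fun r : ℝ => e.symm (f a, r • ξ')) (Metric.ball 0 ε) := by
    intro r hr s hs hrs
    have := e.symm.injOn (hball r hr).1 (hball s hs).1 hrs
    exact smul_left_injective ℝ hξ' (Prod.ext_iff.1 this).2
  have hmaps : MapsTo (fun r : ℝ => e.symm (f a, r • ξ')) (Metric.ball 0 ε)
      (N ∩ f ⁻¹' {f a}) := by
    intro r hr
    refine ⟨(hball r hr).2, ?_⟩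
    have := e.right_inv (hball r hr).1
    have h3 := hf.implicitToOpenPartialHomeomorph_fst hA (e.symm (f a, r • ξ'))
    rw [← he, this] at h3
    exact h3.symm
  have hcount : (Metric.ball (0 : ℝ) ε).Countable := by
    exact Set.MapsTo.countable_of_injOn hmaps hinj hc
  rw [Real.ball_eq_Ioo, Cardinal.Real.Ioo_countable_iff] at hcount
  linarith

end CountableFibre

/-! ### Countability of transverse crossings -/

section TransverseTimes

set_option linter.unusedSectionVars false

variable {E : Type*} [NormedAddCommGroup E] [NormedSpace ℝ E] [FiniteDimensional ℝ E]
  {M : Type*} [TopologicalSpace M] [ChartedSpace E M] [IsManifold 𝓘(ℝ, E) ∞ M]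
  {cov : CovariantDerivative 𝓘(ℝ, E) E (TangentSpace 𝓘(ℝ, E) : M → Type _)}

lemma HasFlow.curveLift_eq_of_curveLift_zero (hF : HasFlow cov) {γ γ' : ℝ → M} {J J' : Set ℝ}
    (h : IsGeodesicOn cov γ J) (h' : IsGeodesicOn cov γ' J') (h0 : 0 ∈ J) (h0' : 0 ∈ J')
    (heq : curveLift 𝓘(ℝ, E) γ 0 = curveLift 𝓘(ℝ, E) γ' 0) {t : ℝ} (ht : t ∈ J) (ht' : t ∈ J') :
    curveLift 𝓘(ℝ, E) γ t = curveLift 𝓘(ℝ, E) γ' t :=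
  hF.unique (isGeodesicOn_inter h h'.isOpen h'.ordConnected).1
    (isGeodesicOn_inter h' h.isOpen h.ordConnected).2 ⟨h0, h0'⟩ heq t ⟨ht, ht'⟩

/-- A geodesic crosses a hypersurface transversally at countably many times only. -/
lemma HasFlow.countable_setOf_transverse (hF : HasFlow cov) (v : TangentBundle 𝓘(ℝ, E) M) (x : M)
    (l : E →L[ℝ] ℝ) (a : ℝ) :
    {t : ℝ | ∃ (γ : ℝ → M) (J : Set ℝ), IsGeodesicOn cov γ J ∧ 0 ∈ J ∧ t ∈ J ∧
      curveLift 𝓘(ℝ, E) γ 0 = v ∧ γ t ∈ (chartAt E x).source ∧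
      l (tangentCoord x (curveLift 𝓘(ℝ, E) γ t)).1 = a ∧
      l (tangentCoord x (curveLift 𝓘(ℝ, E) γ t)).2 ≠ 0}.Countable := by
  -- A subset of `ℝ` all of whose points are isolated is countable, because every subset of `ℝ` is
  -- Lindelöf.
  refine IsLindelof.countable_of_isDiscrete (HereditarilyLindelofSpace.isLindelof _)
    (isDiscrete_iff_nhdsNE.2 ?_)
  rintro t ⟨γ, J, hγ, h0, ht, rfl, hx, ha, hne⟩
  rw [← disjoint_iff, disjoint_principal_right]
  have h1 : HasDerivAt (fun s => l (extChartAt 𝓘(ℝ, E) x (γ s)))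
      (l (tangentCoord x (curveLift 𝓘(ℝ, E) γ t)).2) t :=
    l.hasFDerivAt.comp_hasDerivAt t
      (hasDerivAt_extChartAt_comp_curve (hγ.mdifferentiableAt ht) hx)
  -- With nonzero derivative the function leaves the level `a` at once. By uniqueness the value at
  -- time `s` does not depend on the geodesic chosen as witness there.
  filter_upwards [h1.eventually_ne (c := a) hne,
    nhdsWithin_le_nhds (hγ.isOpen.mem_nhds ht)] with s hs hsJ
  rintro ⟨β, K, hβ, h0', hs', hβ0, -, hb, -⟩
  have h2 := hF.curveLift_eq_of_curveLift_zero hβ hγ h0' h0 hβ0 hs' hsJ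
  rw [h2] at hb
  exact hs hb

/-- Up to proportionality, a geodesic meets a hypersurface transversally in countably many
vectors only. -/
lemma HasFlow.countable_setOf_geodRel (hF : HasFlow cov) (v : TangentBundle 𝓘(ℝ, E) M) (x : M)
    (l : E →L[ℝ] ℝ) (a : ℝ) :
    {w : TangentBundle 𝓘(ℝ, E) M | GeodRel cov v w ∧ w.1 ∈ (chartAt E x).source ∧
      l (tangentCoord x w).1 = a ∧ l (tangentCoord x w).2 = 1}.Countable := by
  have hsm : ∀ (c : ℝ) (u : TangentBundle 𝓘(ℝ, E) M), u.1 ∈ (chartAt E x).source →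
      l (tangentCoord x (fiberSMul c u)).2 = c * l (tangentCoord x u).2 := by
    intro c u hu
    have h1 : (tangentCoord x (fiberSMul c u)).2 = c • (tangentCoord x u).2 :=
      tangentTriv_smul hu c u.2
    rw [h1, map_smul, smul_eq_mul]
  -- Each related vector is given a time at which the geodesic of `v` meets its line; unrelated
  -- vectors receive the value `0`, which plays no role.
  have key : ∀ w : TangentBundle 𝓘(ℝ, E) M, ∃ t : ℝ, GeodRel cov v w →
      ∃ (γ : ℝ → M) (J : Set ℝ), IsGeodesicOn cov γ J ∧ 0 ∈ J ∧ t ∈ J ∧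
        curveLift 𝓘(ℝ, E) γ 0 = v ∧ ∃ c : ℝ, c ≠ 0 ∧ w = fiberSMul c (curveLift 𝓘(ℝ, E) γ t) := by
    intro w
    by_cases h : GeodRel cov v w
    · obtain ⟨γ, J, hγ, h0, hv, t, ht, h2⟩ := h.exists_zero_mem
      exact ⟨t, fun _ => ⟨γ, J, hγ, h0, ht, hv, h2⟩⟩
    · exact ⟨0, fun h' => absurd h' h⟩
  choose T hT using key
  refine Set.MapsTo.countable_of_injOn (f := T) ?_ ?_ (hF.countable_setOf_transverse v x l a)
  · rintro w ⟨hw, hx, h1, h2⟩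
    obtain ⟨γ, J, hγ, h0, ht, hv, c, hc, hwc⟩ := hT w hw
    have hx' : γ (T w) ∈ (chartAt E x).source := by rw [hwc] at hx; exact hx
    refine ⟨γ, J, hγ, h0, ht, hv, hx', ?_, ?_⟩
    · rw [hwc] at h1
      exact h1
    · rw [hwc, hsm c _ hx'] at h2
      exact right_ne_zero_of_mul_eq_one h2
  -- Equal times give proportional vectors, and the condition that `l` is one on the velocity fixes
  -- the factor, so the time determines the vector.
  · rintro w ⟨hw, hx, h1, h2⟩ w' ⟨hw', hx', h1', h2'⟩ heq
    obtain ⟨γ, J, hγ, h0, ht, hv, c, hc, hwc⟩ := hT w hw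
    obtain ⟨γ', J', hγ', h0', ht', hv', c', hc', hwc'⟩ := hT w' hw'
    rw [← heq] at ht' hwc'
    have h3 := hF.curveLift_eq_of_curveLift_zero hγ hγ' h0 h0' (hv.trans hv'.symm) ht ht'
    rw [← h3] at hwc'
    have hx2 : γ (T w) ∈ (chartAt E x).source := by rw [hwc] at hx; exact hx
    rw [hwc, hsm c _ hx2] at h2
    rw [hwc', hsm c' _ hx2] at h2'
    have h4 : c = c' := mul_right_cancel₀ (right_ne_zero_of_mul_eq_one h2) (h2.trans h2'.symm)
    rw [hwc, hwc', h4]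

end TransverseTimes

/-! ### Triangular elimination for the slice -/

section LinearAlgebra

variable {X Y : Type*} [NormedAddCommGroup X] [NormedSpace ℝ X]
  [NormedAddCommGroup Y] [NormedSpace ℝ Y]
  {L : X →L[ℝ] Y} {P Q : X →L[ℝ] ℝ} {B : Y × ℝ × ℝ →L[ℝ] X}

/-- Apply `P` and `Q` to the flow direction `B (0, 1, 0)` and the dilation direction `B (0, 0, 1)`:
the matrix is triangular with ones on the diagonal. The value of `Q` on the flow direction, which
reflects acceleration, is arbitrary and is corrected last. -/
lemma range_prod_prod_eq_top_of_section (hLB : ∀ p, L (B p) = p.1) (hP1 : P (B (0, 1, 0)) = 1)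
    (hP2 : P (B (0, 0, 1)) = 0) (hQ2 : Q (B (0, 0, 1)) = 1) : (L.prod (P.prod Q)).range = ⊤ := by
  refine LinearMap.range_eq_top.2 ?_
  rintro ⟨w, a, b⟩
  set u := B (w, 0, 0) + (a - P (B (w, 0, 0))) • B (0, 1, 0) with hu
  refine ⟨u + (b - Q u) • B (0, 0, 1), ?_⟩
  have h1 : P u = a := by simp [hu, hP1]
  have h2 : L u = w := by simp [hu, hLB]
  refine Prod.ext ?_ (Prod.ext ?_ ?_)
  · change L _ = w
    simp [h2, hLB]
  · change P _ = a
    simp [h1, hP2]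
  · change Q _ = b
    simp [hQ2]

/-- A vector of the kernel has first component zero because of `L`; then `P` and `Q`, in this order,
eliminate the other two. -/
lemma injective_of_comp_eq_fst (hLB : ∀ p, L (B p) = p.1) (hP1 : P (B (0, 1, 0)) = 1)
    (hP2 : P (B (0, 0, 1)) = 0) (hQ2 : Q (B (0, 0, 1)) = 1) : Function.Injective B := by
  refine (injective_iff_map_eq_zero B).2 ?_
  rintro ⟨w, a, b⟩ h
  have hw : w = 0 := by simpa [h] using (hLB (w, a, b)).symm
  subst hw
  have h1 : B (0, a, b) = a • B (0, 1, 0) + b • B (0, 0, 1) := by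
    rw [← map_smul, ← map_smul, ← map_add]
    simp
  rw [h1] at h
  have ha : a = 0 := by simpa [hP1, hP2] using congrArg P h
  subst ha
  have hb : b = 0 := by simpa [hQ2] using congrArg Q h
  subst hb
  rfl

end LinearAlgebra

/-! ### A slice transverse to the flow and to the dilations -/

section Slice

set_option linter.unusedSectionVars false

variable {E : Type*} [NormedAddCommGroup E] [NormedSpace ℝ E] [FiniteDimensional ℝ E]
  {M : Type*} [TopologicalSpace M] [ChartedSpace E M] [IsManifold 𝓘(ℝ, E) ∞ M]
  (cov : CovariantDerivative 𝓘(ℝ, E) E (TangentSpace 𝓘(ℝ, E) : M → Type _))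

/-- A slice transverse to the geodesics and to the dilations near a tangent vector `v`. Every
nearby vector is `scale` times the velocity at time `time` of the geodesic issued from a vector of
the slice, which is parametrized by `base`. -/
structure GeodesicSlice (k : ℕ) (v : TangentBundle 𝓘(ℝ, E) M) where
  /-- the neighbourhood of `v` -/
  domain : Set (TangentBundle 𝓘(ℝ, E) M)
  /-- the parameter of the geodesic -/
  base : TangentBundle 𝓘(ℝ, E) M → EuclideanSpace ℝ (Fin k)
  /-- the time from the slice -/
  time : TangentBundle 𝓘(ℝ, E) M → ℝ
  /-- the dilation factor -/
  scale : TangentBundle 𝓘(ℝ, E) M → ℝ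
  /-- the parametrization of the slice -/
  sect : EuclideanSpace ℝ (Fin k) → TangentBundle 𝓘(ℝ, E) M
  isOpen : IsOpen domain
  mem : v ∈ domain
  contMDiffOn_base : ContMDiffOn 𝓘(ℝ, E).tangent (𝓡 k) ∞ base domain
  contMDiffOn_time : ContMDiffOn 𝓘(ℝ, E).tangent 𝓘(ℝ, ℝ) ∞ time domain
  contMDiffOn_scale : ContMDiffOn 𝓘(ℝ, E).tangent 𝓘(ℝ, ℝ) ∞ scale domain
  contMDiffAt_sect : ContMDiffAt (𝓡 k) 𝓘(ℝ, E).tangent ∞ sect (base v)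
  sect_base : sect (base v) = v
  eventually_sect : ∀ᶠ z in 𝓝 (base v),
    sect z ∈ domain ∧ base (sect z) = z ∧ time (sect z) = 0 ∧ scale (sect z) = 1
  scale_ne_zero : ∀ x ∈ domain, scale x ≠ 0
  sect_ne_zero : ∀ x ∈ domain, (sect (base x)).2 ≠ 0
  exists_geodesic : ∀ x ∈ domain, ∃ (γ : ℝ → M) (J : Set ℝ), IsGeodesicOn cov γ J ∧ 0 ∈ J ∧
    time x ∈ J ∧ curveLift 𝓘(ℝ, E) γ 0 = sect (base x) ∧
    x = fiberSMul (scale x) (curveLift 𝓘(ℝ, E) γ (time x))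
  geodRel_iff : ∀ x ∈ domain, ∀ x' ∈ domain, GeodRel cov x x' ↔ base x = base x'

variable {cov}

/-- The map `(z, s, r) ↦ r · Ψ s (σ z)`, with `σ` a local section of the linear coordinate, has an
injective derivative at `(z₀, 0, 1)`: changing `z` changes the class, while flow and dilation are
independent because `v ≠ 0`. For the inverse function theorem the dimensions must agree, and the
missing inequality says that classes are no more than two-dimensional. It does not follow from the
form of the relation, since a geodesic may return near `v` infinitely often; countability of
transverse crossings gives it. -/
lemma HasFlow.exists_geodesicSlice (hF : HasFlow cov) {v : TangentBundle 𝓘(ℝ, E) M}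
    (hv : v.2 ≠ 0) {k : ℕ} (c : LinearQuotientChart 𝓘(ℝ, E).tangent k (geodClass cov))
    (hvc : v ∈ c.chart.source) (hne : ∀ w ∈ c.chart.source, w.2 ≠ 0) :
    Nonempty (GeodesicSlice cov k v) ∧ k + 2 = 2 * Module.finrank ℝ E := by
  have : CompleteSpace E := FiniteDimensional.complete ℝ E
  obtain ⟨ε, hε, U, hU, hvU, Ψ, hΨ, hΨf⟩ := hF.flow v
  set z₀ := c.proj (c.chart v) with hz₀
  set p₀ : EuclideanSpace ℝ (Fin k) × ℝ × ℝ := (z₀, 0, 1) with hp₀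
  have hσv : c.localSection v z₀ = v := c.localSection_self v hvc
  set h : EuclideanSpace ℝ (Fin k) × ℝ × ℝ → TangentBundle 𝓘(ℝ, E) M :=
    fun p => fiberSMul p.2.2 (Ψ p.2.1 (c.localSection v p.1)) with hh
  set D := c.sectionDomain v ∩ c.localSection v ⁻¹' U with hDdef
  have hD : IsOpen D :=
    (c.contMDiffOn_localSection v).continuousOn.isOpen_inter_preimage (c.isOpen_sectionDomain v) hU
  have hz₀D : z₀ ∈ D := ⟨c.mem_sectionDomain v hvc, by rw [mem_preimage, hσv]; exact hvU⟩
  set W₁ : Set (EuclideanSpace ℝ (Fin k) × ℝ × ℝ) := D ×ˢ Ioo (-ε) ε ×ˢ {0}ᶜ with hW₁def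
  have hW₁ : IsOpen W₁ := hD.prod (isOpen_Ioo.prod isOpen_compl_singleton)
  have h0ε : (0 : ℝ) ∈ Ioo (-ε) ε := ⟨by linarith, hε⟩
  have hp₀W₁ : p₀ ∈ W₁ := ⟨hz₀D, h0ε, by simp [hp₀]⟩
  have hhs : ContMDiffOn 𝓘(ℝ, EuclideanSpace ℝ (Fin k) × ℝ × ℝ) 𝓘(ℝ, E).tangent ∞ h W₁ := by
    have a1 : ContMDiffOn 𝓘(ℝ, EuclideanSpace ℝ (Fin k) × ℝ × ℝ) (𝓡 k) ∞
      (fun p : EuclideanSpace ℝ (Fin k) × ℝ × ℝ => p.1) W₁ := contDiff_fst.contMDiff.contMDiffOn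
    have a2 : ContMDiffOn 𝓘(ℝ, EuclideanSpace ℝ (Fin k) × ℝ × ℝ) 𝓘(ℝ, ℝ) ∞
      (fun p : EuclideanSpace ℝ (Fin k) × ℝ × ℝ => p.2.1) W₁ :=
      (contDiff_fst.comp contDiff_snd).contMDiff.contMDiffOn
    have a3 : ContMDiffOn 𝓘(ℝ, EuclideanSpace ℝ (Fin k) × ℝ × ℝ) 𝓘(ℝ, ℝ) ∞
      (fun p : EuclideanSpace ℝ (Fin k) × ℝ × ℝ => p.2.2) W₁ :=
      (contDiff_snd.comp contDiff_snd).contMDiff.contMDiffOn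
    have a4 : ContMDiffOn 𝓘(ℝ, EuclideanSpace ℝ (Fin k) × ℝ × ℝ) 𝓘(ℝ, E).tangent ∞
      (fun p => c.localSection v p.1) W₁ :=
      (c.contMDiffOn_localSection v).comp a1 fun p hp => hp.1.1
    have a5 : ContMDiffOn 𝓘(ℝ, EuclideanSpace ℝ (Fin k) × ℝ × ℝ) 𝓘(ℝ, E).tangent ∞
        (fun p => Ψ p.2.1 (c.localSection v p.1)) W₁ :=
      hΨ.comp (f := fun p : EuclideanSpace ℝ (Fin k) × ℝ × ℝ => (p.2.1, c.localSection v p.1))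
        (a2.prodMk a4) fun p hp => ⟨hp.2.1, hp.1.2⟩
    exact contMDiff_fiberSMul.comp_contMDiffOn (a3.prodMk a5)
  have hhp₀ : h p₀ = v := by simp [hh, hp₀, hσv, (hΨf v hvU).1]
  set W := W₁ ∩ h ⁻¹' c.chart.source with hWdef
  have hW : IsOpen W := hhs.continuousOn.isOpen_inter_preimage hW₁ c.chart.open_source
  have hp₀W : p₀ ∈ W := ⟨hp₀W₁, by rw [mem_preimage, hhp₀]; exact hvc⟩
  set g : EuclideanSpace ℝ (Fin k) × ℝ × ℝ → E × E := fun p => c.chart (h p) with hg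
  have hgp₀ : g p₀ = c.chart v := by rw [hg]; exact congrArg _ hhp₀
  have hgs : ContDiffOn ℝ ∞ g W := by
    have h1 : ContMDiffOn 𝓘(ℝ, EuclideanSpace ℝ (Fin k) × ℝ × ℝ) 𝓘(ℝ, E × E) ∞ g W :=
      c.contMDiffOn.comp (hhs.mono inter_subset_left) fun p hp => hp.2
    exact contMDiffOn_iff_contDiffOn.1 h1
  -- the class of `h p`
  have hgeod : ∀ p ∈ W₁, ∃ (γ : ℝ → M) (J : Set ℝ), IsGeodesicOn cov γ J ∧ 0 ∈ J ∧
      p.2.1 ∈ J ∧ curveLift 𝓘(ℝ, E) γ 0 = c.localSection v p.1 ∧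
      h p = fiberSMul p.2.2 (curveLift 𝓘(ℝ, E) γ p.2.1) := by
    intro p hp
    obtain ⟨b1, b2, b3⟩ := hΨf _ hp.1.2
    exact ⟨_, _, b2, h0ε, hp.2.1, (b3 0 h0ε).trans b1, by rw [b3 _ hp.2.1]⟩
  -- Flow and dilation do not leave the class of the section point, so the linear coordinate of `h
  -- p` is still the parameter of the section.
  have hLg : ∀ p ∈ W, c.proj (g p) = p.1 := by
    intro p hp
    obtain ⟨γ, J, hγ, h0, ht, hl, hhp⟩ := hgeod p hp.1
    have h1 : GeodRel cov (c.localSection v p.1) (h p) :=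
      ⟨γ, J, hγ, 0, h0, _, ht, hl, _, hp.1.2.2, hhp⟩
    have h2 := (c.eq_iff _ (c.localSection_mem_source v hp.1.1.1) _ hp.2).1
      ((hF.geodClass_eq_iff _ _).2 h1)
    rw [c.proj_localSection v hp.1.1.1] at h2
    exact h2.symm
  set e := extChartAt 𝓘(ℝ, E).tangent v with he
  have hev : ∀ w, tangentCoord v.1 w = e w := tangentCoord_eq v
  have hesource : ∀ {w}, w ∈ e.source ↔ w.1 ∈ (chartAt E v.1).source := by
    intro w
    rw [he, extChartAt_source, TangentBundle.mem_chart_source_iff]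
  set N := c.chart.target ∩ c.chart.symm ⁻¹' e.source with hN
  have hNo : IsOpen N :=
    c.contMDiffOn_symm.continuousOn.isOpen_inter_preimage c.chart.open_target
      (isOpen_extChartAt_source v)
  have hvN : c.chart v ∈ N := ⟨c.chart.map_source hvc, by
    rw [mem_preimage, c.chart.left_inv hvc]; exact mem_extChartAt_source v⟩
  set Θ : E × E → E × E := fun u => e (c.chart.symm u) with hΘ
  have hΘs : ContDiffOn ℝ ∞ Θ N := by
    have h1 : ContMDiffOn 𝓘(ℝ, E × E) 𝓘(ℝ, E × E) ∞ Θ N := by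
      refine ContMDiffOn.comp (t := e.source) ?_ (c.contMDiffOn_symm.mono inter_subset_left)
        fun p hp => hp.2
      rw [he, extChartAt_source]
      exact contMDiffOn_extChartAt (I := 𝓘(ℝ, E).tangent) (x := v)
    exact contMDiffOn_iff_contDiffOn.1 h1
  have hΘa : ContDiffAt ℝ ∞ Θ (c.chart v) := hΘs.contDiffAt (hNo.mem_nhds hvN)
  have hgW : ContDiffAt ℝ ∞ g p₀ := hgs.contDiffAt (hW.mem_nhds hp₀W)
  set B := fderiv ℝ g p₀ with hB
  set T := fderiv ℝ Θ (c.chart v) with hT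
  have hgB : HasFDerivAt g B p₀ := (hgW.differentiableAt (by simp)).hasFDerivAt
  have hΘT : HasFDerivAt Θ T (c.chart v) := (hΘa.differentiableAt (by simp)).hasFDerivAt
  have hLB : ∀ p, c.proj (B p) = p.1 := by
    have h1 : HasFDerivAt (fun p => c.proj (g p)) (c.proj.comp B) p₀ :=
      c.proj.hasFDerivAt.comp p₀ hgB
    have h2 := (hasFDerivAt_fst (𝕜 := ℝ) (p := p₀)).congr_of_eventuallyEq
      (f₁ := fun p => c.proj (g p)) (by
        filter_upwards [hW.mem_nhds hp₀W] with p hp using hLg p hp)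
    exact fun p => congrArg (fun A => A p) (h1.unique h2)
  have hΘg : ∀ p ∈ W, Θ (g p) = tangentCoord v.1 (h p) := by
    intro p hp
    rw [hΘ, hg, hev]
    simp only
    rw [c.chart.left_inv hp.2]
  have hΘB : HasFDerivAt (fun p => tangentCoord v.1 (h p)) (T.comp B) p₀ := by
    have h1 : HasFDerivAt (Θ ∘ g) (T.comp B) p₀ :=
      HasFDerivAt.comp p₀ (by rw [hgp₀]; exact hΘT) hgB
    refine h1.congr_of_eventuallyEq ?_
    filter_upwards [hW.mem_nhds hp₀W] with p hp using (hΘg p hp).symm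
  have hvs : v.1 ∈ (chartAt E v.1).source := mem_chart_source E v.1
  have hvcoord : (tangentCoord v.1 v).2 = (v.2 : E) := tangentTriv_self v.1 v.2
  -- Along the flow the base point moves with velocity `v`. Along dilations, treated next, it is
  -- fixed and the fibre coordinate moves with velocity `v`.
  have hTB1 : (T (B (0, 1, 0))).1 = (v.2 : E) := by
    have h1 : HasDerivAt (fun s : ℝ => ((z₀, s, 1) : EuclideanSpace ℝ (Fin k) × ℝ × ℝ))
        (0, 1, 0) 0 :=
      (hasDerivAt_const _ _).prodMk ((hasDerivAt_id _).prodMk (hasDerivAt_const _ _))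
    have h2 : HasDerivAt (fun s : ℝ => tangentCoord v.1 (h (z₀, s, 1))) (T (B (0, 1, 0))) 0 :=
      HasFDerivAt.comp_hasDerivAt (f := fun s : ℝ =>
        ((z₀, s, 1) : EuclideanSpace ℝ (Fin k) × ℝ × ℝ)) 0 hΘB h1
    obtain ⟨b1, b2, b3⟩ := hΨf v hvU
    have h4 : (Ψ 0 v).1 ∈ (chartAt E v.1).source := by rw [b1]; exact hvs
    have h3 := hasDerivAt_extChartAt_comp_curve (x := v.1) (b2.mdifferentiableAt h0ε) h4
    rw [b3 0 h0ε, b1] at h3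
    have h5 : HasDerivAt (fun s : ℝ => (tangentCoord v.1 (h (z₀, s, 1))).1)
      (T (B (0, 1, 0))).1 0 := h2.fst
    have h6 : (fun s : ℝ => (tangentCoord v.1 (h (z₀, s, 1))).1) =
        extChartAt 𝓘(ℝ, E) v.1 ∘ fun s => (Ψ s v).1 := by
      funext s
      simp only [hh, hσv]
      rfl
    rw [h6] at h5
    exact (h5.unique h3).trans hvcoord
  have hTB2 : T (B (0, 0, 1)) = ((0 : E), (v.2 : E)) := by
    have h1 : HasDerivAt (fun s : ℝ => ((z₀, 0, s) : EuclideanSpace ℝ (Fin k) × ℝ × ℝ))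
        (0, 0, 1) 1 :=
      (hasDerivAt_const _ _).prodMk ((hasDerivAt_const _ _).prodMk (hasDerivAt_id _))
    have h2 : HasDerivAt (fun s : ℝ => tangentCoord v.1 (h (z₀, 0, s))) (T (B (0, 0, 1))) 1 :=
      HasFDerivAt.comp_hasDerivAt (f := fun s : ℝ =>
        ((z₀, 0, s) : EuclideanSpace ℝ (Fin k) × ℝ × ℝ)) 1 hΘB h1
    have h3 : (fun s : ℝ => tangentCoord v.1 (h (z₀, 0, s))) =
        fun s : ℝ => (extChartAt 𝓘(ℝ, E) v.1 v.1, s • (v.2 : E)) := by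
      funext s
      simp only [hh, hσv, (hΨf v hvU).1]
      exact Prod.ext rfl ((tangentTriv_smul hvs s v.2).trans (congrArg (s • ·) hvcoord))
    rw [h3] at h2
    have h4 : ∀ a b : E, HasDerivAt (fun s : ℝ => (a, s • b)) (0, b) 1 := fun a b => by
      simpa using (hasDerivAt_const (1 : ℝ) a).prodMk ((hasDerivAt_id (1 : ℝ)).smul_const b)
    exact h2.unique (h4 _ v.2)
  -- Such a functional exists because `v` is nonzero. Its level sets in position and in velocity cut
  -- the flow and dilation directions transversally.
  obtain ⟨l, hl⟩ : ∃ l : E →L[ℝ] ℝ, l v.2 = 1 := SeparatingDual.exists_eq_one (V := E) hv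
  set P : E × E →L[ℝ] ℝ := l.comp ((ContinuousLinearMap.fst ℝ E E).comp T) with hP
  set Q : E × E →L[ℝ] ℝ := l.comp ((ContinuousLinearMap.snd ℝ E E).comp T) with hQ
  have hP1 : P (B (0, 1, 0)) = 1 := (congrArg l hTB1).trans hl
  have hP2 : P (B (0, 0, 1)) = 0 :=
    (congrArg (fun u : E × E => l u.1) hTB2).trans (map_zero l)
  have hQ2 : Q (B (0, 0, 1)) = 1 := (congrArg (fun u : E × E => l u.2) hTB2).trans hl
  have hBinj : Function.Injective B := injective_of_comp_eq_fst hLB hP1 hP2 hQ2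
  -- The fibre consists of vectors of the class of `v` that lie on the hypersurface and have
  -- velocity normalized by `l`. It is countable, so this submersion is injective to first order.
  have hAinj : Function.Injective (c.proj.prod (P.prod Q)) := by
    have h1 : HasStrictFDerivAt (fun u => (c.proj u, l (Θ u).1, l (Θ u).2))
        (c.proj.prod (P.prod Q)) (c.chart v) := by
      have h2 : HasStrictFDerivAt Θ T (c.chart v) := hΘa.hasStrictFDerivAt (by simp)
      exact c.proj.hasStrictFDerivAt.prodMk
        ((l.hasStrictFDerivAt.comp _ h2.fst).prodMk (l.hasStrictFDerivAt.comp _ h2.snd))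
    refine h1.injective_of_countable_fibre (range_prod_prod_eq_top_of_section hLB hP1 hP2 hQ2)
      (hNo.mem_nhds hvN) ?_
    have h3 := hF.countable_setOf_geodRel v v.1 l (l (tangentCoord v.1 v).1)
    refine (h3.image c.chart).mono ?_
    rintro u ⟨huN, hu⟩
    have hΘv : Θ (c.chart v) = tangentCoord v.1 v := by
      rw [hΘ, hev]; simp only; rw [c.chart.left_inv hvc]
    have hΘu : Θ u = tangentCoord v.1 (c.chart.symm u) := by rw [hΘ, hev]
    have hu' : (c.proj u, l (Θ u).1, l (Θ u).2) =
      (c.proj (c.chart v), l (Θ (c.chart v)).1, l (Θ (c.chart v)).2) := hu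
    rw [hΘv, hΘu] at hu'
    have hu1 : c.proj u = c.proj (c.chart v) := congrArg Prod.fst hu'
    have hu2 := congrArg (fun q => q.2.1) hu'
    have hu3 := congrArg (fun q => q.2.2) hu'
    refine ⟨c.chart.symm u, ⟨?_, hesource.1 huN.2, hu2, ?_⟩, c.chart.right_inv huN.1⟩
    · refine (hF.geodClass_eq_iff _ _).1 ((c.eq_iff _ hvc _ (c.chart.map_target huN.1)).2 ?_)
      rw [c.chart.right_inv huN.1, hu1]
    · exact (hu3 : l _ = l _).trans ((congrArg l hvcoord).trans hl)
  -- Injective linear maps in both directions between `ℝᵏ × ℝ × ℝ` and `E × E` give `k + 2 = 2 dim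
  -- E`.
  have hfin : Module.finrank ℝ (EuclideanSpace ℝ (Fin k) × ℝ × ℝ) = Module.finrank ℝ (E × E) :=
    le_antisymm (LinearMap.finrank_le_finrank_of_injective (f := (B : _ →ₗ[ℝ] E × E)) hBinj)
      (LinearMap.finrank_le_finrank_of_injective
        (f := ((c.proj.prod (P.prod Q) : E × E →L[ℝ] _) : E × E →ₗ[ℝ] _)) hAinj)
  have hk : k + 2 = 2 * Module.finrank ℝ E := by
    simp at hfin
    omega
  refine ⟨?_, hk⟩
  set B' : (EuclideanSpace ℝ (Fin k) × ℝ × ℝ) ≃L[ℝ] E × E :=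
    ((B : _ →ₗ[ℝ] E × E).linearEquivOfInjective hBinj hfin).toContinuousLinearEquiv
    with hB'
  have hgB' : HasFDerivAt g (B' : _ →L[ℝ] E × E) p₀ := by
    have h1 : (B' : _ →L[ℝ] E × E) = B := ContinuousLinearMap.ext fun p =>
      LinearMap.linearEquivOfInjective_apply hBinj hfin p
    rw [h1]
    exact hgB
  obtain ⟨φ, hφ0, hφW, hφg, hφs⟩ :=
    exists_openPartialHomeomorph_contDiffOn_symm hW hgs hp₀W B' hgB'
  set O := c.chart.source ∩ c.chart ⁻¹' φ.target with hO
  -- The inverse of `h`: its three components are the class, the time since the slice and the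
  -- dilation factor.
  set ρ : TangentBundle 𝓘(ℝ, E) M → EuclideanSpace ℝ (Fin k) × ℝ × ℝ :=
    fun x => φ.symm (c.chart x) with hρ
  have hρs : ContMDiffOn 𝓘(ℝ, E).tangent 𝓘(ℝ, EuclideanSpace ℝ (Fin k) × ℝ × ℝ) ∞ ρ O :=
    hφs.contMDiffOn.comp (c.contMDiffOn.mono inter_subset_left) fun x hx => hx.2
  have hρW : ∀ x ∈ O, ρ x ∈ W := fun x hx => hφW (φ.map_target hx.2)
  have hgρ : ∀ x ∈ O, g (ρ x) = c.chart x := fun x hx => by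
    rw [← hφg]; exact φ.right_inv hx.2
  have hhρ : ∀ x ∈ O, h (ρ x) = x := fun x hx =>
    c.chart.injOn (hρW x hx).2 hx.1 (hgρ x hx)
  have hbase : ∀ x ∈ O, (ρ x).1 = c.proj (c.chart x) := fun x hx => by
    rw [← hLg _ (hρW x hx), hgρ x hx]
  have hρh : ∀ p ∈ φ.source, h p ∈ O ∧ ρ (h p) = p := by
    intro p hp
    have h1 : c.chart (h p) = φ p := (hφg p).symm
    refine ⟨⟨(hφW hp).2, ?_⟩, ?_⟩
    · rw [mem_preimage, h1]
      exact φ.map_source hp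
    · simp only [hρ]
      rw [h1, φ.left_inv hp]
  have hρv : ρ v = p₀ := by
    have := (hρh p₀ hφ0).2
    rwa [hhp₀] at this
  have hvO : v ∈ O := by
    have := (hρh p₀ hφ0).1
    rwa [hhp₀] at this
  have hρv1 : (ρ v).1 = z₀ := by rw [hρv]
  refine ⟨{
    domain := O
    base := fun x => (ρ x).1
    time := fun x => (ρ x).2.1
    scale := fun x => (ρ x).2.2
    sect := c.localSection v
    isOpen := c.contMDiffOn.continuousOn.isOpen_inter_preimage c.chart.open_source φ.open_target
    mem := hvO
    contMDiffOn_base := contDiff_fst.contMDiff.comp_contMDiffOn hρs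
    contMDiffOn_time := (contDiff_fst.comp contDiff_snd).contMDiff.comp_contMDiffOn hρs
    contMDiffOn_scale := (contDiff_snd.comp contDiff_snd).contMDiff.comp_contMDiffOn hρs
    contMDiffAt_sect := ?_
    sect_base := ?_
    eventually_sect := ?_
    scale_ne_zero := fun x hx => (hρW x hx).1.2.2
    sect_ne_zero := fun x hx => hne _ (c.localSection_mem_source v (hρW x hx).1.1.1)
    exists_geodesic := ?_
    geodRel_iff := ?_ }⟩
  · rw [hρv1]
    exact (c.contMDiffOn_localSection v).contMDiffAt
      ((c.isOpen_sectionDomain v).mem_nhds (c.mem_sectionDomain v hvc))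
  · rw [hρv1]
    exact hσv
  · rw [hρv1]
    have h1 : ContinuousAt (fun z : EuclideanSpace ℝ (Fin k) => ((z, 0, 1) :
      EuclideanSpace ℝ (Fin k) × ℝ × ℝ)) z₀ := by fun_prop
    filter_upwards [h1.eventually_mem (φ.open_source.mem_nhds hφ0)] with z hz
    obtain ⟨h2, h3⟩ := hρh _ hz
    have h4 : h (z, 0, 1) = c.localSection v z := by
      simp only [hh, one_fiberSMul]
      exact (hΨf _ (hφW hz).1.1.2).1
    rw [h4] at h2 h3
    exact ⟨h2, congrArg (fun p => p.1) h3, congrArg (fun p => p.2.1) h3,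
      congrArg (fun p => p.2.2) h3⟩
  · intro x hx
    obtain ⟨γ, J, hγ, h0, ht, hl, hhp⟩ := hgeod _ (hρW x hx).1
    exact ⟨γ, J, hγ, h0, ht, hl, by rw [← hhp, hhρ x hx]⟩
  · intro x hx x' hx'
    rw [← hF.geodClass_eq_iff, c.eq_iff x hx.1 x' hx'.1, hbase x hx, hbase x' hx']

end Slice

/-! ### Linearizing charts for pairs without closed geodesics -/

section ProductCharts

set_option linter.unusedSectionVars false

variable {E₁ : Type*} [NormedAddCommGroup E₁] [NormedSpace ℝ E₁] [FiniteDimensional ℝ E₁]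
  {M₁ : Type*} [TopologicalSpace M₁] [ChartedSpace E₁ M₁] [IsManifold 𝓘(ℝ, E₁) ∞ M₁]
  {E₂ : Type*} [NormedAddCommGroup E₂] [NormedSpace ℝ E₂] [FiniteDimensional ℝ E₂]
  {M₂ : Type*} [TopologicalSpace M₂] [ChartedSpace E₂ M₂] [IsManifold 𝓘(ℝ, E₂) ∞ M₂]
  {cov₁ : CovariantDerivative 𝓘(ℝ, E₁) E₁ (TangentSpace 𝓘(ℝ, E₁) : M₁ → Type _)}
  {cov₂ : CovariantDerivative 𝓘(ℝ, E₂) E₂ (TangentSpace 𝓘(ℝ, E₂) : M₂ → Type _)}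

lemma eq_one_of_fiberSMul_eq {c : ℝ} {v : TangentBundle 𝓘(ℝ, E₁) M₁} (h : fiberSMul c v = v)
    (hv : v.2 ≠ 0) : c = 1 := by
  have h1 : c • v.2 = v.2 := TotalSpace.mk_inj.1 h
  have h2 : (c - 1) • v.2 = 0 := by rw [sub_smul, one_smul, h1, sub_self]
  exact sub_eq_zero.1 ((smul_eq_zero.1 h2).resolve_right hv)

/-- Without closed geodesics in the first factor, two related pairs with the same nonzero first
component are equal. -/
lemma PairRel.snd_eq_of_fst_eq (hcl : ¬ HasClosedGeodesic cov₁) {u : TangentBundle 𝓘(ℝ, E₁) M₁}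
    {z z' : TangentBundle 𝓘(ℝ, E₂) M₂} (hu : u.2 ≠ 0) (h : PairRel cov₁ cov₂ (u, z) (u, z')) :
    z = z' := by
  obtain ⟨γ₁, γ₂, J, h1, h2, s, hs, t, ht, h3, h4, c, hc, h5, h6⟩ := h
  simp only at h3 h4 h5 h6
  have hv : velocity 𝓘(ℝ, E₁) γ₁ t ≠ 0 := by
    intro h0
    have h7 : c • velocity 𝓘(ℝ, E₁) γ₁ t = 0 := by rw [h0, smul_zero]
    refine hu ?_
    rw [h5]
    exact h7
  -- The first geodesic is back at the line of `u`, so without closed geodesics no time has passed.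
  -- Then the dilation fixes `u ≠ 0`, hence its factor is one, and the second component has not
  -- moved either.
  have hst := eq_of_not_hasClosedGeodesic hcl h1 ht hs hv hc (h3.trans h5)
  subst hst
  rw [h3] at h5
  rw [h6, eq_one_of_fiberSMul_eq h5.symm hu, one_fiberSMul, h4]

/-- If the first factor has no closed geodesic, the pairs of geodesics form a manifold near the
pairs with nonconstant first component. -/
lemma exists_linearQuotientChart_pairClass (h₁ : HasFlow cov₁) (h₂ : HasFlow cov₂)
    (hcl : ¬ HasClosedGeodesic cov₁) {k n : ℕ}
    {v : TangentBundle 𝓘(ℝ, E₁) M₁ × TangentBundle 𝓘(ℝ, E₂) M₂}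
    (S : GeodesicSlice cov₁ k v.1) (hn : k + 2 * Module.finrank ℝ E₂ = n) :
    ∃ c : LinearQuotientChart (𝓘(ℝ, E₁).tangent.prod 𝓘(ℝ, E₂).tangent) n
      (pairClass cov₁ cov₂), v ∈ c.chart.source := by
  obtain ⟨ε, hε, U, hU, hvU, Ψ, hΨ, hΨf⟩ := h₂.flow v.2
  have h0ε : (0 : ℝ) ∈ Ioo (-ε) ε := ⟨by linarith, hε⟩
  set e := extChartAt 𝓘(ℝ, E₂).tangent v.2 with he
  obtain ⟨hv0, hvb⟩ : S.time v.1 = 0 ∧ S.scale v.1 = 1 := by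
    have := S.eventually_sect.self_of_nhds
    rw [S.sect_base] at this
    exact this.2.2
  -- the translation of the second component along its geodesic to the slice
  set Z : TangentBundle 𝓘(ℝ, E₁) M₁ × TangentBundle 𝓘(ℝ, E₂) M₂ → TangentBundle 𝓘(ℝ, E₂) M₂ :=
    fun x => Ψ (-S.time x.1) (fiberSMul (S.scale x.1)⁻¹ x.2) with hZ
  set A : TangentBundle 𝓘(ℝ, E₁) M₁ × TangentBundle 𝓘(ℝ, E₂) M₂ →
      ℝ × TangentBundle 𝓘(ℝ, E₂) M₂ :=
    fun x => (-S.time x.1, fiberSMul (S.scale x.1)⁻¹ x.2) with hA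
  set O : Set (TangentBundle 𝓘(ℝ, E₁) M₁ × TangentBundle 𝓘(ℝ, E₂) M₂) := S.domain ×ˢ univ with hO
  have hOo : IsOpen O := S.isOpen.prod isOpen_univ
  have hfst : ContMDiffOn (𝓘(ℝ, E₁).tangent.prod 𝓘(ℝ, E₂).tangent) 𝓘(ℝ, E₁).tangent ∞
    (fun x : TangentBundle 𝓘(ℝ, E₁) M₁ × TangentBundle 𝓘(ℝ, E₂) M₂ => x.1) O :=
    contMDiff_fst.contMDiffOn
  have hsnd : ContMDiffOn (𝓘(ℝ, E₁).tangent.prod 𝓘(ℝ, E₂).tangent) 𝓘(ℝ, E₂).tangent ∞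
    (fun x : TangentBundle 𝓘(ℝ, E₁) M₁ × TangentBundle 𝓘(ℝ, E₂) M₂ => x.2) O :=
    contMDiff_snd.contMDiffOn
  have hAs : ContMDiffOn (𝓘(ℝ, E₁).tangent.prod 𝓘(ℝ, E₂).tangent)
      (𝓘(ℝ, ℝ).prod 𝓘(ℝ, E₂).tangent) ∞ A O := by
    have h1 : ContMDiffOn (𝓘(ℝ, E₁).tangent.prod 𝓘(ℝ, E₂).tangent) 𝓘(ℝ, ℝ) ∞
        (fun x : TangentBundle 𝓘(ℝ, E₁) M₁ × TangentBundle 𝓘(ℝ, E₂) M₂ => -S.time x.1) O :=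
      (contDiff_neg.contMDiff (n := ∞)).comp_contMDiffOn
        (S.contMDiffOn_time.comp hfst fun x hx => hx.1)
    have h2 : ContMDiffOn (𝓘(ℝ, E₁).tangent.prod 𝓘(ℝ, E₂).tangent) 𝓘(ℝ, ℝ) ∞
        (fun x : TangentBundle 𝓘(ℝ, E₁) M₁ × TangentBundle 𝓘(ℝ, E₂) M₂ => (S.scale x.1)⁻¹) O :=
      (S.contMDiffOn_scale.comp hfst fun x hx => hx.1).inv₀ fun x hx => S.scale_ne_zero _ hx.1
    exact h1.prodMk (contMDiff_fiberSMul.comp_contMDiffOn (h2.prodMk hsnd))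
  set O₁ := O ∩ A ⁻¹' (Ioo (-ε) ε ×ˢ U) with hO₁
  have hO₁o : IsOpen O₁ := hAs.continuousOn.isOpen_inter_preimage hOo (isOpen_Ioo.prod hU)
  have hZs : ContMDiffOn (𝓘(ℝ, E₁).tangent.prod 𝓘(ℝ, E₂).tangent) 𝓘(ℝ, E₂).tangent ∞ Z O₁ :=
    hΨ.comp (hAs.mono inter_subset_left) fun x hx => hx.2
  set O₂ := O₁ ∩ Z ⁻¹' e.source with hO₂
  have hO₂o : IsOpen O₂ :=
    hZs.continuousOn.isOpen_inter_preimage hO₁o (isOpen_extChartAt_source v.2)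
  have hZsect : ∀ u, S.time u = 0 → S.scale u = 1 → ∀ w ∈ U, Z (u, w) = w := by
    intro u h1 h2 w hw
    simp only [hZ]
    rw [h1, h2, neg_zero, inv_one, one_fiberSMul, (hΨf w hw).1]
  have hmem : ∀ u ∈ S.domain, S.time u = 0 → S.scale u = 1 → ∀ w ∈ U, w ∈ e.source →
      (u, w) ∈ O₂ := by
    intro u hu h1 h2 w hw hwe
    refine ⟨⟨⟨hu, mem_univ _⟩, ?_⟩, ?_⟩
    · simp only [hA, mem_preimage]
      rw [h1, h2, neg_zero, inv_one, one_fiberSMul]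
      exact ⟨h0ε, hw⟩
    · rw [mem_preimage, hZsect u h1 h2 w hw]
      exact hwe
  have hve : v.2 ∈ e.source := mem_extChartAt_source v.2
  have hvO : v ∈ O₂ := hmem v.1 S.mem hv0 hvb v.2 hvU hve
  have hZv : Z v = v.2 := hZsect v.1 hv0 hvb v.2 hvU
  -- every pair is related to its translate
  have hrel : ∀ x ∈ O₂, PairRel cov₁ cov₂ (S.sect (S.base x.1), Z x) x := by
    rintro x ⟨⟨⟨hx, -⟩, hxA⟩, -⟩
    obtain ⟨γ, J, hγ, h0, ht, hl, hxγ⟩ := S.exists_geodesic x.1 hx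
    obtain ⟨b1, b2, b3⟩ := hΨf _ hxA.2
    have hc := S.scale_ne_zero _ hx
    set β : ℝ → M₂ := fun s => (Ψ s (fiberSMul (S.scale x.1)⁻¹ x.2)).1 with hβ
    have hβ' := b2.comp_affine 1 (-S.time x.1)
    have m0 : 1 * (0 : ℝ) + -S.time x.1 ∈ Ioo (-ε) ε := by
      rw [mul_zero, zero_add]
      exact hxA.1
    have m1 : 1 * S.time x.1 + -S.time x.1 ∈ Ioo (-ε) ε := by simpa using h0ε
    refine ⟨γ, fun s => β (1 * s + -S.time x.1), _,
      (isGeodesicOn_inter hγ hβ'.isOpen hβ'.ordConnected).1,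
      (isGeodesicOn_inter hβ' hγ.isOpen hγ.ordConnected).2, 0, ⟨h0, m0⟩, S.time x.1, ⟨ht, m1⟩, hl,
      ?_, S.scale x.1, hc, hxγ, ?_⟩
    · rw [b2.curveLift_comp_affine m0, one_fiberSMul, b3 _ m0]
      rw [mul_zero, zero_add]
    · rw [b2.curveLift_comp_affine m1, one_fiberSMul, b3 _ m1, one_mul, add_neg_cancel, b1]
      simp only [hA]
      rw [fiberSMul_fiberSMul, mul_inv_cancel₀ hc, one_fiberSMul]
  have hes : ContMDiffOn 𝓘(ℝ, E₂).tangent 𝓘(ℝ, E₂ × E₂) ∞ e e.source := by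
    rw [he, extChartAt_source]
    exact contMDiffOn_extChartAt (I := 𝓘(ℝ, E₂).tangent) (x := v.2)
  -- The complete invariant of the class of a pair: the geodesic of the first component, and the
  -- second component at the moment when the first is in the slice.
  set f : TangentBundle 𝓘(ℝ, E₁) M₁ × TangentBundle 𝓘(ℝ, E₂) M₂ →
      EuclideanSpace ℝ (Fin k) × (E₂ × E₂) := fun x => (S.base x.1, e (Z x)) with hf
  have hfs : ContMDiffOn (𝓘(ℝ, E₁).tangent.prod 𝓘(ℝ, E₂).tangent)
      𝓘(ℝ, EuclideanSpace ℝ (Fin k) × (E₂ × E₂)) ∞ f O₂ := by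
    have h1 : ContMDiffOn (𝓘(ℝ, E₁).tangent.prod 𝓘(ℝ, E₂).tangent) (𝓡 k) ∞
        (fun x : TangentBundle 𝓘(ℝ, E₁) M₁ × TangentBundle 𝓘(ℝ, E₂) M₂ => S.base x.1) O₂ :=
      S.contMDiffOn_base.comp (hfst.mono (inter_subset_left.trans inter_subset_left))
        fun x hx => hx.1.1.1
    have h2 : ContMDiffOn (𝓘(ℝ, E₁).tangent.prod 𝓘(ℝ, E₂).tangent) 𝓘(ℝ, E₂ × E₂) ∞
        (fun x => e (Z x)) O₂ := hes.comp (hZs.mono inter_subset_left) fun x hx => hx.2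
    exact h1.prodMk_space h2
  -- Pairs with first component already in the slice are their own translates, so they form a
  -- section of `f`.
  set σ : EuclideanSpace ℝ (Fin k) × (E₂ × E₂) →
      TangentBundle 𝓘(ℝ, E₁) M₁ × TangentBundle 𝓘(ℝ, E₂) M₂ :=
    fun p => (S.sect p.1, e.symm p.2) with hσ
  have hfv : f v = (S.base v.1, e v.2) := by simp only [hf]; rw [hZv]
  have htgt : e.target ∈ 𝓝 (e v.2) := extChartAt_target_mem_nhds v.2
  have hes' : ContMDiffAt 𝓘(ℝ, E₂ × E₂) 𝓘(ℝ, E₂).tangent ∞ e.symm (e v.2) :=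
    (contMDiffOn_extChartAt_symm v.2).contMDiffAt htgt
  refine exists_linearQuotientChart_of_section _ (F := EuclideanSpace ℝ (Fin k) × (E₂ × E₂))
    ?_ hO₂o hvO hfs (σ := σ) ?_ ?_ ?_ ?_
  · simp
    omega
  · rw [hfv]
    have h1 : ContMDiffAt 𝓘(ℝ, EuclideanSpace ℝ (Fin k) × (E₂ × E₂)) 𝓘(ℝ, E₁).tangent ∞
        (fun p : EuclideanSpace ℝ (Fin k) × (E₂ × E₂) => S.sect p.1) (S.base v.1, e v.2) :=
      S.contMDiffAt_sect.comp (S.base v.1, e v.2)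
        (f := fun p : EuclideanSpace ℝ (Fin k) × (E₂ × E₂) => p.1) contDiff_fst.contMDiff.contMDiffAt
    have h2 : ContMDiffAt 𝓘(ℝ, EuclideanSpace ℝ (Fin k) × (E₂ × E₂)) 𝓘(ℝ, E₂).tangent ∞
        (fun p : EuclideanSpace ℝ (Fin k) × (E₂ × E₂) => e.symm p.2) (S.base v.1, e v.2) :=
      hes'.comp (S.base v.1, e v.2)
        (f := fun p : EuclideanSpace ℝ (Fin k) × (E₂ × E₂) => p.2) contDiff_snd.contMDiff.contMDiffAt
    exact (h1.prodMk h2).of_le (by simp)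
  · rw [hfv]
    exact Prod.ext S.sect_base (e.left_inv hve)
  · rw [hfv]
    have h1 : ∀ᶠ p : E₂ × E₂ in 𝓝 (e v.2), p ∈ e.target ∧ e.symm p ∈ U := by
      refine Filter.Eventually.and htgt (hes'.continuousAt.eventually_mem ?_)
      rw [e.left_inv hve]
      exact hU.mem_nhds hvU
    rw [nhds_prod_eq]
    filter_upwards [S.eventually_sect.prod_mk h1] with p hp
    obtain ⟨⟨c1, c2, c3, c4⟩, c5, c6⟩ := hp
    refine Prod.ext c2 ?_
    change e (Z (S.sect p.1, e.symm p.2)) = p.2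
    rw [hZsect _ c3 c4 _ c6, e.right_inv c5]
  · intro x hx x' hx'
    have hsym : ∀ {a b}, PairRel cov₁ cov₂ a b → PairRel cov₁ cov₂ b a := fun h =>
      (pairClass_eq_iff h₁ h₂ _ _).1 ((pairClass_eq_iff h₁ h₂ _ _).2 h).symm
    have hx1 := (pairClass_eq_iff h₁ h₂ _ _).2 (hrel x hx)
    have hx1' := (pairClass_eq_iff h₁ h₂ _ _).2 (hrel x' hx')
    constructor
    · intro h
      -- Related pairs have the same first geodesic. Their translates are then related pairs with
      -- the same nonzero first component, and so they are equal.
      have h1 := (S.geodRel_iff _ hx.1.1.1 _ hx'.1.1.1).1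
        ((pairClass_eq_iff h₁ h₂ _ _).1 h).geodRel_fst
      have h2 := (pairClass_eq_iff h₁ h₂ _ _).1 ((hx1.trans h).trans hx1'.symm)
      rw [← h1] at h2
      have h3 := h2.snd_eq_of_fst_eq hcl (S.sect_ne_zero _ hx.1.1.1)
      exact Prod.ext h1 (congrArg e h3)
    · intro h
      have h1 : S.base x.1 = S.base x'.1 := congrArg Prod.fst h
      have h2 : Z x = Z x' := e.injOn hx.2 hx'.2 (congrArg Prod.snd h)
      rw [h1, h2] at hx1
      exact hx1.symm.trans hx1'

end ProductCharts

/-! ### The theorem -/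

theorem mainTheorem4
    {E₁ : Type*} [NormedAddCommGroup E₁] [NormedSpace ℝ E₁] [FiniteDimensional ℝ E₁]
    [Nontrivial E₁]
    {M₁ : Type*} [TopologicalSpace M₁] [ChartedSpace E₁ M₁] [IsManifold 𝓘(ℝ, E₁) ∞ M₁]
    [T2Space M₁] [ParacompactSpace M₁] [ConnectedSpace M₁]
    {E₂ : Type*} [NormedAddCommGroup E₂] [NormedSpace ℝ E₂] [FiniteDimensional ℝ E₂]
    [Nontrivial E₂]
    {M₂ : Type*} [TopologicalSpace M₂] [ChartedSpace E₂ M₂] [IsManifold 𝓘(ℝ, E₂) ∞ M₂]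
    [T2Space M₂] [ParacompactSpace M₂] [ConnectedSpace M₂]
    (cov₁ : CovariantDerivative 𝓘(ℝ, E₁) E₁ (TangentSpace 𝓘(ℝ, E₁) : M₁ → Type _))
    [CovariantDerivative.ContMDiffCovariantDerivative cov₁ ∞]
    (cov₂ : CovariantDerivative 𝓘(ℝ, E₂) E₂ (TangentSpace 𝓘(ℝ, E₂) : M₂ → Type _))
    [CovariantDerivative.ContMDiffCovariantDerivative cov₂ ∞]
    (hG₁ : GeodesicSpaceLocallyEuclidean cov₁)
    (hG₂ : GeodesicSpaceLocallyEuclidean cov₂) :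
    GeodesicSpaceLocallyEuclidean (prodConnection cov₁ cov₂) ↔
      ¬ HasClosedGeodesic cov₁ ∧ ¬ HasClosedGeodesic cov₂ := by
  have h₁ := hasFlow_of_contMDiff cov₁
  have h₂ := hasFlow_of_contMDiff cov₂
  have hF := h₁.prodConnection h₂
  set eqv := equivTangentBundleProd 𝓘(ℝ, E₁) M₁ 𝓘(ℝ, E₂) M₂ with heqv
  constructor
  · intro h
    obtain ⟨k, hk⟩ := hF.exists_linearQuotientChart_of_locallyEuclidean h
    have key : ∀ v : TangentBundle 𝓘(ℝ, E₁) M₁ × TangentBundle 𝓘(ℝ, E₂) M₂,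
        (v.1.2 ≠ 0 ∨ v.2.2 ≠ 0) →
        ∃ c : LinearQuotientChart (𝓘(ℝ, E₁).tangent.prod 𝓘(ℝ, E₂).tangent) k
          (pairClass cov₁ cov₂), v ∈ c.chart.source := by
      intro v hv
      have hV : (eqv.symm v).2 ≠ 0 := by
        intro h0
        rcases hv with hv | hv
        · exact hv (congrArg (fun u : E₁ × E₂ => u.1) h0)
        · exact hv (congrArg (fun u : E₁ × E₂ => u.2) h0)
      obtain ⟨c, hc, -⟩ := hk _ hV
      have h1 := (exists_linearQuotientChart_pairClass_iff h₁ h₂ (eqv.symm v)).2 ⟨c, hc⟩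
      rwa [← heqv, eqv.apply_symm_apply] at h1
    -- The second factor is treated by the same argument after exchanging the components of the
    -- pairs.
    refine ⟨not_hasClosedGeodesic_of_exists_linearQuotientChart h₁ h₂
      fun v hv => key v (Or.inl hv), not_hasClosedGeodesic_of_exists_linearQuotientChart (k := k) h₂ h₁
      fun v hv => ?_⟩
    exact exists_linearQuotientChart_pairClass_swap h₁ h₂ (key v.swap (Or.inr hv))
  · rintro ⟨hcl₁, hcl₂⟩
    obtain ⟨k₁, hk₁⟩ := h₁.exists_linearQuotientChart_of_locallyEuclidean hG₁
    obtain ⟨k₂, hk₂⟩ := h₂.exists_linearQuotientChart_of_locallyEuclidean hG₂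
    -- Two less than the dimension of the tangent bundle of the product. The slice gives `kᵢ + 2 = 2
    -- dim Mᵢ`, so `kᵢ` plus twice the dimension of the other factor is this number in either case.
    refine hF.geodesicSpaceLocallyEuclidean
      (k := 2 * Module.finrank ℝ E₁ + 2 * Module.finrank ℝ E₂ - 2) fun V hV => ?_
    refine (exists_linearQuotientChart_pairClass_iff h₁ h₂ V).1 ?_
    -- The slice is taken in a factor where the component of `V` is nonzero, and it is the absence
    -- of closed geodesics in that factor that is used.
    by_cases h0 : (eqv V).1.2 = 0
    · have hV2 : (eqv V).2.2 ≠ 0 := fun h0' =>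
        hV (Prod.ext (show (_ : E₁) = 0 from h0) (show (_ : E₂) = 0 from h0'))
      obtain ⟨c, hc, hne⟩ := hk₂ _ hV2
      obtain ⟨⟨S⟩, hk⟩ := h₂.exists_geodesicSlice hV2 c hc hne
      exact exists_linearQuotientChart_pairClass_swap h₂ h₁
        (exists_linearQuotientChart_pairClass (v := (eqv V).swap) h₂ h₁ hcl₂ S (by omega))
    · obtain ⟨c, hc, hne⟩ := hk₁ _ h0
      obtain ⟨⟨S⟩, hk⟩ := h₁.exists_geodesicSlice h0 c hc hne
      exact exists_linearQuotientChart_pairClass (v := eqv V) h₁ h₂ hcl₁ S (by omega)
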